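/- Let $\Sigma$ be a finite alphabet and $k,k'\ge 1$. A hyperproperty over $\Sigma$ is a set $\mathbf S\subseteq\mathcal P(\Sigma^\omega)$. For $T\subseteq\Sigma^*$ and $T'\subseteq\Sigma^\omega$ write $T\le T'$ if every $t\in T$ is a prefix of some $t'\in T'$. A set $T\subseteq\Sigma^*$ is a bad prefix of $\mathbf S$ if $T'\notin\mathbf S$ for all $T'\subseteq\Sigma^\omega$ with $T\le T'$; and $\mathbf S$ is a $j$-safety hyperproperty if for every $T'\notin\mathbf S$ there is a bad prefix $T$ of $\mathbf S$ with $T\le T'$ and $|T|\le j$. For a word $\sigma\in(\Sigma^k)^*$ let $\mathrm{unzip}(\sigma)\subseteq\Sigma^*$ be the set of its $k$ component words. A finite automaton $\mathcal A$ over $\Sigma^k$ is a ($k$-)bad-prefix automaton for $\mathbf S$ if $\mathrm{unzip}(\sigma)$ is a bad prefix of $\mathbf S$ for every $\sigma\in L(\mathcal A)$, and for all $T\subseteq\Sigma^\omega$: $T\notin\mathbf S$ if and only if $\mathrm{unzip}(\sigma)\le T$ for some $\sigma\in L(\mathcal A)$. For deterministic finite automata $\mathcal A_k$ over $\Sigma^k$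 and $\mathcal A_{k'}$ over $\Sigma^{k'}$ (in which a state has at most one successor for each letter), $\mathcal A_k\equiv\mathcal A_{k'}$ (representation-equivalence) means that, for some $j\le\min(k,k')$, both are bad-prefix automata for the same $j$-safety hyperproperty. Let $|\mathcal A|$ be the number of states of $\mathcal A$. Algorithms are programs of a random access machine with a read-only input (which consists of $|\Sigma|$, $k$, $k'$ and the tables of the two automata); time is the number of elementary steps, and space is the number of memory words used. Then representation-equivalence is decidable, by programs that work for all $\Sigma,k,k'$, as follows. (1) There is a deterministic program that decides whether $\mathcal A_k\equiv\mathcal A_{k'}$ in time $\mathrm{poly}(|\mathcal A_k|+|\mathcal A_{k'}|)$, with words of value at most $\mathrm{poly}(|\mathcal A_k|+|\mathcal A_{k'}|)$, where the polynomial may depend on $|\Sigma|$, $k$ and $k'$. (2) There is a nondeterministic program, all of whose runs halt and which has a run that ends with the answer "no" if and only if $\mathcal A_k\not\equiv\mathcal A_{k'}$, all of whose runs take at the same time only time $\mathrm{poly}(|\mathcal A_k|+|\mathcal A_{k'}|)$, where the polynomial may depend on $|\Sigma|$, $k$ and $k'$, and space $2^{O(\max(\log k,\log k')\cdot\max(k,k'))}$,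 that is, at most $C\cdot 2^{C\max(\log_2 k,\log_2 k')\max(k,k')}$ words with an absolute constant $C$; each word has a value at most $(N+m^m)^C$, where $N$ is the length of the input and $m=\max(k,k')$. -/

import Mathlib

namespace HyperAut

section Hyperproperties

variable {α : Type*}

/-- The finite trace `t` is a prefix of the infinite trace `τ`. -/
def IsPrefix (t : List α) (τ : ℕ → α) : Prop :=
  ∀ (i : ℕ) (h : i < t.length), t[i] = τ i

/-- The prefix relation `T ≤ T'` between a set of finite traces and a set of infinite traces. -/
def SetPrefix (T : Set (List α)) (T' : Set (ℕ → α)) : Prop :=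
  ∀ t ∈ T, ∃ t' ∈ T', IsPrefix t t'

/-- The bad prefixes of a hyperproperty `S` (a set of sets of infinite traces). -/
def bad (S : Set (Set (ℕ → α))) : Set (Set (List α)) :=
  {T | ∀ T' : Set (ℕ → α), SetPrefix T T' → T' ∉ S}

/-- The bad prefixes that consist of at most `k` traces. -/
def badK (S : Set (Set (ℕ → α))) (k : ℕ) : Set (Set (List α)) :=
  {T | T ∈ bad S ∧ T.encard ≤ k}

/-- Hypersafety: every violating set of traces has a (finite) bad prefix. -/
def IsHypersafety (S : Set (Set (ℕ → α))) : Prop :=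
  ∀ T' : Set (ℕ → α), T' ∉ S → ∃ T : Set (List α), T.Finite ∧ SetPrefix T T' ∧ T ∈ bad S

/-- `k`-safety hyperproperties. -/
def IsKSafety (k : ℕ) (S : Set (Set (ℕ → α))) : Prop :=
  IsHypersafety S ∧ ∀ T' : Set (ℕ → α), T' ∉ S → ∃ T ∈ badK S k, SetPrefix T T'

/-- The set of the `k` component traces of a word over `k`-tuples. -/
def unzip {k : ℕ} (σ : List (Fin k → α)) : Set (List α) :=
  Set.range fun i : Fin k => σ.map fun v => v i

/-- `L` is a `k`-representation of `S`: its words represent bad prefixes of `S`, and a set of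
traces violates `S` iff one of these bad prefixes is a prefix of it. -/
def IsRepresentation {k : ℕ} (L : Language (Fin k → α)) (S : Set (Set (ℕ → α))) : Prop :=
  (∀ σ ∈ L, unzip σ ∈ bad S) ∧
    ∀ T : Set (ℕ → α), T ∉ S ↔ ∃ σ ∈ L, SetPrefix (unzip σ) T ∧ unzip σ ∈ bad S

end Hyperproperties

section Automata

/-- A deterministic finite automaton over the alphabet `α` with the `n` states `Fin n`:
in each state there is at most one successor for each letter. -/
structure DetAut (α : Type*) (n : ℕ) where
  start : Fin n
  step : Fin n → α → Option (Fin n)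
  accept : Fin n → Bool

variable {α : Type*}

/-- The automaton as a nondeterministic automaton. -/
def DetAut.toNFA {n : ℕ} (A : DetAut α n) : NFA α (Fin n) where
  step q a := {q' | A.step q a = some q'}
  start := {A.start}
  accept := {q | A.accept q = true}

/-- `A` is a `k`-bad-prefix automaton for the hyperproperty `S`. -/
def IsBadPrefixAut {k n : ℕ} (A : DetAut (Fin k → α) n) (S : Set (Set (ℕ → α))) : Prop :=
  IsRepresentation A.toNFA.accepts S

/-- Representation-equivalence: both automata are bad-prefix automata for the same `j`-safety
hyperproperty, for some `j` that is at most both arities. -/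
def RepEquiv {k k' n n' : ℕ} (A : DetAut (Fin k → α) n) (A' : DetAut (Fin k' → α) n') : Prop :=
  ∃ j : ℕ, j ≤ k ∧ j ≤ k' ∧ ∃ S : Set (Set (ℕ → α)),
    IsKSafety j S ∧ IsBadPrefixAut A S ∧ IsBadPrefixAut A' S

end Automata

section Machine

/-- Work memory of a random access machine: a word in each cell. -/
abbrev Mem := ℕ → ℕ

/-- Elementary instructions; the arguments are addresses of memory cells (`c` is a constant). -/
inductive Instr where
  | const (i c : ℕ)
  | add (i j l : ℕ)
  | sub (i j l : ℕ)
  | mul (i j l : ℕ)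
  | div (i j l : ℕ)
  | mod (i j l : ℕ)
  | load (i j : ℕ)
  | store (i j : ℕ)
  | input (i j : ℕ)
  | guess (i j : ℕ)

/-- The possible memories after executing one instruction; `inp` is the read-only input.
`load` and `store` are indirect, `input i j` reads the entry of the input whose position is in
cell `j`, and `guess i j` puts an arbitrary number `v ≤ M j` into cell `i`. -/
def Instr.exec (inp : List ℕ) : Instr → Mem → Set Mem
  | .const i c, M => {Function.update M i c}
  | .add i j l, M => {Function.update M i (M j + M l)}
  | .sub i j l, M => {Function.update M i (M j - M l)}
  | .mul i j l, M => {Function.update M i (M j * M l)}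
  | .div i j l, M => {Function.update M i (M j / M l)}
  | .mod i j l, M => {Function.update M i (M j % M l)}
  | .load i j, M => {Function.update M i (M (M j))}
  | .store i j, M => {Function.update M (M i) (M j)}
  | .input i j, M => {Function.update M i (inp.getD (M j) 0)}
  | .guess i j, M => {M' | ∃ v, v ≤ M j ∧ M' = Function.update M i v}

/-- Programs; `ite i p q` and `loop i p` (a while loop) test whether cell `i` is nonzero. -/
inductive Prog where
  | instr (a : Instr)
  | seq (p q : Prog)
  | ite (i : ℕ) (p q : Prog)
  | loop (i : ℕ) (p : Prog)

/-- The program contains no `guess`. -/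
def Prog.Deterministic : Prog → Prop
  | .instr (.guess _ _) => False
  | .instr _ => True
  | .seq p q => p.Deterministic ∧ q.Deterministic
  | .ite _ p q => p.Deterministic ∧ q.Deterministic
  | .loop _ p => p.Deterministic

/-- The parts of the program still to be executed, and the memory.
The machine has halted when the list is empty. -/
abbrev Config := List Prog × Mem

/-- The possible successors of a configuration in one step. -/
def Config.next (inp : List ℕ) : Config → Set Config
  | ([], _) => ∅
  | (.instr a :: K, M) => {c | ∃ M' ∈ a.exec inp M, c = (K, M')}
  | (.seq p q :: K, M) => {(p :: q :: K, M)}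
  | (.ite i p q :: K, M) => {(if M i ≠ 0 then p :: K else q :: K, M)}
  | (.loop i p :: K, M) => {(if M i ≠ 0 then p :: .loop i p :: K else K, M)}

/-- `Run P inp t c`: the program `P` started on the input `inp`, with all memory cells zero,
can be in the configuration `c` after exactly `t` steps. -/
inductive Run (P : Prog) (inp : List ℕ) : ℕ → Config → Prop where
  | init : Run P inp 0 ([P], fun _ => 0)
  | step {t : ℕ} {c c' : Config} : Run P inp t c → c' ∈ Config.next inp c → Run P inp (t + 1) c'

/-- Every run has at most `t` steps; as every configuration that has not halted has a
successor, every run then halts. -/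
def HaltsWithin (P : Prog) (inp : List ℕ) (T : ℕ) : Prop :=
  ∀ t c, Run P inp t c → t ≤ T

/-- At all times, all memory cells contain numbers at most `W`. -/
def WordsAtMost (P : Prog) (inp : List ℕ) (W : ℕ) : Prop :=
  ∀ t c, Run P inp t c → ∀ a, c.2 a ≤ W

/-- At all times, all memory cells other than the first `B` ones are unused. -/
def SpaceAtMost (P : Prog) (inp : List ℕ) (B : ℝ) : Prop :=
  ∀ t c, Run P inp t c → ∀ a : ℕ, B ≤ (a : ℝ) → c.2 a = 0

/-- Every halting run ends with the answer "yes", a nonzero number in cell `0`. For a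
deterministic program there is at most one halting run. For a program with `guess` this is the
usual convention for a search for a counterexample: "no" is the answer iff some run finds one. -/
def AnswersYes (P : Prog) (inp : List ℕ) : Prop :=
  ∀ t M, Run P inp t ([], M) → M 0 ≠ 0

end Machine

section Encoding

/-- The automaton as a list of numbers: number of states, initial state, the table of accepting
states, and the transition table. The entry for the state `q` and the letter `v` has position
`q * s ^ k + ∑ i, v i * s ^ i` in the transition table, and is `n` if there is no transition. -/
def encodeAut {s k n : ℕ} (A : DetAut (Fin k → Fin s) n) : List ℕ :=
  n :: (A.start : ℕ) ::
    ((List.ofFn fun q : Fin n => if A.accept q then 1 else 0) ++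
      List.ofFn fun i : Fin (n * s ^ k) =>
        ((A.step (finProdFinEquiv.symm i).1
          (finFunctionFinEquiv.symm (finProdFinEquiv.symm i).2)).map Fin.val).getD n)

/-- The input for a pair of automata over `k`- and `k'`-tuples of letters from `Fin s`. -/
def encodeInput {s k k' n n' : ℕ} (A : DetAut (Fin k → Fin s) n)
    (A' : DetAut (Fin k' → Fin s) n') : List ℕ :=
  s :: k :: k' :: (encodeAut A ++ encodeAut A')

end Encoding

end HyperAut

namespace HyperAut

/-! ### Total correctness of machine programs -/

section Total

/-- `Total inp ok dem t c Q`: started in `c`, the machine halts within `t` steps in a memory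
satisfying `Q`, and passes only through memories satisfying `ok`. This refers to all runs if
`dem` is true, and to some run if `dem` is false. -/
def Total (inp : List ℕ) (ok : Mem → Prop) (dem : Bool) : ℕ → Config → (Mem → Prop) → Prop
  | 0, c, Q => ok c.2 ∧ c.1 = [] ∧ Q c.2
  | t + 1, c, Q => ok c.2 ∧ ((c.1 = [] ∧ Q c.2) ∨ (c.1 ≠ [] ∧
      bif dem then ∀ c' ∈ c.next inp, Total inp ok dem t c' Q
      else ∃ c' ∈ c.next inp, Total inp ok dem t c' Q))

variable {inp : List ℕ} {ok : Mem → Prop} {dem : Bool}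

theorem Total.mono {t t' : ℕ} {c : Config} {Q Q' : Mem → Prop}
    (h : Total inp ok dem t c Q) (ht : t ≤ t') (hQ : ∀ M, Q M → Q' M) :
    Total inp ok dem t' c Q' := by
  induction t generalizing t' c with
  | zero =>
    obtain ⟨h1, h2, h3⟩ := h
    cases t' with
    | zero => exact ⟨h1, h2, hQ _ h3⟩
    | succ t' => exact ⟨h1, Or.inl ⟨h2, hQ _ h3⟩⟩
  | succ t ih =>
    obtain ⟨t', rfl⟩ : ∃ u, t' = u + 1 := ⟨t' - 1, by omega⟩
    obtain ⟨h1, ⟨h2, h3⟩ | ⟨h2, h3⟩⟩ := h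
    · exact ⟨h1, Or.inl ⟨h2, hQ _ h3⟩⟩
    · refine ⟨h1, Or.inr ⟨h2, ?_⟩⟩
      cases dem with
      | true => exact fun c' hc' => ih (h3 c' hc') (by omega)
      | false =>
        obtain ⟨c', hc', h4⟩ := h3
        exact ⟨c', hc', ih h4 (by omega)⟩

theorem mem_next_append {K K' : List Prog} {M : Mem} (hK : K ≠ []) (c : Config) :
    c ∈ Config.next inp (K ++ K', M) ↔
      ∃ c₀ ∈ Config.next inp (K, M), c = (c₀.1 ++ K', c₀.2) := by
  cases K with
  | nil => exact absurd rfl hK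
  | cons p K =>
    cases p with
    | instr a =>
      simp only [List.cons_append, Config.next, Set.mem_ofPred_eq]
      constructor
      · rintro ⟨M', h, rfl⟩; exact ⟨_, ⟨M', h, rfl⟩, rfl⟩
      · rintro ⟨_, ⟨M', h, rfl⟩, rfl⟩; exact ⟨M', h, rfl⟩
    | seq p q => simp [Config.next]
    | ite i p q => by_cases h : M i = 0 <;> simp [Config.next, h]
    | loop i p => by_cases h : M i = 0 <;> simp [Config.next, h]

theorem Total.append {t t' : ℕ} {K K' : List Prog} {M : Mem} {Q : Mem → Prop}
    (h : Total inp ok dem t (K, M) fun M' => Total inp ok dem t' (K', M') Q) :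
    Total inp ok dem (t + t') (K ++ K', M) Q := by
  induction t generalizing K M with
  | zero =>
    obtain ⟨-, h2, h3⟩ := h
    obtain rfl : K = [] := h2
    simpa using h3
  | succ t ih =>
    obtain ⟨h1, ⟨h2, h3⟩ | ⟨h2, h3⟩⟩ := h
    · obtain rfl : K = [] := h2
      exact Total.mono h3 (by omega) fun _ h => h
    · have h2' : K ≠ [] := h2
      rw [Nat.succ_add]
      refine ⟨h1, Or.inr ⟨by simp [h2'], ?_⟩⟩
      cases dem with
      | true =>
        intro c' hc'
        obtain ⟨c₀, h4, rfl⟩ := (mem_next_append h2' c').1 hc'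
        exact ih (h3 c₀ h4)
      | false =>
        obtain ⟨c₀, h4, h5⟩ := h3
        exact ⟨_, (mem_next_append h2' _).2 ⟨c₀, h4, rfl⟩, ih h5⟩

theorem Total.nil {t : ℕ} {M : Mem} {Q : Mem → Prop} (h : ok M) (hQ : Q M) :
    Total inp ok dem t ([], M) Q := by
  cases t with
  | zero => exact ⟨h, rfl, hQ⟩
  | succ t => exact ⟨h, Or.inl ⟨rfl, hQ⟩⟩

theorem Total.of_next_eq {t : ℕ} {c c' : Config} {Q : Mem → Prop} (h : ok c.2) (hc : c.1 ≠ [])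
    (hn : c.next inp = {c'}) (h' : Total inp ok dem t c' Q) : Total inp ok dem (t + 1) c Q := by
  refine ⟨h, Or.inr ⟨hc, ?_⟩⟩
  cases dem <;> simpa [hn] using h'

theorem Total.seq {t t' : ℕ} {p q : Prog} {M : Mem} {Q : Mem → Prop} (h : ok M)
    (hp : Total inp ok dem t ([p], M) fun M' => Total inp ok dem t' ([q], M') Q) :
    Total inp ok dem (t + t' + 1) ([.seq p q], M) Q :=
  Total.of_next_eq h (by simp) rfl hp.append

theorem Total.ite {t : ℕ} {i : ℕ} {p q : Prog} {M : Mem} {Q : Mem → Prop} (h : ok M)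
    (hp : M i ≠ 0 → Total inp ok dem t ([p], M) Q)
    (hq : M i = 0 → Total inp ok dem t ([q], M) Q) :
    Total inp ok dem (t + 1) ([.ite i p q], M) Q := by
  by_cases hi : M i = 0
  · exact Total.of_next_eq h (by simp) (by simp [Config.next, hi]) (hq hi)
  · exact Total.of_next_eq h (by simp) (by simp [Config.next, hi]) (hp hi)

theorem Total.instr {a : Instr} {M M' : Mem} {Q : Mem → Prop} (h : ok M)
    (ha : a.exec inp M = {M'}) (h' : ok M') (hQ : Q M') :
    Total inp ok dem 1 ([.instr a], M) Q :=
  Total.of_next_eq (c' := ([], M')) h (by simp) (by simp [Config.next, ha]) (Total.nil h' hQ)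

theorem Total.run {P : Prog} {T : ℕ} {Q : Mem → Prop}
    (h : Total inp ok true T ([P], fun _ => 0) Q) {t : ℕ} {c : Config} (hr : Run P inp t c) :
    t ≤ T ∧ Total inp ok true (T - t) c Q := by
  induction hr with
  | init => exact ⟨by omega, h⟩
  | @step t c c' _ hc ih =>
    obtain ⟨h1, h2⟩ := ih
    have hne : c.1 ≠ [] := by
      rcases c with ⟨_ | ⟨p, K⟩, M⟩
      · exact absurd hc (by simp [Config.next])
      · simp
    obtain ⟨d, hd⟩ : ∃ d, T - t = d := ⟨_, rfl⟩
    rw [hd] at h2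
    cases d with
    | zero => exact absurd h2.2.1 hne
    | succ d =>
      obtain ⟨-, ⟨h3, -⟩ | ⟨-, h3⟩⟩ := h2
      · exact absurd h3 hne
      · refine ⟨by omega, ?_⟩
        rw [show T - (t + 1) = d by omega]
        exact h3 c' hc

theorem Total.ok_mem {t : ℕ} {c : Config} {Q : Mem → Prop} (h : Total inp ok dem t c Q) :
    ok c.2 := by
  cases t <;> exact h.1

theorem Total.post {t : ℕ} {M : Mem} {Q : Mem → Prop} (h : Total inp ok dem t ([], M) Q) :
    Q M := by
  cases t with
  | zero => exact h.2.2
  | succ t =>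
    obtain ⟨-, ⟨-, h⟩ | ⟨h, -⟩⟩ := h
    · exact h
    · exact absurd rfl h

theorem Total.exists_run {P : Prog} {T : ℕ} {Q : Mem → Prop}
    (h : Total inp ok false T ([P], fun _ => 0) Q) : ∃ t M, Run P inp t ([], M) ∧ Q M := by
  suffices ∀ T t c, Run P inp t c → Total inp ok false T c Q →
      ∃ t M, Run P inp t ([], M) ∧ Q M from this T 0 _ .init h
  intro T
  induction T with
  | zero =>
    rintro t ⟨K, M⟩ hr ⟨-, rfl, hQ⟩
    exact ⟨t, M, hr, hQ⟩
  | succ T ih =>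
    rintro t ⟨K, M⟩ hr ⟨-, ⟨rfl, hQ⟩ | ⟨-, c', hc', h⟩⟩
    · exact ⟨t, M, hr, hQ⟩
    · exact ih _ _ (.step hr hc') h

end Total

/-! ### A structured language with registers and a heap -/

section Language

/-- The arithmetic operations. -/
inductive Op where
  | add | sub | mul | div | mod

/-- The value of an arithmetic operation. -/
def Op.eval : Op → ℕ → ℕ → ℕ
  | .add, a, b => a + b
  | .sub, a, b => a - b
  | .mul, a, b => a * b
  | .div, a, b => a / b
  | .mod, a, b => a % b

/-- The machine instruction of an arithmetic operation. -/
def Op.instr : Op → ℕ → ℕ → ℕ → Instr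
  | .add => .add
  | .sub => .sub
  | .mul => .mul
  | .div => .div
  | .mod => .mod

/-- Expressions over registers from `ρ`. -/
inductive Expr (ρ : Type) where
  | const (c : ℕ)
  | var (x : ρ)
  | bin (o : Op) (a b : Expr ρ)
  | heap (a : Expr ρ)
  | input (a : Expr ρ)

/-- Statements over registers from `ρ`. -/
inductive Stm (ρ : Type) where
  | assign (x : ρ) (e : Expr ρ)
  | store (a e : Expr ρ)
  | guess (x : ρ) (e : Expr ρ)
  | seq (p q : Stm ρ)
  | ite (e : Expr ρ) (p q : Stm ρ)
  | loop (e : Expr ρ) (p : Stm ρ)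

/-- The contents of the registers and of the heap. -/
structure Store (ρ : Type) where
  r : ρ → ℕ
  h : ℕ → ℕ

variable {ρ : Type}

/-- The value of an expression. -/
def Expr.eval (inp : List ℕ) (σ : Store ρ) : Expr ρ → ℕ
  | .const c => c
  | .var x => σ.r x
  | .bin o a b => o.eval (a.eval inp σ) (b.eval inp σ)
  | .heap a => σ.h (a.eval inp σ)
  | .input a => inp.getD (a.eval inp σ) 0

/-- A bound for the number of temporary cells, and for the growth of the values. -/
def Expr.deg : Expr ρ → ℕ
  | .const c => c + 1
  | .var _ => 1
  | .bin _ a b => a.deg + b.deg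
  | .heap a => a.deg + 1
  | .input a => a.deg + 1

/-- A bound for the number of steps. -/
def Expr.time : Expr ρ → ℕ
  | .const _ => 1
  | .var _ => 3
  | .bin _ a b => a.time + (b.time + 1 + 1) + 1
  | .heap a => a.time + (1 + (1 + 1 + 1) + 1) + 1
  | .input a => a.time + 1 + 1

/-- A bound for the degrees of all expressions. -/
def Stm.deg : Stm ρ → ℕ
  | .assign _ e => e.deg
  | .store a e => a.deg + e.deg
  | .guess _ e => e.deg
  | .seq p q => p.deg + q.deg
  | .ite e p q => e.deg + p.deg + q.deg
  | .loop e p => e.deg + p.deg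

/-- A bound for the number of steps, if every loop has at most `T` rounds. -/
def Stm.time (T : ℕ) : Stm ρ → ℕ
  | .assign _ e => e.time + (1 + 1 + 1) + 1
  | .store a e => a.time + (e.time + (1 + (1 + 1 + 1) + 1) + 1) + 1
  | .guess _ e => e.time + 1 + 1
  | .seq p q => p.time T + q.time T + 1
  | .ite e p q => e.time + (p.time T + q.time T + 1) + 1
  | .loop e p => e.time + (T * (p.time T + e.time + 2) + 1) + 1

/-- The statement contains no `guess`. -/
def Stm.NoGuess : Stm ρ → Prop
  | .assign _ _ => True
  | .store _ _ => True
  | .guess _ _ => False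
  | .seq p q => p.NoGuess ∧ q.NoGuess
  | .ite _ p q => p.NoGuess ∧ q.NoGuess
  | .loop _ p => p.NoGuess

/-- The parameters of an execution: the input, a bound `Z` for the values of all registers and
heap cells, a bound `H` for the size of the heap, a bound `T` for the number of rounds of each
loop, and whether all choices (`dem` is true) or some choice is considered. -/
structure Env where
  inp : List ℕ
  Z : ℕ
  H : ℕ
  T : ℕ
  dem : Bool

/-- Weakest preconditions of loops with at most `n` rounds. -/
def wpLoop (test : Store ρ → ℕ) (body : Store ρ → (Store ρ → Prop) → Prop) :
    ℕ → Store ρ → (Store ρ → Prop) → Prop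
  | 0, σ, Q => test σ = 0 ∧ Q σ
  | n + 1, σ, Q => (test σ = 0 → Q σ) ∧
      (test σ ≠ 0 → body σ fun σ' => wpLoop test body n σ' Q)

theorem wpLoop_mono {test : Store ρ → ℕ} {body : Store ρ → (Store ρ → Prop) → Prop}
    (hb : ∀ σ Q Q', body σ Q → (∀ σ', Q σ' → Q' σ') → body σ Q') {n : ℕ} {σ : Store ρ}
    {Q Q' : Store ρ → Prop} (h : wpLoop test body n σ Q) (hQ : ∀ σ', Q σ' → Q' σ') :
    wpLoop test body n σ Q' := by
  induction n generalizing σ with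
  | zero => exact ⟨h.1, hQ _ h.2⟩
  | succ n ih => exact ⟨fun ht => hQ _ (h.1 ht), fun ht => hb _ _ _ (h.2 ht) fun _ => ih⟩

variable [DecidableEq ρ]

/-- Assignment to a register. -/
def Store.set (σ : Store ρ) (x : ρ) (v : ℕ) : Store ρ := ⟨Function.update σ.r x v, σ.h⟩

/-- Assignment to a heap cell. -/
def Store.put (σ : Store ρ) (a v : ℕ) : Store ρ := ⟨σ.r, Function.update σ.h a v⟩

/-- Weakest preconditions, including the bounds on values, addresses and rounds of loops. -/
def wp (E : Env) : Stm ρ → Store ρ → (Store ρ → Prop) → Prop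
  | .assign x e, σ, Q => e.eval E.inp σ ≤ E.Z ∧ Q (σ.set x (e.eval E.inp σ))
  | .store a e, σ, Q => a.eval E.inp σ < E.H ∧ e.eval E.inp σ ≤ E.Z ∧
      Q (σ.put (a.eval E.inp σ) (e.eval E.inp σ))
  | .guess x e, σ, Q => e.eval E.inp σ ≤ E.Z ∧
      bif E.dem then ∀ v ≤ e.eval E.inp σ, Q (σ.set x v)
      else ∃ v ≤ e.eval E.inp σ, Q (σ.set x v)
  | .seq p q, σ, Q => wp E p σ fun σ' => wp E q σ' Q
  | .ite e p q, σ, Q => (e.eval E.inp σ ≠ 0 → wp E p σ Q) ∧ (e.eval E.inp σ = 0 → wp E q σ Q)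
  | .loop e p, σ, Q => wpLoop (e.eval E.inp) (wp E p) E.T σ Q

theorem wp_mono {E : Env} {p : Stm ρ} {σ : Store ρ} {Q Q' : Store ρ → Prop}
    (h : wp E p σ Q) (hQ : ∀ σ', Q σ' → Q' σ') : wp E p σ Q' := by
  induction p generalizing σ Q Q' with
  | assign x e => exact ⟨h.1, hQ _ h.2⟩
  | store a e => exact ⟨h.1, h.2.1, hQ _ h.2.2⟩
  | guess x e =>
    refine ⟨h.1, ?_⟩
    have h2 := h.2
    cases hd : E.dem with
    | true =>
      rw [hd] at h2
      exact fun v hv => hQ _ (h2 v hv)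
    | false =>
      rw [hd] at h2
      obtain ⟨v, hv, h3⟩ := h2
      exact ⟨v, hv, hQ _ h3⟩
  | seq p q ihp ihq => exact ihp h fun σ' h' => ihq h' hQ
  | ite e p q ihp ihq => exact ⟨fun he => ihp (h.1 he) hQ, fun he => ihq (h.2 he) hQ⟩
  | loop e p ih => exact wpLoop_mono (body := wp E p) (fun _ _ _ h h' => ih h h') h hQ

theorem wp_seq {E : Env} {p q : Stm ρ} {σ : Store ρ} {Q : Store ρ → Prop}
    (h : wp E p σ fun σ' => wp E q σ' Q) : wp E (.seq p q) σ Q := h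

/-- The rule for loops with a decreasing measure. -/
theorem wp_loop_measure {E : Env} {e : Expr ρ} {p : Stm ρ} {σ : Store ρ} {Q : Store ρ → Prop}
    (I : Store ρ → Prop) (μ : Store ρ → ℕ) (hμ : μ σ ≤ E.T) (h0 : I σ)
    (hs : ∀ σ, I σ → e.eval E.inp σ ≠ 0 →
      0 < μ σ ∧ wp E p σ fun σ' => I σ' ∧ μ σ' < μ σ)
    (hQ : ∀ σ, I σ → e.eval E.inp σ = 0 → Q σ) : wp E (.loop e p) σ Q := by
  change wpLoop _ _ _ _ _
  generalize E.T = n at hμ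
  induction n generalizing σ with
  | zero =>
    have : e.eval E.inp σ = 0 := by
      by_contra hne
      have h := (hs σ h0 hne).1
      omega
    exact ⟨this, hQ σ h0 this⟩
  | succ n ih =>
    refine ⟨fun h => hQ σ h0 h, fun h => wp_mono (hs σ h0 h).2 fun σ' h' => ?_⟩
    exact ih h'.1 (by have := h'.2; omega)

/-- The rule for loops with a known number `n` of rounds. -/
theorem wp_loop_count {E : Env} {e : Expr ρ} {p : Stm ρ} {σ : Store ρ} {Q : Store ρ → Prop}
    (n : ℕ) (I : ℕ → Store ρ → Prop) (hn : n ≤ E.T) (h0 : I 0 σ)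
    (hs : ∀ i σ, i < n → I i σ → e.eval E.inp σ ≠ 0 ∧ wp E p σ (I (i + 1)))
    (hQ : ∀ σ, I n σ → e.eval E.inp σ = 0 ∧ Q σ) : wp E (.loop e p) σ Q := by
  change wpLoop _ _ _ _ _
  suffices ∀ m i σ, n ≤ i + m → i ≤ n → I i σ → wpLoop (e.eval E.inp) (wp E p) m σ Q from
    this E.T 0 σ (by omega) (by omega) h0
  intro m
  induction m with
  | zero =>
    intro i σ h1 h2 h3
    obtain rfl : i = n := by omega
    exact hQ σ h3
  | succ m ih =>
    intro i σ h1 h2 h3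
    rcases h2.lt_or_eq with h4 | rfl
    · exact ⟨fun h => absurd h (hs i σ h4 h3).1,
        fun _ => wp_mono (hs i σ h4 h3).2 fun σ' h' => ih (i + 1) σ' (by omega) h4 h'⟩
    · exact ⟨fun _ => (hQ σ h3).2, fun h => absurd (hQ σ h3).1 h⟩

end Language

end HyperAut

namespace HyperAut

/-! ### Compilation of the structured language -/

section Compilation

/-- The memory layout: `D` temporary cells, `R` cells for registers, then the heap. -/
structure Layout (ρ : Type) where
  code : ρ → ℕ
  R : ℕ
  D : ℕ
  inj : Function.Injective code
  lt : ∀ x, code x < R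

variable {ρ : Type} (L : Layout ρ)

/-- The address of the first heap cell. -/
def Layout.off : ℕ := L.D + L.R

/-- The program that computes an expression into the cell `t`, using no other cells below
`L.D` than those from `t` on. -/
def Expr.compile : Expr ρ → ℕ → Prog
  | .const c, t => .instr (.const t c)
  | .var x, t => .seq (.instr (.const t 0)) (.instr (.add t t (L.D + L.code x)))
  | .bin o a b, t =>
      .seq (a.compile t) (.seq (b.compile (t + 1)) (.instr (o.instr t t (t + 1))))
  | .heap a, t => .seq (a.compile t) (.seq (.instr (.const (t + 1) L.off))
      (.seq (.instr (.add t t (t + 1))) (.instr (.load t t))))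
  | .input a, t => .seq (a.compile t) (.instr (.input t t))

/-- The program that executes a statement. -/
def Stm.compile : Stm ρ → Prog
  | .assign x e => .seq (e.compile L 0)
      (.seq (.instr (.const 1 0)) (.instr (.add (L.D + L.code x) 0 1)))
  | .store a e => .seq (a.compile L 0) (.seq (e.compile L 1) (.seq (.instr (.const 2 L.off))
      (.seq (.instr (.add 0 0 2)) (.instr (.store 0 1)))))
  | .guess x e => .seq (e.compile L 0) (.instr (.guess (L.D + L.code x) 0))
  | .seq p q => .seq p.compile q.compile
  | .ite e p q => .seq (e.compile L 0) (.ite 0 p.compile q.compile)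
  | .loop e p => .seq (e.compile L 0) (.loop 0 (.seq p.compile (e.compile L 0)))

theorem Expr.compile_deterministic (e : Expr ρ) (t : ℕ) : (e.compile L t).Deterministic := by
  induction e generalizing t with
  | const c => trivial
  | var x => exact ⟨trivial, trivial⟩
  | bin o a b iha ihb => exact ⟨iha _, ihb _, by cases o <;> trivial⟩
  | heap a ih => exact ⟨ih _, trivial, trivial, trivial⟩
  | input a ih => exact ⟨ih _, trivial⟩

theorem Stm.compile_deterministic (p : Stm ρ) (h : p.NoGuess) :
    (p.compile L).Deterministic := by
  induction p with
  | assign x e => exact ⟨e.compile_deterministic L _, trivial, trivial⟩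
  | store a e =>
    exact ⟨a.compile_deterministic L _, e.compile_deterministic L _, trivial, trivial, trivial⟩
  | guess x e => exact h.elim
  | seq p q ihp ihq => exact ⟨ihp h.1, ihq h.2⟩
  | ite e p q ihp ihq => exact ⟨e.compile_deterministic L _, ihp h.1, ihq h.2⟩
  | loop e p ih => exact ⟨e.compile_deterministic L _, ih h, e.compile_deterministic L _⟩

/-- The memories with values at most `W` that use at most `H` heap cells. -/
def Layout.Ok (W H : ℕ) (M : Mem) : Prop :=
  (∀ a, M a ≤ W) ∧ ∀ a, L.off + H ≤ a → M a = 0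

/-- The memory `M` represents the store `σ`. -/
structure Layout.Represents (E : Env) (W : ℕ) (M : Mem) (σ : Store ρ) : Prop where
  ok : L.Ok W E.H M
  reg : ∀ x, M (L.D + L.code x) = σ.r x
  heap : ∀ a, M (L.off + a) = σ.h a
  reg_le : ∀ x, σ.r x ≤ E.Z
  heap_le : ∀ a, σ.h a ≤ E.Z

variable {L} {E : Env} {W : ℕ} {M : Mem} {σ : Store ρ}

theorem Layout.Ok.update {H a v : ℕ} (h : L.Ok W H M) (ha : a < L.off + H) (hv : v ≤ W) :
    L.Ok W H (Function.update M a v) := by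
  constructor
  · intro b
    by_cases hb : b = a
    · subst hb; simpa using hv
    · simpa [hb] using h.1 b
  · intro b hb
    rw [Function.update_of_ne (by omega)]
    exact h.2 b hb

theorem Layout.Represents.temp {t v : ℕ} (h : L.Represents E W M σ) (ht : t < L.D) (hv : v ≤ W) :
    L.Represents E W (Function.update M t v) σ where
  ok := h.ok.update (by unfold Layout.off; omega) hv
  reg x := by rw [Function.update_of_ne (by omega)]; exact h.reg x
  heap a := by rw [Function.update_of_ne (by unfold Layout.off; omega)]; exact h.heap a
  reg_le := h.reg_le
  heap_le := h.heap_le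

theorem Layout.Represents.set [DecidableEq ρ] {x : ρ} {v : ℕ} (h : L.Represents E W M σ)
    (hv : v ≤ E.Z) (hZ : E.Z ≤ W) :
    L.Represents E W (Function.update M (L.D + L.code x) v) (σ.set x v) where
  ok := h.ok.update (by have := L.lt x; unfold Layout.off; omega) (hv.trans hZ)
  reg y := by
    by_cases hy : y = x
    · subst hy; simp [Store.set]
    · have : L.D + L.code y ≠ L.D + L.code x := fun h' => hy (L.inj (by omega))
      rw [Function.update_of_ne this]
      simpa [Store.set, hy] using h.reg y
  heap a := by
    rw [Function.update_of_ne (by have := L.lt x; unfold Layout.off; omega)]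
    exact h.heap a
  reg_le y := by
    by_cases hy : y = x
    · subst hy; simpa [Store.set] using hv
    · simpa [Store.set, hy] using h.reg_le y
  heap_le := h.heap_le

theorem Layout.Represents.put [DecidableEq ρ] {a v : ℕ} (h : L.Represents E W M σ)
    (ha : a < E.H) (hv : v ≤ E.Z) (hZ : E.Z ≤ W) :
    L.Represents E W (Function.update M (L.off + a) v) (σ.put a v) where
  ok := h.ok.update (by omega) (hv.trans hZ)
  reg y := by
    rw [Function.update_of_ne (by have := L.lt y; unfold Layout.off; omega)]
    exact h.reg y
  heap b := by
    by_cases hb : b = a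
    · subst hb; simp [Store.put]
    · simpa [Store.put, hb] using h.heap b
  reg_le := h.reg_le
  heap_le b := by
    by_cases hb : b = a
    · subst hb; simpa [Store.put] using hv
    · simpa [Store.put, hb] using h.heap_le b

theorem Expr.deg_pos (e : Expr ρ) : 0 < e.deg := by
  induction e <;> (simp [Expr.deg]; try omega)

theorem add_le_two_le_pow {b i j x y : ℕ} (hb : 2 ≤ b) (hi : 0 < i) (hj : 0 < j)
    (hx : x ≤ b ^ i) (hy : y ≤ b ^ j) : x + y ≤ b ^ (i + j) := by
  have h1 : b ≤ b ^ i := Nat.le_self_pow (by omega) b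
  have h2 : b ≤ b ^ j := Nat.le_self_pow (by omega) b
  rw [pow_add]
  nlinarith

theorem Expr.eval_le (hr : ∀ x, σ.r x ≤ E.Z) (hh : ∀ a, σ.h a ≤ E.Z)
    (hi : ∀ a, E.inp.getD a 0 ≤ E.Z) (e : Expr ρ) : e.eval E.inp σ ≤ (E.Z + 2) ^ e.deg := by
  have key : ∀ n, E.Z ≤ (E.Z + 2) ^ (n + 1) := fun n =>
    (Nat.le_add_right _ 2).trans (Nat.le_self_pow (by omega) _)
  have up : ∀ {x i : ℕ} (j : ℕ), x ≤ (E.Z + 2) ^ i → x ≤ (E.Z + 2) ^ (i + j) := fun j h =>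
    h.trans (Nat.pow_le_pow_right (by omega) (by omega))
  induction e with
  | const c =>
    exact (Nat.lt_two_pow_self.le.trans (Nat.pow_le_pow_left (by omega) c)).trans
      (Nat.pow_le_pow_right (by omega) (by simp [Expr.deg]))
  | var x => exact (hr x).trans (key 0)
  | heap a _ => exact (hh _).trans (key _)
  | input a _ => exact (hi _).trans (key _)
  | bin o a b iha ihb =>
    simp only [Expr.eval, Expr.deg]
    cases o with
    | add => exact add_le_two_le_pow (by omega) a.deg_pos b.deg_pos iha ihb
    | sub => exact up _ ((Nat.sub_le _ _).trans iha)
    | mul => rw [pow_add]; exact Nat.mul_le_mul iha ihb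
    | div => exact up _ ((Nat.div_le_self _ _).trans iha)
    | mod => exact up _ ((Nat.mod_le _ _).trans iha)

theorem Op.exec_instr (inp : List ℕ) (o : Op) (i j l : ℕ) (M : Mem) :
    (o.instr i j l).exec inp M = {Function.update M i (o.eval (M j) (M l))} := by
  cases o <;> rfl

theorem Expr.compile_total (hi : ∀ a, E.inp.getD a 0 ≤ E.Z) (e : Expr ρ) {t : ℕ} {M : Mem}
    (hM : L.Represents E W M σ) (ht : t + e.deg ≤ L.D) (hW : L.off + (E.Z + 2) ^ e.deg ≤ W) :
    Total E.inp (L.Ok W E.H) E.dem e.time ([e.compile L t], M) fun M' =>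
      L.Represents E W M' σ ∧ M' t = e.eval E.inp σ ∧ ∀ a < t, M' a = M a := by
  have hle := e.eval_le hM.reg_le hM.heap_le hi
  induction e generalizing t M with
  | const c =>
    have := hM.temp (t := t) (v := c) (by simp [Expr.deg] at ht; omega)
      (by simp only [Expr.eval] at hle; omega)
    exact Total.instr hM.ok rfl this.ok ⟨this, by simp [Expr.eval],
      fun a ha => Function.update_of_ne (by omega) _ _⟩
  | var x =>
    simp only [Expr.deg] at ht hW
    have h1 := hM.temp (t := t) (v := 0) (by omega) (by omega)
    have h2 := h1.temp (t := t) (v := σ.r x) (by omega)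
      (by simp only [Expr.eval, Expr.deg] at hle; omega)
    refine Total.seq (t := 1) (t' := 1) hM.ok (Total.instr hM.ok rfl h1.ok ?_)
    refine Total.instr h1.ok (M' := Function.update (Function.update M t 0) t (σ.r x)) ?_ h2.ok
      ⟨h2, by simp [Expr.eval], fun a ha => ?_⟩
    · simp [Instr.exec, h1.reg x]
    · simp [ha.ne]
  | bin o a b iha ihb =>
    have hd : (Expr.bin o a b).deg = a.deg + b.deg := rfl
    have hpa : (E.Z + 2) ^ a.deg ≤ (E.Z + 2) ^ (a.deg + b.deg) :=
      Nat.pow_le_pow_right (by omega) (by omega)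
    have hpb : (E.Z + 2) ^ b.deg ≤ (E.Z + 2) ^ (a.deg + b.deg) :=
      Nat.pow_le_pow_right (by omega) (by omega)
    have ha0 := a.deg_pos
    rw [hd] at ht hW hle
    refine Total.seq hM.ok ((iha hM (by omega) (by omega)
      (a.eval_le hM.reg_le hM.heap_le hi)).mono le_rfl fun M₁ h1 => ?_)
    obtain ⟨h1, h1t, h1f⟩ := h1
    refine Total.seq h1.ok ((ihb (t := t + 1) h1 (by omega) (by omega)
      (b.eval_le hM.reg_le hM.heap_le hi)).mono le_rfl fun M₂ h2 => ?_)
    obtain ⟨h2, h2t, h2f⟩ := h2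
    have h3 := h2.temp (t := t) (by omega) (hle.trans (by omega))
    refine Total.instr h2.ok (Op.exec_instr _ _ _ _ _ _) ?_ ⟨?_, ?_, ?_⟩
    · rw [h2t, h2f t (by omega), h1t]; exact h3.ok
    · rw [h2t, h2f t (by omega), h1t]; exact h3
    · rw [h2t, h2f t (by omega), h1t]; simp [Expr.eval]
    · intro c hc
      rw [Function.update_of_ne (by omega), h2f c (by omega), h1f c hc]
  | heap a ih =>
    have hd : (Expr.heap a).deg = a.deg + 1 := rfl
    have hpa : (E.Z + 2) ^ a.deg ≤ (E.Z + 2) ^ (a.deg + 1) :=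
      Nat.pow_le_pow_right (by omega) (by omega)
    have ha0 := a.deg_pos
    have hae := a.eval_le hM.reg_le hM.heap_le hi
    rw [hd] at ht hW hle
    refine Total.seq hM.ok ((ih hM (by omega) (by omega) hae).mono le_rfl fun M₁ h1 => ?_)
    obtain ⟨h1, h1t, h1f⟩ := h1
    have h2 := h1.temp (t := t + 1) (v := L.off) (by omega) (by omega)
    refine Total.seq (t := 1) (t' := 3) h1.ok (Total.instr (a := .const (t + 1) L.off) h1.ok rfl
      h2.ok ?_)
    have h3 := h2.temp (t := t) (v := L.off + a.eval E.inp σ) (by omega) (by omega)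
    refine Total.seq (t := 1) (t' := 1) h2.ok (Total.instr h2.ok (M' := Function.update
      (Function.update M₁ (t + 1) L.off) t (L.off + a.eval E.inp σ)) ?_ h3.ok ?_)
    · simp [Instr.exec, h1t, add_comm]
    have h4 := h3.temp (t := t) (v := σ.h (a.eval E.inp σ)) (by omega) (hle.trans (by omega))
    refine Total.instr h3.ok ?_ h4.ok ⟨h4, by simp [Expr.eval], fun c hc => ?_⟩
    · have := h3.heap (a.eval E.inp σ)
      simp [Instr.exec] at this ⊢
      rw [this]
    · rw [Function.update_of_ne (by omega), Function.update_of_ne (by omega),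
        Function.update_of_ne (by omega), h1f c hc]
  | input a ih =>
    have hd : (Expr.input a).deg = a.deg + 1 := rfl
    have hpa : (E.Z + 2) ^ a.deg ≤ (E.Z + 2) ^ (a.deg + 1) :=
      Nat.pow_le_pow_right (by omega) (by omega)
    have hae := a.eval_le hM.reg_le hM.heap_le hi
    rw [hd] at ht hW hle
    refine Total.seq (t' := 1) hM.ok ((ih hM (by omega) (by omega) hae).mono le_rfl
      fun M₁ h1 => ?_)
    obtain ⟨h1, h1t, h1f⟩ := h1
    have h2 := h1.temp (t := t) (v := (Expr.input a).eval E.inp σ) (by omega) (hle.trans (by omega))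
    refine Total.instr h1.ok ?_ h2.ok ⟨h2, by simp, fun c hc => ?_⟩
    · simp [Instr.exec, h1t, Expr.eval]
    · rw [Function.update_of_ne (by omega), h1f c hc]

theorem Stm.compile_total [DecidableEq ρ] (hi : ∀ a, E.inp.getD a 0 ≤ E.Z) (p : Stm ρ) {M : Mem}
    {Q : Store ρ → Prop} (hM : L.Represents E W M σ) (hD : p.deg + 3 ≤ L.D)
    (hW : L.off + (E.Z + 2) ^ p.deg ≤ W) (hp : wp E p σ Q) :
    Total E.inp (L.Ok W E.H) E.dem (p.time E.T) ([p.compile L], M) fun M' =>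
      ∃ σ', L.Represents E W M' σ' ∧ Q σ' := by
  have hZ : ∀ n, n ≠ 0 → E.Z ≤ (E.Z + 2) ^ n := fun n hn =>
    (Nat.le_add_right _ 2).trans (Nat.le_self_pow hn _)
  have hmono : ∀ {i j : ℕ}, i ≤ j → (E.Z + 2) ^ i ≤ (E.Z + 2) ^ j := fun h =>
    Nat.pow_le_pow_right (by omega) h
  induction p generalizing σ M Q with
  | assign x e =>
    simp only [Stm.deg] at hD hW
    have hZ' := hZ e.deg e.deg_pos.ne'
    refine Total.seq hM.ok ((e.compile_total hi (t := 0) hM (by omega) (by omega)).mono le_rfl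
      fun M₁ h1 => ?_)
    obtain ⟨h1, h1t, -⟩ := h1
    have h2 := h1.temp (t := 1) (v := 0) (by omega) (by omega)
    refine Total.seq (t := 1) (t' := 1) h1.ok (Total.instr h1.ok rfl h2.ok ?_)
    have h3 := h2.set (x := x) hp.1 (by omega)
    refine Total.instr h2.ok ?_ h3.ok ⟨_, h3, hp.2⟩
    simp [Instr.exec, h1t]
  | store a e =>
    simp only [Stm.deg] at hD hW
    have ha0 := a.deg_pos
    have he0 := e.deg_pos
    have hZ' := hZ (a.deg + e.deg) (by omega)
    have hma : (E.Z + 2) ^ a.deg ≤ (E.Z + 2) ^ (a.deg + e.deg) := hmono (by omega)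
    have hme : (E.Z + 2) ^ e.deg ≤ (E.Z + 2) ^ (a.deg + e.deg) := hmono (by omega)
    have hae := a.eval_le hM.reg_le hM.heap_le hi
    obtain ⟨hp1, hp2, hp3⟩ := hp
    refine Total.seq hM.ok ((a.compile_total hi (t := 0) hM (by omega) (by omega)).mono le_rfl
      fun M₁ h1 => ?_)
    obtain ⟨h1, h1t, -⟩ := h1
    refine Total.seq h1.ok ((e.compile_total hi (t := 1) h1 (by omega) (by omega)).mono le_rfl
      fun M₂ h2 => ?_)
    obtain ⟨h2, h2t, h2f⟩ := h2
    have h3 := h2.temp (t := 2) (v := L.off) (by omega) (by omega)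
    refine Total.seq (t := 1) (t' := 3) h2.ok (Total.instr (a := .const 2 L.off) h2.ok rfl h3.ok ?_)
    have h4 := h3.temp (t := 0) (v := L.off + a.eval E.inp σ) (by omega) (by omega)
    refine Total.seq (t := 1) (t' := 1) h3.ok (Total.instr h3.ok (M' := Function.update
      (Function.update M₂ 2 L.off) 0 (L.off + a.eval E.inp σ)) ?_ h4.ok ?_)
    · simp [Instr.exec, h1t, h2f 0 (by omega), add_comm]
    have h5 := h4.put hp1 hp2 (by omega)
    refine Total.instr h4.ok ?_ h5.ok ⟨_, h5, hp3⟩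
    simp [Instr.exec, h2t]
  | guess x e =>
    simp only [Stm.deg] at hD hW
    have hZ' := hZ e.deg e.deg_pos.ne'
    refine Total.seq (t' := 1) hM.ok
      ((e.compile_total hi (t := 0) hM (by omega) (by omega)).mono le_rfl fun M₁ h1 => ?_)
    obtain ⟨h1, h1t, -⟩ := h1
    obtain ⟨hp1, hp2⟩ := hp
    refine ⟨h1.ok, Or.inr ⟨by simp, ?_⟩⟩
    cases hd : E.dem with
    | true =>
      rw [hd] at hp2
      rintro c ⟨M', ⟨v, hv, rfl⟩, rfl⟩
      rw [h1t] at hv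
      have h3 := h1.set (x := x) (hv.trans hp1) (by omega)
      exact Total.nil h3.ok ⟨_, h3, hp2 v hv⟩
    | false =>
      rw [hd] at hp2
      obtain ⟨v, hv, hQ⟩ := hp2
      have h3 := h1.set (x := x) (hv.trans hp1) (by omega)
      exact ⟨_, ⟨_, ⟨v, by rwa [h1t], rfl⟩, rfl⟩, Total.nil h3.ok ⟨_, h3, hQ⟩⟩
  | seq p q ihp ihq =>
    simp only [Stm.deg] at hD hW
    have hma : (E.Z + 2) ^ p.deg ≤ (E.Z + 2) ^ (p.deg + q.deg) := hmono (by omega)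
    have hmb : (E.Z + 2) ^ q.deg ≤ (E.Z + 2) ^ (p.deg + q.deg) := hmono (by omega)
    refine Total.seq hM.ok ((ihp hM (by omega) (by omega) hp).mono le_rfl ?_)
    rintro M₁ ⟨σ₁, h1, h1'⟩
    exact ihq h1 (by omega) (by omega) h1'
  | ite e p q ihp ihq =>
    simp only [Stm.deg] at hD hW
    have hme : (E.Z + 2) ^ e.deg ≤ (E.Z + 2) ^ (e.deg + p.deg + q.deg) := hmono (by omega)
    have hma : (E.Z + 2) ^ p.deg ≤ (E.Z + 2) ^ (e.deg + p.deg + q.deg) := hmono (by omega)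
    have hmb : (E.Z + 2) ^ q.deg ≤ (E.Z + 2) ^ (e.deg + p.deg + q.deg) := hmono (by omega)
    refine Total.seq hM.ok ((e.compile_total hi (t := 0) hM (by omega) (by omega)).mono le_rfl
      fun M₁ h1 => ?_)
    obtain ⟨h1, h1t, -⟩ := h1
    refine Total.ite h1.ok (fun h => ?_) fun h => ?_
    · exact (ihp h1 (by omega) (by omega) (hp.1 (by rwa [← h1t]))).mono (by omega) fun _ h => h
    · exact (ihq h1 (by omega) (by omega) (hp.2 (by rwa [← h1t]))).mono (by omega) fun _ h => h
  | loop e p ih =>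
    simp only [Stm.deg] at hD hW
    have hme : (E.Z + 2) ^ e.deg ≤ (E.Z + 2) ^ (e.deg + p.deg) := hmono (by omega)
    have hma : (E.Z + 2) ^ p.deg ≤ (E.Z + 2) ^ (e.deg + p.deg) := hmono (by omega)
    refine Total.seq hM.ok ((e.compile_total hi (t := 0) hM (by omega) (by omega)).mono le_rfl
      fun M₁ h1 => ?_)
    obtain ⟨h1, h1t, -⟩ := h1
    suffices ∀ n M σ, L.Represents E W M σ → M 0 = e.eval E.inp σ →
        wpLoop (Expr.eval E.inp · e) (wp E p) n σ Q →
        Total E.inp (L.Ok W E.H) E.dem (n * (p.time E.T + e.time + 2) + 1)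
          ([.loop 0 (.seq (p.compile L) (e.compile L 0))], M) fun M' =>
            ∃ σ', L.Represents E W M' σ' ∧ Q σ' from this _ _ _ h1 h1t hp
    intro n
    induction n with
    | zero =>
      intro M σ hM h0 hl
      refine Total.of_next_eq (c' := ([], M)) hM.ok (by simp) ?_ (Total.nil hM.ok ⟨σ, hM, hl.2⟩)
      have : M 0 = 0 := h0.trans hl.1
      simp [Config.next, this]
    | succ n ihn =>
      intro M σ hM h0 hl
      by_cases ht : M 0 = 0
      · refine (Total.of_next_eq (t := 0) (c' := ([], M)) hM.ok (by simp) ?_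
          (Total.nil hM.ok ⟨σ, hM, hl.1 (h0.symm.trans ht)⟩)).mono (by omega) fun _ h => h
        simp [Config.next, ht]
      · have hl2 := hl.2 (fun h => ht (h0.trans h))
        have hbody : Total E.inp (L.Ok W E.H) E.dem (p.time E.T + e.time + 1)
            ([.seq (p.compile L) (e.compile L 0)], M) fun M' => ∃ σ', L.Represents E W M' σ' ∧
              M' 0 = e.eval E.inp σ' ∧ wpLoop (Expr.eval E.inp · e) (wp E p) n σ' Q := by
          refine Total.seq hM.ok ((ih hM (by omega) (by omega) hl2).mono le_rfl ?_)
          rintro M₁ ⟨σ₁, h1, h1'⟩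
          exact (e.compile_total hi (t := 0) h1 (by omega) (by omega)).mono le_rfl
            fun M₂ h2 => ⟨σ₁, h2.1, h2.2.1, h1'⟩
        have := Total.append (K' := [.loop 0 (.seq (p.compile L) (e.compile L 0))])
          (hbody.mono le_rfl fun M' ⟨σ', h1, h2, h3⟩ => ihn M' σ' h1 h2 h3)
        refine (Total.of_next_eq hM.ok (by simp) ?_ this).mono ?_ fun _ h => h
        · simp [Config.next, ht]
        · rw [Nat.succ_mul]; omega

theorem Stm.deg_pos (p : Stm ρ) : 0 < p.deg := by
  induction p with
  | assign x e => exact e.deg_pos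
  | store a e => exact Nat.add_pos_left a.deg_pos _
  | guess x e => exact e.deg_pos
  | seq p q ihp _ => exact Nat.add_pos_left ihp _
  | ite e p q _ _ => exact Nat.add_pos_left (Nat.add_pos_left e.deg_pos _) _
  | loop e p _ => exact Nat.add_pos_left e.deg_pos _

theorem Stm.exists_polynomial_time (p : Stm ρ) :
    ∃ q : Polynomial ℕ, ∀ T, p.time T = q.eval T := by
  induction p with
  | assign x e => exact ⟨Polynomial.C (e.time + (1 + 1 + 1) + 1), fun T => by simp [Stm.time]⟩
  | store a e =>
    exact ⟨Polynomial.C (a.time + (e.time + (1 + (1 + 1 + 1) + 1) + 1) + 1),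
      fun T => by simp [Stm.time]⟩
  | guess x e => exact ⟨Polynomial.C (e.time + 1 + 1), fun T => by simp [Stm.time]⟩
  | seq p q ihp ihq =>
    obtain ⟨f, hf⟩ := ihp
    obtain ⟨g, hg⟩ := ihq
    exact ⟨f + g + 1, fun T => by simp [Stm.time, hf, hg]⟩
  | ite e p q ihp ihq =>
    obtain ⟨f, hf⟩ := ihp
    obtain ⟨g, hg⟩ := ihq
    exact ⟨Polynomial.C e.time + (f + g + 1) + 1, fun T => by simp [Stm.time, hf, hg]⟩
  | loop e p ih =>
    obtain ⟨f, hf⟩ := ih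
    exact ⟨Polynomial.C e.time +
      (Polynomial.X * (f + Polynomial.C e.time + Polynomial.C 2) + 1) + 1,
      fun T => by simp [Stm.time, hf]⟩

/-- Every statement is executed by a machine program: the bounds of `wp` hold up to a constant
for the program, and the value of the register `ans` is its answer. -/
theorem Stm.exists_prog [Fintype ρ] [DecidableEq ρ] (p : Stm ρ) (ans : ρ) :
    ∃ (P : Prog) (C : ℕ) (q : Polynomial ℕ), (p.NoGuess → P.Deterministic) ∧
      ∀ (inp : List ℕ) (Z H T : ℕ), (∀ a, inp.getD a 0 ≤ Z) →
        (∀ Q, wp ⟨inp, Z, H, T, true⟩ p ⟨fun _ => 0, fun _ => 0⟩ Q →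
          HaltsWithin P inp (q.eval T) ∧ WordsAtMost P inp ((Z + 2) ^ C) ∧
          (∀ t c, Run P inp t c → ∀ a, C + H ≤ a → c.2 a = 0) ∧
          ∀ t M, Run P inp t ([], M) → ∃ σ : Store ρ, M 0 = σ.r ans ∧ Q σ) ∧
        ∀ Q, wp ⟨inp, Z, H, T, false⟩ p ⟨fun _ => 0, fun _ => 0⟩ Q →
          ∃ t M, Run P inp t ([], M) ∧ ∃ σ : Store ρ, M 0 = σ.r ans ∧ Q σ := by
  let L : Layout ρ := ⟨fun x => Fintype.equivFin ρ x, Fintype.card ρ, p.deg + 3,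
    fun x y h => (Fintype.equivFin ρ).injective (Fin.ext h), fun x => (Fintype.equivFin ρ x).2⟩
  obtain ⟨q, hq⟩ := p.exists_polynomial_time
  have hoff : L.off = p.deg + 3 + Fintype.card ρ := rfl
  have key : ∀ E : Env, (∀ a, E.inp.getD a 0 ≤ E.Z) → ∀ Q,
      wp E p ⟨fun _ => 0, fun _ => 0⟩ Q →
      Total E.inp (L.Ok ((E.Z + 2) ^ (p.deg + L.off)) E.H) E.dem ((q + Polynomial.C 4).eval E.T)
        ([.seq (p.compile L) ((Expr.var ans).compile L 0)], fun _ => 0)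
        fun M => ∃ σ : Store ρ, M 0 = σ.r ans ∧ Q σ := by
    intro E hi Q h
    have hdeg := p.deg_pos
    have hW : L.off + (E.Z + 2) ^ p.deg ≤ (E.Z + 2) ^ (p.deg + L.off) := by
      rw [add_comm]
      exact add_le_two_le_pow (by omega) hdeg (by omega) le_rfl
        (Nat.lt_two_pow_self.le.trans (Nat.pow_le_pow_left (by omega) _))
    have h0 : L.Represents E ((E.Z + 2) ^ (p.deg + L.off)) (fun _ => 0)
        ⟨fun _ => 0, fun _ => 0⟩ :=
      ⟨⟨fun _ => Nat.zero_le _, fun _ _ => rfl⟩, fun _ => rfl, fun _ => rfl,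
        fun _ => Nat.zero_le _, fun _ => Nat.zero_le _⟩
    have htime : (q + Polynomial.C 4).eval E.T = p.time E.T + 3 + 1 := by
      rw [hq, Polynomial.eval_add, Polynomial.eval_C]
    rw [htime]
    refine Total.seq h0.ok ((Stm.compile_total hi p h0 le_rfl hW h).mono le_rfl ?_)
    rintro M ⟨σ, hM, hQ⟩
    have hpow : (E.Z + 2) ^ 1 ≤ (E.Z + 2) ^ p.deg := Nat.pow_le_pow_right (by omega) hdeg
    refine ((Expr.var ans).compile_total hi (t := 0) hM ?_ ?_).mono le_rfl fun M' h' => ?_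
    · simp only [Expr.deg, L]; omega
    · simp only [Expr.deg]; omega
    · exact ⟨σ, h'.2.1, hQ⟩
  refine ⟨.seq (p.compile L) ((Expr.var ans).compile L 0), p.deg + L.off, q + Polynomial.C 4,
    fun h => ⟨p.compile_deterministic L h, Expr.compile_deterministic L _ _⟩,
    fun inp Z H T hi => ⟨fun Q h => ?_, fun Q h => ?_⟩⟩
  · have hT := key ⟨inp, Z, H, T, true⟩ hi Q h
    refine ⟨fun t c hr => (hT.run hr).1, fun t c hr => (hT.run hr).2.ok_mem.1,
      fun t c hr a ha => (hT.run hr).2.ok_mem.2 a (by change L.off + H ≤ a; omega),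
      fun t M hr => (hT.run hr).2.post⟩
  · exact (key ⟨inp, Z, H, T, false⟩ hi Q h).exists_run

end Compilation

end HyperAut

namespace HyperAut

/-! ### Representation-equivalence and counterexamples -/

section Counterexamples

variable {α : Type*}

/-- The prefix of length `i` of an infinite word. -/
def pre (τ : ℕ → α) (i : ℕ) : List α := List.ofFn fun j : Fin i => τ j

@[simp]
theorem length_pre (τ : ℕ → α) (i : ℕ) : (pre τ i).length = i := by simp [pre]

theorem pre_succ (τ : ℕ → α) (i : ℕ) : pre τ (i + 1) = pre τ i ++ [τ i] := by
  simp only [pre, List.ofFn_succ', List.concat_eq_append, Fin.val_castSucc, Fin.val_last]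

@[simp]
theorem getElem_pre (τ : ℕ → α) (i j : ℕ) (h : j < (pre τ i).length) : (pre τ i)[j] = τ j := by
  simp [pre]

theorem isPrefix_iff (t : List α) (τ : ℕ → α) : IsPrefix t τ ↔ t = pre τ t.length := by
  constructor
  · intro h
    refine List.ext_getElem (by simp) fun i h1 h2 => ?_
    simpa [pre] using h i h1
  · intro h i hi
    have : t[i]? = (pre τ t.length)[i]? := by rw [← h]
    simpa [pre, hi] using this

theorem map_pre {β : Type*} (g : α → β) (τ : ℕ → α) (i : ℕ) :
    (pre τ i).map g = pre (fun n => g (τ n)) i := by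
  simp [pre, List.map_ofFn, Function.comp_def]

/-- Some word of `L` represents a prefix of `T`. -/
def Violates {k : ℕ} (L : Language (Fin k → α)) (T : Set (ℕ → α)) : Prop :=
  ∃ σ ∈ L, SetPrefix (unzip σ) T

/-- Some infinite word over `k`-tuples has a prefix in `L`, while no choice of `k'` of its
components yields a word with a prefix in `L'`. -/
def Counterexample {k k' : ℕ} (L : Language (Fin k → α)) (L' : Language (Fin k' → α)) : Prop :=
  ∃ τ : ℕ → Fin k → α, (∃ i, pre τ i ∈ L) ∧
    ∀ (f : Fin k' → Fin k) (i : ℕ), pre (fun n => τ n ∘ f) i ∉ L'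

theorem forall_violates_iff {k k' : ℕ} (L : Language (Fin k → α)) (L' : Language (Fin k' → α)) :
    (∀ T, Violates L T → Violates L' T) ↔ ¬ Counterexample L L' := by
  constructor
  · rintro h ⟨τ, ⟨i, hi⟩, hτ⟩
    obtain ⟨σ, hσ, hp⟩ := h (Set.range fun (a : Fin k) (n : ℕ) => τ n a) ⟨pre τ i, hi, by
      rintro _ ⟨a, rfl⟩
      refine ⟨_, ⟨a, rfl⟩, ?_⟩
      simp only [isPrefix_iff, map_pre, length_pre]⟩
    have : ∀ b : Fin k', ∃ a : Fin k, (σ.map fun v => v b) = pre (fun n => τ n a) σ.length := by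
      intro b
      obtain ⟨_, ⟨a, rfl⟩, h⟩ := hp _ ⟨b, rfl⟩
      exact ⟨a, by simpa using (isPrefix_iff _ _).1 h⟩
    choose f hf using this
    refine hτ f σ.length ?_
    convert hσ using 1
    refine List.ext_getElem (by simp) fun j h1 h2 => ?_
    funext b
    have : (σ.map fun v => v b)[j]? = (pre (fun n => τ n (f b)) σ.length)[j]? := by rw [← hf b]
    rw [getElem_pre]
    simpa [pre, h2] using this.symm
  · rintro h T ⟨σ, hσ, hp⟩
    have : ∀ a : Fin k, ∃ t ∈ T, (σ.map fun v => v a) = pre t σ.length := by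
      intro a
      obtain ⟨t, ht, h⟩ := hp _ ⟨a, rfl⟩
      exact ⟨t, ht, by simpa using (isPrefix_iff _ _).1 h⟩
    choose t ht htp using this
    have hpre : pre (fun n a => t a n) σ.length = σ := by
      refine List.ext_getElem (by simp) fun j h1 h2 => ?_
      funext a
      have : (σ.map fun v => v a)[j]? = (pre (t a) σ.length)[j]? := by rw [← htp a]
      rw [getElem_pre]
      simpa [pre, h2] using this.symm
    by_contra hv
    refine h ⟨fun n a => t a n, ⟨σ.length, by rwa [hpre]⟩, fun f i hi => hv ⟨_, hi, ?_⟩⟩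
    rintro _ ⟨b, rfl⟩
    refine ⟨t (f b), ht _, ?_⟩
    simp only [isPrefix_iff, map_pre, length_pre, Function.comp_apply]

theorem unzip_mem_bad {k : ℕ} {L : Language (Fin k → α)} {σ : List (Fin k → α)} (hσ : σ ∈ L) :
    unzip σ ∈ bad {T | ¬ Violates L T} :=
  fun _ hT h => h ⟨σ, hσ, hT⟩

theorem isRepresentation_iff {k : ℕ} {L : Language (Fin k → α)} {S : Set (Set (ℕ → α))} :
    IsRepresentation L S ↔ S = {T | ¬ Violates L T} := by
  constructor
  · rintro ⟨h1, h2⟩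
    ext T
    have := h2 T
    rw [Set.mem_ofPred_eq, ← not_iff_not, this, not_not]
    exact ⟨fun ⟨σ, h3, h4, _⟩ => ⟨σ, h3, h4⟩, fun ⟨σ, h3, h4⟩ => ⟨σ, h3, h4, h1 σ h3⟩⟩
  · rintro rfl
    refine ⟨fun σ hσ => unzip_mem_bad hσ, fun T => ?_⟩
    rw [Set.mem_ofPred_eq, not_not]
    exact ⟨fun ⟨σ, h3, h4⟩ => ⟨σ, h3, h4, unzip_mem_bad h3⟩, fun ⟨σ, h3, h4, _⟩ => ⟨σ, h3, h4⟩⟩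

theorem isKSafety_violates {k : ℕ} (L : Language (Fin k → α)) :
    IsKSafety k {T | ¬ Violates L T} := by
  refine ⟨fun T hT => ?_, fun T hT => ?_⟩
  · obtain ⟨σ, hσ, h⟩ := not_not.1 hT
    exact ⟨unzip σ, Set.finite_range _, h, unzip_mem_bad hσ⟩
  · obtain ⟨σ, hσ, h⟩ := not_not.1 hT
    refine ⟨unzip σ, ⟨unzip_mem_bad hσ, ?_⟩, h⟩
    rw [unzip, ← Set.image_univ]
    exact (Set.encard_image_le _ _).trans (by simp)

theorem repEquiv_iff {k k' n n' : ℕ} (A : DetAut (Fin k → α) n) (A' : DetAut (Fin k' → α) n') :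
    RepEquiv A A' ↔ ¬ Counterexample A.toNFA.accepts A'.toNFA.accepts ∧
      ¬ Counterexample A'.toNFA.accepts A.toNFA.accepts := by
  rw [← forall_violates_iff, ← forall_violates_iff]
  unfold RepEquiv IsBadPrefixAut
  simp only [isRepresentation_iff]
  constructor
  · rintro ⟨j, -, -, S, -, rfl, h⟩
    have h' : ∀ T, ¬ Violates A.toNFA.accepts T ↔ ¬ Violates A'.toNFA.accepts T :=
      fun T => Set.ext_iff.1 h T
    exact ⟨fun T hT => not_not.1 fun h1 => (h' T).2 h1 hT,
      fun T hT => not_not.1 fun h1 => (h' T).1 h1 hT⟩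
  · rintro ⟨h1, h2⟩
    have h : {T | ¬ Violates A.toNFA.accepts T} = {T | ¬ Violates A'.toNFA.accepts T} := by
      ext T
      exact not_congr ⟨h1 T, h2 T⟩
    rcases le_total k k' with hk | hk
    · exact ⟨k, le_rfl, hk, _, isKSafety_violates _, rfl, h⟩
    · exact ⟨k', hk, le_rfl, _, isKSafety_violates _, h.symm, rfl⟩

end Counterexamples

/-! ### Walks in finite transition systems -/

section Walks

variable {X Λ : Type*} (step : X → Λ → X) (Bad : X → Prop)

/-- The state after `i` steps. -/
def states (x : X) (τ : ℕ → Λ) : ℕ → X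
  | 0 => x
  | i + 1 => step (states x τ i) (τ i)

/-- There is a walk of length `n` from `x` to `y` in which all states but possibly the last one
are not bad. -/
def Walk : ℕ → X → X → Prop
  | 0, x, y => x = y
  | n + 1, x, y => ¬ Bad x ∧ ∃ v, Walk n (step x v) y

variable {step Bad}

theorem Walk.snoc {n : ℕ} {x y : X} (h : Walk step Bad n x y) (hy : ¬ Bad y) (v : Λ) :
    Walk step Bad (n + 1) x (step y v) := by
  induction n generalizing x with
  | zero =>
    obtain rfl : x = y := h
    exact ⟨hy, v, rfl⟩
  | succ n ih =>
    obtain ⟨h1, u, h2⟩ := h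
    exact ⟨h1, u, ih h2⟩

theorem walk_succ_iff {n : ℕ} {x z : X} :
    Walk step Bad (n + 1) x z ↔ ∃ y v, Walk step Bad n x y ∧ ¬ Bad y ∧ step y v = z := by
  constructor
  · intro h
    induction n generalizing x with
    | zero =>
      obtain ⟨h1, v, h2⟩ := h
      exact ⟨x, v, rfl, h1, h2⟩
    | succ n ih =>
      obtain ⟨h1, v, h2⟩ := h
      obtain ⟨y, u, h3, h4⟩ := ih h2
      exact ⟨y, u, ⟨h1, v, h3⟩, h4⟩
  · rintro ⟨y, v, h1, h2, rfl⟩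
    exact h1.snoc h2 v

theorem states_add (x : X) (τ : ℕ → Λ) (i j : ℕ) :
    states step x τ (i + j) = states step (states step x τ i) (fun n => τ (i + n)) j := by
  induction j with
  | zero => rfl
  | succ j ih => rw [← add_assoc, states, ih, states]

theorem states_congr {x : X} {τ τ' : ℕ → Λ} {i : ℕ} (h : ∀ j < i, τ j = τ' j) :
    states step x τ i = states step x τ' i := by
  induction i with
  | zero => rfl
  | succ i ih => rw [states, states, ih fun j hj => h j (by omega), h i (by omega)]

theorem walk_states {x : X} {τ : ℕ → Λ} {i : ℕ} (n : ℕ)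
    (h : ∀ j, i ≤ j → j < i + n → ¬ Bad (states step x τ j)) :
    Walk step Bad n (states step x τ i) (states step x τ (i + n)) := by
  induction n with
  | zero => rfl
  | succ n ih =>
    exact (ih fun j h1 h2 => h j h1 (by omega)).snoc (h (i + n) (by omega) (by omega)) _

theorem Walk.exists_states {n : ℕ} {x y : X} (h : Walk step Bad n x y) (u : ℕ → Λ) :
    ∃ τ : ℕ → Λ, (∀ j < n, ¬ Bad (states step x τ j)) ∧ states step x τ n = y ∧
      ∀ j, τ (n + j) = u j := by
  induction n generalizing y u with
  | zero => exact ⟨u, by simp, h, by simp⟩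
  | succ n ih =>
    obtain ⟨z, v, h1, h2, rfl⟩ := walk_succ_iff.1 h
    obtain ⟨τ, h3, h4, h5⟩ := ih h1 fun j => Nat.casesOn j v u
    refine ⟨τ, fun j hj => ?_, ?_, fun j => ?_⟩
    · rcases Nat.lt_succ_iff_lt_or_eq.1 hj with hj | rfl
      · exact h3 j hj
      · rwa [h4]
    · rw [states, h4]
      congr 1
      exact h5 0
    · rw [add_assoc, add_comm 1 j]
      exact h5 (j + 1)

/-- An infinite walk exists from every state of a set without bad states in which every state
has a successor. -/
theorem exists_forall_not_bad {G : Set X} (hb : ∀ x ∈ G, ¬ Bad x)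
    (hs : ∀ x ∈ G, ∃ v, step x v ∈ G) {x : X} (hx : x ∈ G) :
    ∃ τ : ℕ → Λ, ∀ i, ¬ Bad (states step x τ i) := by
  choose g hg using hs
  let w : ℕ → G := fun n => Nat.rec ⟨x, hx⟩ (fun _ y => ⟨step y.1 (g y.1 y.2), hg y.1 y.2⟩) n
  refine ⟨fun n => g (w n).1 (w n).2, fun i => ?_⟩
  have : states step x (fun n => g (w n).1 (w n).2) i = (w i).1 := by
    induction i with
    | zero => rfl
    | succ i ih => rw [states, ih]
  rw [this]
  exact hb _ (w i).2

theorem exists_repetition [Fintype X] {L : ℕ} (hL : Fintype.card X ≤ L) (w : ℕ → X) :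
    ∃ a b, a < b ∧ b ≤ L ∧ w a = w b := by
  obtain ⟨i, j, hij, h⟩ := Fintype.exists_ne_map_eq_of_card_lt (fun i : Fin (L + 1) => w i)
    (by simpa using Nat.lt_succ_of_le hL)
  rcases lt_or_gt_of_ne hij with hlt | hlt
  · exact ⟨i, j, hlt, by omega, h⟩
  · exact ⟨j, i, hlt, by omega, h.symm⟩

theorem Walk.exists_forall_not_bad [Fintype X] {L : ℕ} (hL : Fintype.card X ≤ L) {x y : X}
    (h : Walk step Bad L x y) : ∃ τ : ℕ → Λ, ∀ i, ¬ Bad (states step x τ i) := by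
  have hpos : 0 < L := lt_of_lt_of_le (Fintype.card_pos_iff.2 ⟨x⟩) hL
  obtain ⟨v, -⟩ : ∃ v : Λ, True := by
    cases L with
    | zero => omega
    | succ L => exact ⟨h.2.choose, trivial⟩
  obtain ⟨τ, h1, -, -⟩ := h.exists_states fun _ => v
  obtain ⟨a, b, hab, hb, he⟩ := exists_repetition hL (states step x τ)
  have hcyc : Walk step Bad (b - a) (states step x τ a) (states step x τ a) := by
    have := walk_states (step := step) (Bad := Bad) (x := x) (τ := τ) (i := a) (b - a)
      fun j h2 h3 => h1 j (by omega)
    rwa [show a + (b - a) = b by omega, ← he] at this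
  have hx : Walk step Bad b x (states step x τ a) := by
    have := walk_states (step := step) (Bad := Bad) (x := x) (τ := τ) (i := 0) b
      fun j h2 h3 => h1 j (by omega)
    rwa [zero_add, ← he] at this
  refine HyperAut.exists_forall_not_bad
    (G := {z | ∃ m, Walk step Bad (m + 1) z (states step x τ a)}) ?_ ?_ ?_
  · rintro z ⟨m, h2⟩
    exact h2.1
  · rintro z ⟨m, -, v, h2⟩
    refine ⟨v, ?_⟩
    cases m with
    | zero =>
      obtain h2 : step z v = _ := h2
      rw [h2]
      exact ⟨b - a - 1, by rwa [show b - a - 1 + 1 = b - a by omega]⟩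
    | succ m => exact ⟨m, h2⟩
  · exact ⟨b - 1, by rwa [show b - 1 + 1 = b by omega]⟩

/-- An infinite walk without bad states that reaches the absorbing set `Acc` exists iff there are
suitable finite walks whose length is the number of states. -/
theorem exists_infinite_walk_iff [Fintype X] {Acc : X → Prop}
    (hA : ∀ x v, Acc x → Acc (step x v)) {L : ℕ} (hL : Fintype.card X ≤ L) (x : X) :
    (∃ τ : ℕ → Λ, (∃ i, Acc (states step x τ i)) ∧ ∀ i, ¬ Bad (states step x τ i)) ↔
      ∃ y z, Walk step Bad L x y ∧ Acc y ∧ Walk step Bad L y z ∧ Acc z := by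
  classical
  constructor
  · intro h
    have h' : ∃ i, ∃ τ : ℕ → Λ, Acc (states step x τ i) ∧ ∀ i, ¬ Bad (states step x τ i) := by
      obtain ⟨τ, ⟨i, h1⟩, h2⟩ := h
      exact ⟨i, τ, h1, h2⟩
    obtain ⟨τ, h1, h2⟩ := Nat.find_spec h'
    have hlt : Nat.find h' ≤ L := by
      by_contra hlt
      obtain ⟨a, b, hab, hb, he⟩ := exists_repetition hL (states step x τ)
      refine Nat.find_min h' (m := Nat.find h' - (b - a)) (by omega) ?_
      have e1 : ∀ j ≤ a, states step x (fun n => if n < a then τ n else τ (n + (b - a))) j =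
          states step x τ j := fun j hj => states_congr fun n hn => by simp [show n < a by omega]
      have e2 : ∀ j, states step x (fun n => if n < a then τ n else τ (n + (b - a))) (a + j) =
          states step x τ (b + j) := by
        intro j
        rw [states_add, states_add x τ b, e1 a le_rfl, he]
        refine states_congr fun n _ => ?_
        simp only [Nat.not_lt.2 (Nat.le_add_right a n), if_false]
        congr 1
        omega
      refine ⟨fun n => if n < a then τ n else τ (n + (b - a)), ?_, fun i => ?_⟩
      · rw [show Nat.find h' - (b - a) = a + (Nat.find h' - b) by omega, e2,
          show b + (Nat.find h' - b) = Nat.find h' by omega]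
        exact h1
      · rcases le_total i a with hi | hi
        · rw [e1 i hi]; exact h2 i
        · rw [show i = a + (i - a) by omega, e2]; exact h2 _
    have hAcc : ∀ j, Acc (states step x τ (Nat.find h' + j)) := by
      intro j
      induction j with
      | zero => exact h1
      | succ j ih => exact hA _ _ ih
    refine ⟨states step x τ L, states step x τ (L + L), ?_, ?_, walk_states L fun j _ _ => h2 j, ?_⟩
    · have := walk_states (step := step) (Bad := Bad) (x := x) (τ := τ) (i := 0) L
        fun j _ _ => h2 j
      rwa [zero_add] at this
    · rw [show L = Nat.find h' + (L - Nat.find h') by omega]; exact hAcc _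
    · rw [show L + L = Nat.find h' + (L + L - Nat.find h') by omega]; exact hAcc _
  · rintro ⟨y, z, h1, h2, h3, -⟩
    obtain ⟨u, hu⟩ := h3.exists_forall_not_bad hL
    obtain ⟨τ, h4, h5, h6⟩ := h1.exists_states u
    refine ⟨τ, ⟨L, by rwa [h5]⟩, fun i => ?_⟩
    rcases lt_or_ge i L with hi | hi
    · exact h4 i hi
    · obtain ⟨j, rfl⟩ := Nat.exists_eq_add_of_le hi
      rw [states_add, h5, show (fun n => τ (L + n)) = u from funext h6]
      exact hu j

end Walks

end HyperAut

namespace HyperAut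

/-! ### The product system -/

section Product

variable {α : Type*}

/-- The state of the automaton after a word, if there is one. -/
def DetAut.run {n : ℕ} (A : DetAut α n) (w : List α) : Option (Fin n) :=
  w.foldl (fun o a => o.bind fun q => A.step q a) (some A.start)

theorem DetAut.run_append {n : ℕ} (A : DetAut α n) (w : List α) (a : α) :
    A.run (w ++ [a]) = (A.run w).bind fun q => A.step q a := by
  simp [DetAut.run]

theorem DetAut.mem_eval_iff {n : ℕ} (A : DetAut α n) (w : List α) (q : Fin n) :
    q ∈ A.toNFA.eval w ↔ A.run w = some q := by
  induction w using List.reverseRecOn generalizing q with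
  | nil =>
    simp only [NFA.eval_nil, DetAut.run, List.foldl_nil, Option.some.injEq]
    exact eq_comm
  | append_singleton w a ih =>
    rw [NFA.eval_append_singleton, NFA.mem_stepSet, DetAut.run_append]
    simp only [ih, Option.bind_eq_some_iff]
    rfl

theorem DetAut.mem_accepts_iff {n : ℕ} (A : DetAut α n) (w : List α) :
    w ∈ A.toNFA.accepts ↔ ∃ q, A.run w = some q ∧ A.accept q = true := by
  rw [NFA.mem_accepts]
  constructor
  · rintro ⟨q, h1, h2⟩
    exact ⟨q, (A.mem_eval_iff w q).1 h2, h1⟩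
  · rintro ⟨q, h1, h2⟩
    exact ⟨q, h2, (A.mem_eval_iff w q).2 h1⟩

/-- The states of the product: the state of the first automaton, which is `none` once a prefix
has been accepted, and a state of the second automaton for each choice of components. -/
abbrev ProdState (k k' n n' : ℕ) : Type :=
  Option (Option (Fin n)) × ((Fin k' → Fin k) → Option (Fin n'))

variable {k k' n n' : ℕ} (A : DetAut (Fin k → α) n)

/-- The transitions of the first component. -/
def watchStep (v : Fin k → α) : Option (Option (Fin n)) → Option (Option (Fin n))
  | none => none
  | some none => some none
  | some (some q) => if A.accept q then none else some (A.step q v)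

/-- The transitions of the product. -/
def prodStep (B : DetAut (Fin k' → α) n') (x : ProdState k k' n n') (v : Fin k → α) :
    ProdState k k' n n' :=
  (watchStep A v x.1, fun f => (x.2 f).bind fun q => B.step q (v ∘ f))

/-- The initial state of the product. -/
def prodStart (B : DetAut (Fin k' → α) n') : ProdState k k' n n' :=
  (some (some A.start), fun _ => some B.start)

/-- Some copy of the second automaton accepts. -/
def ProdBad (B : DetAut (Fin k' → α) n') (x : ProdState k k' n n') : Prop :=
  ∃ f q, x.2 f = some q ∧ B.accept q = true

variable (B : DetAut (Fin k' → α) n')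

theorem states_prod_snd (τ : ℕ → Fin k → α) (i : ℕ) (f : Fin k' → Fin k) :
    (states (prodStep A B) (prodStart A B) τ i).2 f = B.run (pre (fun n => τ n ∘ f) i) := by
  induction i with
  | zero => simp [states, prodStart, pre, DetAut.run]
  | succ i ih => rw [pre_succ, DetAut.run_append, ← ih]; rfl

theorem states_prod_fst (τ : ℕ → Fin k → α) (i : ℕ) :
    (states (prodStep A B) (prodStart A B) τ i).1 = none ∧ (∃ j, pre τ j ∈ A.toNFA.accepts) ∨
      (states (prodStep A B) (prodStart A B) τ i).1 = some (A.run (pre τ i)) ∧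
        ∀ j < i, pre τ j ∉ A.toNFA.accepts := by
  induction i with
  | zero => exact Or.inr ⟨by simp [states, prodStart, pre, DetAut.run], by simp⟩
  | succ i ih =>
    simp only [states, prodStep]
    rcases ih with ⟨h1, h2⟩ | ⟨h1, h2⟩
    · exact Or.inl ⟨by rw [h1]; rfl, h2⟩
    · rw [h1, pre_succ, DetAut.run_append]
      have hacc := A.mem_accepts_iff (pre τ i)
      cases hr : A.run (pre τ i) with
      | none =>
        refine Or.inr ⟨rfl, fun j hj => ?_⟩
        rcases Nat.lt_succ_iff_lt_or_eq.1 hj with hj | rfl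
        · exact h2 j hj
        · rw [hacc, hr]; simp
      | some q =>
        rw [hr] at hacc
        by_cases hq : A.accept q = true
        · exact Or.inl ⟨by simp [watchStep, hq], i, hacc.2 ⟨q, rfl, hq⟩⟩
        · refine Or.inr ⟨by simp [watchStep, hq], fun j hj => ?_⟩
          rcases Nat.lt_succ_iff_lt_or_eq.1 hj with hj | rfl
          · exact h2 j hj
          · rw [hacc]; simpa using hq

theorem counterexample_iff_states :
    Counterexample A.toNFA.accepts B.toNFA.accepts ↔
      ∃ τ : ℕ → Fin k → α, (∃ i, (states (prodStep A B) (prodStart A B) τ i).1 = none) ∧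
        ∀ i, ¬ ProdBad B (states (prodStep A B) (prodStart A B) τ i) := by
  refine exists_congr fun τ => and_congr ⟨?_, ?_⟩ ?_
  · rintro ⟨i, hi⟩
    refine ⟨i + 1, ?_⟩
    rcases states_prod_fst A B τ (i + 1) with h | h
    · exact h.1
    · exact absurd hi (h.2 i (by omega))
  · rintro ⟨i, hi⟩
    rcases states_prod_fst A B τ i with h | h
    · exact h.2
    · rw [h.1] at hi; cases hi
  · simp only [ProdBad, states_prod_snd, DetAut.mem_accepts_iff, not_exists]
    exact ⟨fun h i f => h f i, fun h f i => h i f⟩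

theorem counterexample_iff_walk {L : ℕ} (hL : (n + n' + 2) ^ (k ^ k' + 1) ≤ L) :
    Counterexample A.toNFA.accepts B.toNFA.accepts ↔
      ∃ y z, Walk (prodStep A B) (ProdBad B) L (prodStart A B) y ∧ y.1 = none ∧
        Walk (prodStep A B) (ProdBad B) L y z ∧ z.1 = none := by
  rw [counterexample_iff_states]
  refine exists_infinite_walk_iff (Acc := fun x : ProdState k k' n n' => x.1 = none)
    (fun x v h => ?_) (le_trans ?_ hL) _
  · simp only [prodStep, h]; rfl
  · simp only [Fintype.card_prod, Fintype.card_option, Fintype.card_fin, Fintype.card_pi,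
      Finset.prod_const, Finset.card_univ]
    rw [pow_succ, mul_comm]
    exact Nat.mul_le_mul (Nat.pow_le_pow_left (by omega) _) (by omega)

end Product

end HyperAut

namespace HyperAut

/-! ### Numerical representation of automata and product states -/

section Numerical

variable {k' n' s k n : ℕ}

/-- The list `inp` contains at position `b` the representation of the automaton. -/
structure Encodes (inp : List ℕ) (b : ℕ) (A : DetAut (Fin k → Fin s) n) : Prop where
  size : inp.getD b 0 = n
  start : inp.getD (b + 1) 0 = A.start
  accept : ∀ q : Fin n, inp.getD (b + 2 + q) 0 = if A.accept q then 1 else 0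
  step : ∀ (q : Fin n) (v : Fin k → Fin s),
    inp.getD (b + 2 + n + q * s ^ k + finFunctionFinEquiv v) 0 =
      ((A.step q v).map Fin.val).getD n

@[simp]
theorem length_encodeAut (A : DetAut (Fin k → Fin s) n) :
    (encodeAut A).length = n + n * s ^ k + 2 := by
  simp [encodeAut]

theorem encodes_append (A : DetAut (Fin k → Fin s) n) (l l' : List ℕ) :
    Encodes (l ++ (encodeAut A ++ l')) l.length A := by
  have key : ∀ i, i < n + n * s ^ k + 2 →
      (l ++ (encodeAut A ++ l')).getD (l.length + i) 0 = (encodeAut A).getD i 0 := by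
    intro i hi
    rw [List.getD_append_right _ _ _ _ (by omega),
      List.getD_append _ _ _ _ (by simpa using by omega)]
    simp
  refine ⟨?_, ?_, fun q => ?_, fun q v => ?_⟩
  · rw [← Nat.add_zero l.length, key 0 (by omega)]; rfl
  · rw [key 1 (by omega)]; rfl
  · rw [add_assoc, key (2 + q) (by omega), add_comm]
    simp only [encodeAut, List.getD_cons_succ]
    rw [List.getD_append _ _ _ _ (by simp)]
    simp [List.getD_eq_getElem?_getD]
  · have h1 : (q : ℕ) * s ^ k + finFunctionFinEquiv v < n * s ^ k := by
      have := (finFunctionFinEquiv v).2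
      have := Nat.mul_le_mul_right (s ^ k) (show (q : ℕ) + 1 ≤ n from q.2)
      rw [add_mul] at this
      omega
    rw [show l.length + 2 + n + (q : ℕ) * s ^ k + (finFunctionFinEquiv v : ℕ) =
      l.length + (n + ((q : ℕ) * s ^ k + finFunctionFinEquiv v) + 2) by ring, key _ (by omega)]
    simp only [encodeAut, List.getD_cons_succ]
    rw [List.getD_append_right _ _ _ _ (by simp)]
    have h2 : (⟨(q : ℕ) * s ^ k + finFunctionFinEquiv v, h1⟩ : Fin (n * s ^ k)) =
        finProdFinEquiv (q, finFunctionFinEquiv v) := by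
      ext; simp [finProdFinEquiv]; ring
    simp only [List.length_ofFn, Nat.add_sub_cancel_left, List.getD_eq_getElem?_getD,
      List.getElem?_ofFn, h1, dif_pos, h2, Equiv.symm_apply_apply, Option.getD_some]

/-- The number of the letter that results from the `i`-th choice of `k'` components of the letter
with the number `v`. -/
def letter (s k k' i v : ℕ) : ℕ :=
  ∑ j ∈ Finset.range k', v / s ^ (i / k ^ j % k) % s * s ^ j

theorem letter_eq (i : Fin (k ^ k')) (v : Fin k → Fin s) :
    letter s k k' i (finFunctionFinEquiv v : Fin (s ^ k)) =
      (finFunctionFinEquiv (v ∘ finFunctionFinEquiv.symm i) : Fin (s ^ k')) := by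
  rw [finFunctionFinEquiv_apply, letter, Finset.sum_range]
  refine Finset.sum_congr rfl fun j _ => ?_
  congr 1
  have h : ∀ a : Fin k, (finFunctionFinEquiv v : ℕ) / s ^ (a : ℕ) % s = v a := fun a => by
    conv_rhs => rw [← Equiv.symm_apply_apply finFunctionFinEquiv v]
    rfl
  exact h (finFunctionFinEquiv.symm i j)

/-- The number of a state of the first component of the product. -/
def watchVal : Option (Option (Fin n)) → ℕ
  | none => n + 1
  | some o => (o.map Fin.val).getD n

/-- The product state as a sequence of `k ^ k' + 1` numbers. -/
def dig (x : ProdState k k' n n') (i : ℕ) : ℕ :=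
  if h : i < k ^ k' then ((x.2 (finFunctionFinEquiv.symm ⟨i, h⟩)).map Fin.val).getD n'
  else watchVal x.1

theorem getD_map_val_le (o : Option (Fin n)) : (o.map Fin.val).getD n ≤ n := by
  cases o with
  | none => simp
  | some q => simp

theorem getD_map_val_injective :
    Function.Injective fun o : Option (Fin n) => (o.map Fin.val).getD n := by
  rintro (_ | q) (_ | q') h
  · rfl
  · have : n = (q' : ℕ) := h
    have := q'.2
    omega
  · have : (q : ℕ) = n := h
    have := q.2
    omega
  · have : (q : ℕ) = q' := h
    rw [Fin.ext this]

theorem watchVal_injective : Function.Injective (watchVal (n := n)) := by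
  rintro (_ | o) (_ | o') h
  · rfl
  · have : n + 1 = (o'.map Fin.val).getD n := h
    have := getD_map_val_le o'
    omega
  · have : (o.map Fin.val).getD n = n + 1 := h
    have := getD_map_val_le o
    omega
  · rw [getD_map_val_injective (show (o.map Fin.val).getD n = (o'.map Fin.val).getD n from h)]

theorem watchVal_le (o : Option (Option (Fin n))) : watchVal o ≤ n + 1 := by
  cases o with
  | none => exact le_rfl
  | some o => exact (getD_map_val_le o).trans (by omega)

theorem dig_lt (x : ProdState k k' n n') (i : ℕ) : dig x i < n + n' + 2 := by
  unfold dig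
  split
  · exact (getD_map_val_le _).trans_lt (by omega)
  · exact (watchVal_le _).trans_lt (by omega)

theorem dig_last (x : ProdState k k' n n') : dig x (k ^ k') = watchVal x.1 := by simp [dig]

theorem dig_finFunctionFinEquiv (x : ProdState k k' n n') (f : Fin k' → Fin k) :
    dig x (finFunctionFinEquiv f) = ((x.2 f).map Fin.val).getD n' := by
  rw [dig, dif_pos (finFunctionFinEquiv f).2]
  simp only [Fin.eta, Equiv.symm_apply_apply]

theorem eq_of_dig_eq {x y : ProdState k k' n n'} (h : ∀ i ≤ k ^ k', dig x i = dig y i) :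
    x = y := by
  refine Prod.ext (watchVal_injective ?_) (funext fun f => getD_map_val_injective ?_)
  · rw [← dig_last, ← dig_last]; exact h _ le_rfl
  · have := h (finFunctionFinEquiv f) (finFunctionFinEquiv f).2.le
    rwa [dig_finFunctionFinEquiv, dig_finFunctionFinEquiv] at this

theorem fst_eq_none_iff (x : ProdState k k' n n') : x.1 = none ↔ dig x (k ^ k') - n ≠ 0 := by
  rw [dig_last]
  rcases x with ⟨_ | o, g⟩
  · simp [watchVal]
  · simp [watchVal, Nat.sub_eq_zero_of_le (getD_map_val_le o)]

variable {inp : List ℕ} {bA bB : ℕ} {A : DetAut (Fin k → Fin s) n} {B : DetAut (Fin k' → Fin s) n'}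

theorem prodBad_iff (hB : Encodes inp bB B) (x : ProdState k k' n n') :
    ProdBad B x ↔ ∃ i < k ^ k', dig x i < n' ∧ inp.getD (bB + 2 + dig x i) 0 ≠ 0 := by
  constructor
  · rintro ⟨f, q, h1, h2⟩
    refine ⟨finFunctionFinEquiv f, (finFunctionFinEquiv f).2, ?_⟩
    have : dig x (finFunctionFinEquiv f) = q := by
      rw [dig_finFunctionFinEquiv, h1]; rfl
    rw [this, hB.accept]
    simp [h2]
  · rintro ⟨i, hi, h1, h2⟩
    simp only [dig, hi, dif_pos] at h1 h2
    cases hx : x.2 (finFunctionFinEquiv.symm ⟨i, hi⟩) with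
    | none => simp [hx] at h1
    | some q =>
      rw [hx, Option.map_some, Option.getD_some, hB.accept] at h2
      exact ⟨_, q, hx, by simpa using h2⟩

theorem dig_prodStep_of_lt (hB : Encodes inp bB B) (x : ProdState k k' n n') (v : Fin k → Fin s)
    {i : ℕ} (hi : i < k ^ k') :
    dig (prodStep A B x v) i = if dig x i < n' then
      inp.getD (bB + 2 + n' + dig x i * s ^ k' + letter s k k' i (finFunctionFinEquiv v)) 0
      else dig x i := by
  have hl := letter_eq (k' := k') ⟨i, hi⟩ v
  simp only at hl
  simp only [dig, hi, dif_pos, prodStep]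
  cases x.2 (finFunctionFinEquiv.symm ⟨i, hi⟩) with
  | none => simp
  | some q =>
    simp only [Option.map_some, Option.getD_some, Option.bind_some, q.2, if_true, hl]
    exact (hB.step q _).symm

theorem dig_prodStep_last (hA : Encodes inp bA A) (x : ProdState k k' n n') (v : Fin k → Fin s) :
    dig (prodStep A B x v) (k ^ k') = if dig x (k ^ k') < n then
      if inp.getD (bA + 2 + dig x (k ^ k')) 0 ≠ 0 then n + 1
      else inp.getD (bA + 2 + n + dig x (k ^ k') * s ^ k + finFunctionFinEquiv v) 0
      else dig x (k ^ k') := by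
  rw [dig_last, dig_last]
  rcases x with ⟨_ | _ | q, g⟩
  · simp [prodStep, watchStep, watchVal]
  · simp [prodStep, watchStep, watchVal]
  · simp only [prodStep, watchStep, watchVal, Option.map_some, Option.getD_some, q.2, if_true,
      hA.accept, hA.step]
    by_cases hq : A.accept q = true <;> simp [hq]

theorem dig_prodStart_of_lt (hB : Encodes inp bB B) {i : ℕ} (hi : i < k ^ k') :
    dig (prodStart A B) i = inp.getD (bB + 1) 0 := by
  rw [hB.start]
  simp [dig, hi, prodStart]

theorem dig_prodStart_last (hA : Encodes inp bA A) :
    dig (prodStart A B) (k ^ k') = inp.getD (bA + 1) 0 := by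
  rw [dig_last, hA.start]
  simp [prodStart, watchVal]

end Numerical

end HyperAut

namespace HyperAut

/-! ### Programming in the structured language -/

section Expressions

variable {ρ : Type}

instance : Add (Expr ρ) := ⟨.bin .add⟩
instance : Sub (Expr ρ) := ⟨.bin .sub⟩
instance : Mul (Expr ρ) := ⟨.bin .mul⟩
instance : Div (Expr ρ) := ⟨.bin .div⟩
instance : Mod (Expr ρ) := ⟨.bin .mod⟩
instance (n : ℕ) : OfNat (Expr ρ) n := ⟨.const n⟩
instance : Coe ρ (Expr ρ) := ⟨.var⟩

variable (inp : List ℕ) (σ : Store ρ) (a b : Expr ρ)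

@[simp] theorem eval_add : (a + b).eval inp σ = a.eval inp σ + b.eval inp σ := rfl
@[simp] theorem eval_sub : (a - b).eval inp σ = a.eval inp σ - b.eval inp σ := rfl
@[simp] theorem eval_mul : (a * b).eval inp σ = a.eval inp σ * b.eval inp σ := rfl
@[simp] theorem eval_div : (a / b).eval inp σ = a.eval inp σ / b.eval inp σ := rfl
@[simp] theorem eval_mod : (a % b).eval inp σ = a.eval inp σ % b.eval inp σ := rfl
@[simp] theorem eval_zero : (0 : Expr ρ).eval inp σ = 0 := rfl
@[simp] theorem eval_one : (1 : Expr ρ).eval inp σ = 1 := rfl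
@[simp] theorem eval_two : (2 : Expr ρ).eval inp σ = 2 := rfl
@[simp] theorem eval_three : (3 : Expr ρ).eval inp σ = 3 := rfl
@[simp] theorem eval_var (x : ρ) : (Expr.var x).eval inp σ = σ.r x := rfl
@[simp] theorem eval_heap : (Expr.heap a).eval inp σ = σ.h (a.eval inp σ) := rfl
@[simp] theorem eval_input : (Expr.input a).eval inp σ = inp.getD (a.eval inp σ) 0 := rfl

variable {σ} {σ' σ'' : Store ρ} {l l' : List ρ}

@[simp] theorem put_r (a v : ℕ) : (σ.put a v).r = σ.r := rfl
@[simp] theorem put_h (a b v : ℕ) : (σ.put a v).h b = if b = a then v else σ.h b := by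
  simp [Store.put, Function.update_apply]

/-- The stores agree on all registers that are not in `l`. -/
def Agree (l : List ρ) (σ σ' : Store ρ) : Prop := ∀ x, x ∉ l → σ'.r x = σ.r x

theorem Agree.refl : Agree l σ σ := fun _ _ => rfl

theorem Agree.put {a v : ℕ} (h : Agree l σ σ') : Agree l σ (σ'.put a v) := h

theorem Agree.trans (h : Agree l σ σ') (h' : Agree l' σ' σ'') (hl : l' ⊆ l) : Agree l σ σ'' :=
  fun x hx => (h' x fun h => hx (hl h)).trans (h x hx)

theorem Agree.mono (h : Agree l σ σ') (hl : l ⊆ l') : Agree l' σ σ' :=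
  fun x hx => h x fun h => hx (hl h)

variable [DecidableEq ρ]

@[simp] theorem set_r (x y : ρ) (v : ℕ) : (σ.set x v).r y = if y = x then v else σ.r y := by
  simp [Store.set, Function.update_apply]
@[simp] theorem set_h (x : ρ) (v : ℕ) : (σ.set x v).h = σ.h := rfl

theorem Agree.set {x : ρ} {v : ℕ} (h : Agree l σ σ') (hx : x ∈ l) : Agree l σ (σ'.set x v) :=
  fun y hy => by
    have : y ≠ x := fun h' => hy (h' ▸ hx)
    simpa [this] using h y hy

end Expressions

infixl:60 "≔" => Stm.assign
infixr:50 ";;" => Stm.seq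

/-- The registers of the programs. -/
inductive Reg where
  | s | ka | kb | bA | bB | na | nb | pA | pB | K | base
  | v | err | f | q | g | w | p | j | u | i
  | ans | V | row | t | x | y | tot
  deriving DecidableEq

instance : Fintype Reg :=
  Fintype.ofList [.s, .ka, .kb, .bA, .bB, .na, .nb, .pA, .pB, .K, .base, .v, .err, .f, .q, .g, .w,
    .p, .j, .u, .i, .ans, .V, .row, .t, .x, .y, .tot] fun r => by cases r <;> simp

namespace Code

open Reg HyperAut.Expr HyperAut.Stm

/-- `p ≔ u ^ g` -/
def power : Stm Reg :=
  p ≔ 1 ;; j ≔ 0 ;; loop (g - j) (p ≔ p * u ;; j ≔ j + 1)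

/-- `w` becomes the number of the letter for the `f`-th choice of components of the letter `v`. -/
def getLetter : Stm Reg :=
  g ≔ f ;; w ≔ 0 ;; p ≔ 1 ;; j ≔ 0 ;;
  loop (kb - j) (
    i ≔ g % ka ;; g ≔ g / ka ;; u ≔ v ;;
    loop i (u ≔ u / s ;; i ≔ i - 1) ;;
    w ≔ w + p * (u % s) ;; p ≔ p * s ;; j ≔ j + 1)

/-- The transition of the product state on the heap for the letter `v`. -/
def move : Stm Reg :=
  f ≔ 0 ;;
  loop (K - f) (
    q ≔ heap f ;;
    ite (nb - q) (
      ite (input (bB + 2 + q)) (err ≔ 1) (err ≔ err) ;;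
      getLetter ;;
      store f (input (bB + 2 + nb + q * pB + w))) (q ≔ q) ;;
    f ≔ f + 1) ;;
  q ≔ heap K ;;
  ite (na - q)
    (ite (input (bA + 2 + q)) (store K (na + 1)) (store K (input (bA + 2 + na + q * pA + v))))
    (q ≔ q)

end Code

/-- The parameters of a check: size of the alphabet, arities and sizes of the automata, and the
positions of the automata in the input. -/
structure Params where
  s : ℕ
  ka : ℕ
  kb : ℕ
  na : ℕ
  nb : ℕ
  bA : ℕ
  bB : ℕ

/-- The number of choices of components. -/
def Params.K (P : Params) : ℕ := P.ka ^ P.kb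

/-- A number greater than those of all states. -/
def Params.base (P : Params) : ℕ := P.na + P.nb + 2

/-- The registers contain the parameters. -/
structure Ready (P : Params) (σ : Store Reg) : Prop where
  s : σ.r .s = P.s
  ka : σ.r .ka = P.ka
  kb : σ.r .kb = P.kb
  na : σ.r .na = P.na
  nb : σ.r .nb = P.nb
  bA : σ.r .bA = P.bA
  bB : σ.r .bB = P.bB
  pA : σ.r .pA = P.s ^ P.ka
  pB : σ.r .pB = P.s ^ P.kb
  K : σ.r .K = P.K
  base : σ.r .base = P.base

theorem Ready.agree {P : Params} {σ σ' : Store Reg} {l : List Reg} (h : Ready P σ)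
    (h' : Agree l σ σ')
    (hl : ∀ z ∈ [Reg.s, .ka, .kb, .na, .nb, .bA, .bB, .pA, .pB, .K, .base], z ∉ l) :
    Ready P σ' where
  s := (h' _ (hl _ (by simp))).trans h.s
  ka := (h' _ (hl _ (by simp))).trans h.ka
  kb := (h' _ (hl _ (by simp))).trans h.kb
  na := (h' _ (hl _ (by simp))).trans h.na
  nb := (h' _ (hl _ (by simp))).trans h.nb
  bA := (h' _ (hl _ (by simp))).trans h.bA
  bB := (h' _ (hl _ (by simp))).trans h.bB
  pA := (h' _ (hl _ (by simp))).trans h.pA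
  pB := (h' _ (hl _ (by simp))).trans h.pB
  K := (h' _ (hl _ (by simp))).trans h.K
  base := (h' _ (hl _ (by simp))).trans h.base

/-- The bounds needed for a check. -/
structure Enough (E : Env) (P : Params) : Prop where
  rounds : E.Z ≤ E.T
  one : 1 ≤ E.Z
  inp : ∀ a, E.inp.getD a 0 ≤ E.Z
  s : P.s ≤ E.Z
  ka : P.ka ≤ E.Z
  kb : P.kb ≤ E.Z
  bA : P.bA ≤ E.Z
  bB : P.bB ≤ E.Z
  pA : P.s ^ P.ka ≤ E.Z
  pB : P.s ^ P.kb ≤ E.Z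
  two_K : 2 * P.K + 3 ≤ E.Z
  base : P.base ≤ E.Z
  heap : P.K < E.H

theorem Enough.K {E : Env} {P : Params} (h : Enough E P) : P.K ≤ E.Z := by
  have := h.two_K
  omega

open Code

variable {E : Env} {P : Params} {σ : Store Reg}

theorem wp_power {Q : Store Reg → Prop} (hT : σ.r .g ≤ E.T) (hZ : σ.r .g ≤ E.Z) (h1 : 1 ≤ E.Z)
    (hp : ∀ m ≤ σ.r .g, σ.r .u ^ m ≤ E.Z)
    (hQ : ∀ σ', Agree [.p, .j] σ σ' → σ'.h = σ.h → σ'.r .p = σ.r .u ^ σ.r .g → Q σ') :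
    wp E power σ Q := by
  refine ⟨h1, Nat.zero_le _, ?_⟩
  refine wp_loop_count (σ.r .g) (fun m σ' => Agree [.p, .j] σ σ' ∧ σ'.h = σ.h ∧ σ'.r .j = m ∧
    σ'.r .p = σ.r .u ^ m) hT ?_ ?_ ?_
  · exact ⟨(Agree.refl.set (by decide)).set (by decide), rfl, by simp, by simp⟩
  · rintro m σ' hm ⟨h2, h3, h4, h5⟩
    have hg := h2 .g (by decide)
    have hu := h2 .u (by decide)
    refine ⟨by simp [hg, h4]; omega, ?_, ?_, (h2.set (by decide)).set (by decide), h3, ?_, ?_⟩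
    · have := hp (m + 1) (by omega)
      simpa [h5, hu, pow_succ] using this
    · simp [h4]; omega
    · simp [h4]
    · simp [h5, hu, pow_succ]
  · rintro σ' ⟨h2, h3, h4, h5⟩
    have hg := h2 .g (by decide)
    exact ⟨by simp [hg, h4], hQ σ' h2 h3 h5⟩

theorem wp_getLetter {Q : Store Reg → Prop} (hR : Ready P σ) (hE : Enough E P) (hs : 0 < P.s)
    (hf : σ.r .f ≤ E.Z) (hv : σ.r .v ≤ E.Z)
    (hQ : ∀ σ', Agree [.g, .w, .p, .j, .u, .i] σ σ' → σ'.h = σ.h →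
      σ'.r .w = letter P.s P.ka P.kb (σ.r .f) (σ.r .v) → Q σ') :
    wp E getLetter σ Q := by
  refine ⟨hf, Nat.zero_le _, hE.one, Nat.zero_le _, ?_⟩
  refine wp_loop_count P.kb (fun m σ' => Agree [.g, .w, .p, .j, .u, .i] σ σ' ∧ σ'.h = σ.h ∧
    σ'.r .j = m ∧ σ'.r .g = σ.r .f / P.ka ^ m ∧ σ'.r .p = P.s ^ m ∧ σ'.r .w < P.s ^ m ∧
    σ'.r .w = letter P.s P.ka m (σ.r .f) (σ.r .v)) (hE.kb.trans hE.rounds) ?_ ?_ ?_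
  · exact ⟨((((Agree.refl.set (by decide)).set (by decide)).set (by decide)).set (by decide)), rfl,
      by simp, by simp, by simp, by simp, by simp [letter]⟩
  · rintro m σ' hm ⟨h1, h2, h3, h4, h5, h6, h7⟩
    have hR' := hR.agree h1 (by decide)
    have hv' := h1 .v (by decide)
    have hg : σ'.r .g ≤ E.Z := by rw [h4]; exact (Nat.div_le_self _ _).trans hf
    have hmod : σ'.r .g % P.ka ≤ E.Z := (Nat.mod_le _ _).trans hg
    have hpow : P.s ^ (m + 1) ≤ E.Z := (Nat.pow_le_pow_right hs hm).trans hE.pB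
    refine ⟨by simp [hR'.kb, h3]; omega, ?_⟩
    refine ⟨by simpa [hR'.ka] using hmod, ?_, by simpa [hv'] using hv, ?_⟩
    · simpa using (Nat.div_le_self _ _).trans hg
    refine wp_loop_count (σ'.r .g % P.ka) (fun l τ => Agree [.g, .u, .i] σ' τ ∧ τ.h = σ.h ∧
      τ.r .g = σ.r .f / P.ka ^ (m + 1) ∧ τ.r .i = σ'.r .g % P.ka - l ∧
      τ.r .u = σ.r .v / P.s ^ l) (hmod.trans hE.rounds) ?_ ?_ ?_
    · refine ⟨((Agree.refl.set (by decide)).set (by decide)).set (by decide), h2, ?_, ?_, ?_⟩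
      · simp [hR'.ka, h4, pow_succ, Nat.div_div_eq_div_mul]
      · simp [hR'.ka]
      · simp [hv']
    · rintro l τ hl ⟨g1, g2, g3, g4, g5⟩
      have hs' : τ.r .s = P.s := (g1 .s (by decide)).trans hR'.s
      refine ⟨by simp [g4]; omega, ?_, ?_, (g1.set (by decide)).set (by decide), g2, ?_, ?_, ?_⟩
      · simp [g5]
        exact (Nat.div_le_self _ _).trans ((Nat.div_le_self _ _).trans hv)
      · simp [g4]; omega
      · simp [g3]
      · simp [g4]; omega
      · simp [g5, hs', pow_succ, Nat.div_div_eq_div_mul]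
    · rintro τ ⟨g1, g2, g3, g4, g5⟩
      have hs' : τ.r .s = P.s := (g1 .s (by decide)).trans hR'.s
      have hw' := g1 .w (by decide)
      have hp' := g1 .p (by decide)
      have hj' := g1 .j (by decide)
      have hlt : τ.r .w + τ.r .p * (τ.r .u % τ.r .s) < P.s ^ (m + 1) := by
        rw [hw', hp', hs', h5, pow_succ]
        have := Nat.mod_lt (τ.r .u) hs
        nlinarith [Nat.mul_le_mul_left (P.s ^ m) this]
      refine ⟨by simp [g4], ?_, ?_, ?_, ?_, g2, ?_, ?_, ?_, ?_, ?_⟩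
      · exact (by simpa using hlt.le.trans hpow)
      · simpa [hp', hs', h5, ← pow_succ] using hpow
      · simp [hj', h3]; exact le_trans hm hE.kb
      · exact (((h1.trans g1 (by decide)).set (by decide)).set (by decide)).set (by decide)
      · simp [hj', h3]
      · simp [g3]
      · simp [hp', hs', h5, pow_succ]
      · simpa using hlt
      · simp only [set_r, eval_add, eval_mul, eval_mod, eval_var, reduceCtorEq, if_false, if_true,
          letter, Finset.sum_range_succ, hw', h7, hp', h5, g5, hs', h4]
        rw [mul_comm]
  · rintro σ' ⟨h1, h2, h3, h4, h5, h6, h7⟩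
    have hR' := hR.agree h1 (by decide)
    exact ⟨by simp [hR'.kb, h3], hQ σ' h1 h2 h7⟩

theorem wp_move {Q : Store Reg → Prop} (hR : Ready P σ) (hE : Enough E P) (hs : 0 < P.s)
    (hv : σ.r .v ≤ E.Z) (hbad : σ.r .err ≤ E.Z) (hh : ∀ a ≤ P.K, σ.h a ≤ E.Z)
    (hQ : ∀ σ', Agree [.f, .q, .g, .w, .p, .j, .u, .i, .err] σ σ' →
      (σ'.r .err = 0 ↔ σ.r .err = 0 ∧
        ∀ a < P.K, σ.h a < P.nb → E.inp.getD (P.bB + 2 + σ.h a) 0 = 0) →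
      σ'.r .err ≤ E.Z →
      (∀ a < P.K, σ'.h a = if σ.h a < P.nb then E.inp.getD (P.bB + 2 + P.nb + σ.h a * P.s ^ P.kb +
        letter P.s P.ka P.kb a (σ.r .v)) 0 else σ.h a) →
      (σ'.h P.K = if σ.h P.K < P.na then
        if E.inp.getD (P.bA + 2 + σ.h P.K) 0 ≠ 0 then P.na + 1
        else E.inp.getD (P.bA + 2 + P.na + σ.h P.K * P.s ^ P.ka + σ.r .v) 0
        else σ.h P.K) →
      (∀ a, P.K < a → σ'.h a = σ.h a) → Q σ') :
    wp E move σ Q := by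
  refine ⟨Nat.zero_le _, ?_⟩
  have hKH := hE.heap
  refine wp_loop_count P.K (fun m σ' => Agree [.f, .q, .g, .w, .p, .j, .u, .i, .err] σ σ' ∧
    σ'.r .f = m ∧ (σ'.r .err = 0 ↔ σ.r .err = 0 ∧
        ∀ a < m, σ.h a < P.nb → E.inp.getD (P.bB + 2 + σ.h a) 0 = 0) ∧ σ'.r .err ≤ E.Z ∧
    (∀ a < m, σ'.h a = if σ.h a < P.nb then E.inp.getD (P.bB + 2 + P.nb + σ.h a * P.s ^ P.kb +
        letter P.s P.ka P.kb a (σ.r .v)) 0 else σ.h a) ∧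
    ∀ a, m ≤ a → σ'.h a = σ.h a) (hE.K.trans hE.rounds) ?_ ?_ ?_
  · exact ⟨Agree.refl.set (by decide), by simp, by simp, by simpa using hbad, by simp, by simp⟩
  · rintro m σ' hm ⟨h1, h2, h3, h4, h5, h6⟩
    have hR' := hR.agree h1 (by decide)
    have hq : σ'.h m = σ.h m := h6 m le_rfl
    have hv' := h1 .v (by decide)
    have hmK : m + 1 ≤ E.Z := le_trans hm hE.K
    refine ⟨by simp [hR'.K, h2]; omega, ?_⟩
    refine ⟨by simpa [h2, hq] using hh m hm.le, fun hlt => ?_, fun hlt => ?_⟩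
    · have hlt' : σ.h m < P.nb := by
        simp [hR'.nb, h2, hq] at hlt; omega
      have hbad' : ∀ τ : Store Reg, Agree [.q, .err] σ' τ → τ.r .q = σ.h m → τ.h = σ'.h →
          (τ.r .err = 0 ↔ σ.r .err = 0 ∧
            ∀ a < m + 1, σ.h a < P.nb → E.inp.getD (P.bB + 2 + σ.h a) 0 = 0) → τ.r .err ≤ E.Z →
          wp E (getLetter ;; .store (Expr.var .f) (.input ((Expr.var .bB) + 2 + .var .nb +
            .var .q * .var .pB + .var .w)) ) τ fun σ' =>
              wp E (Reg.f ≔ .var .f + 1) σ' fun σ' =>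
              Agree [.f, .q, .g, .w, .p, .j, .u, .i, .err] σ σ' ∧
            σ'.r .f = m + 1 ∧ (σ'.r .err = 0 ↔ σ.r .err = 0 ∧
                ∀ a < m + 1, σ.h a < P.nb → E.inp.getD (P.bB + 2 + σ.h a) 0 = 0) ∧
            σ'.r .err ≤ E.Z ∧
            (∀ a < m + 1, σ'.h a = if σ.h a < P.nb then
              E.inp.getD (P.bB + 2 + P.nb + σ.h a * P.s ^ P.kb +
                letter P.s P.ka P.kb a (σ.r .v)) 0 else σ.h a) ∧
            ∀ a, m + 1 ≤ a → σ'.h a = σ.h a := by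
        intro τ g1 g2 g3 g4 g5
        have hRτ := hR'.agree g1 (by decide)
        have hfτ := (g1 .f (by decide)).trans h2
        have hvτ := (g1 .v (by decide)).trans hv'
        refine wp_getLetter hRτ hE hs (by omega) (by omega) fun τ' k1 k2 k3 => ?_
        have hRτ' := hRτ.agree k1 (by decide)
        have hfτ' := (k1 .f (by decide)).trans hfτ
        have hqτ' := (k1 .q (by decide)).trans g2
        have hbτ' := k1 .err (by decide)
        refine ⟨by simp [hfτ']; omega, hE.inp _, by simpa [hfτ'] using hmK, ?_, ?_, ?_, ?_, ?_, ?_⟩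
        · exact (((h1.trans g1 (by decide)).trans k1 (by decide)).put).set (by decide)
        · simp [hfτ']
        · simpa [hbτ'] using g4
        · simpa [hbτ'] using g5
        · intro a ha
          rcases Nat.lt_succ_iff_lt_or_eq.1 ha with ha | rfl
          · have := h5 a ha
            simp only [set_h, put_h, eval_var, hfτ', ha.ne, if_false, k2, g3, this]
          · simp only [set_h, put_h, eval_var, hfτ', if_true, hlt', eval_input, eval_add, eval_mul,
              eval_two, hRτ'.bB, hRτ'.nb, hRτ'.pB, hqτ', k3, hfτ, hvτ]
        · intro a ha
          simp only [set_h, put_h, eval_var, hfτ', if_neg (show ¬ a = m by omega), k2, g3]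
          exact h6 a (by omega)
      have hinp : (Expr.input (Expr.var Reg.bB + 2 + Expr.var .q)).eval E.inp
          (σ'.set .q ((Expr.heap (Expr.var .f)).eval E.inp σ')) =
          E.inp.getD (P.bB + 2 + σ.h m) 0 := by
        simp [hR'.bB, h2, hq]
      refine ⟨fun hacc => ?_, fun hacc => ?_⟩
      · rw [hinp] at hacc
        refine ⟨hE.one, ?_⟩
        refine hbad' _ ((Agree.refl.set (by decide)).set (by decide)) (by simp [h2, hq]) rfl ?_ ?_
        · simp only [set_r, if_true, eval_one, one_ne_zero, false_iff, not_and, not_forall]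
          exact fun _ => ⟨m, by omega, hlt', hacc⟩
        · simpa using hE.one
      · rw [hinp] at hacc
        refine ⟨by simpa using h4, ?_⟩
        refine hbad' _ ((Agree.refl.set (by decide)).set (by decide)) (by simp [h2, hq]) rfl ?_ ?_
        · simp only [set_r, if_true, eval_var, reduceCtorEq, if_false, h3]
          refine and_congr_right fun _ => ⟨fun h a ha hlt => ?_, fun h a ha => h a (by omega)⟩
          rcases Nat.lt_succ_iff_lt_or_eq.1 ha with ha | rfl
          · exact h a ha hlt
          · exact hacc
        · simpa using h4
    · have hlt' : ¬ σ.h m < P.nb := by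
        simp [hR'.nb, h2, hq] at hlt; omega
      refine ⟨by simpa [h2, hq] using hh m hm.le, by simpa [h2] using hmK, ?_, ?_, ?_, ?_, ?_, ?_⟩
      · exact ((h1.set (by decide)).set (by decide)).set (by decide)
      · simp [h2]
      · simp only [set_r, reduceCtorEq, if_false, h3]
        refine and_congr_right fun _ => ⟨fun h a ha hlt => ?_, fun h a ha => h a (by omega)⟩
        rcases Nat.lt_succ_iff_lt_or_eq.1 ha with ha | rfl
        · exact h a ha hlt
        · exact absurd hlt hlt'
      · simpa using h4
      · intro a ha
        rcases Nat.lt_succ_iff_lt_or_eq.1 ha with ha | rfl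
        · exact h5 a ha
        · rw [if_neg hlt']; exact hq
      · exact fun a ha => h6 a (by omega)
  · rintro σ' ⟨h1, h2, h3, h4, h5, h6⟩
    have hR' := hR.agree h1 (by decide)
    have hq : σ'.h P.K = σ.h P.K := h6 _ le_rfl
    have hv' := h1 .v (by decide)
    have hbase := hE.base
    unfold Params.base at hbase
    refine ⟨by simp [hR'.K, h2], by simpa [hR'.K, hq] using hh _ le_rfl,
      fun hlt => ?_, fun hlt => ?_⟩
    · have hlt' : σ.h P.K < P.na := by
        simp [hR'.na, hR'.K, hq] at hlt; omega
      refine ⟨fun hacc => ?_, fun hacc => ?_⟩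
      · have hacc' : E.inp.getD (P.bA + 2 + σ.h P.K) 0 ≠ 0 := by
          simpa [hR'.bA, hR'.K, hq] using hacc
        refine ⟨by simpa [hR'.K] using hE.heap, by simp [hR'.na]; omega, hQ _ ?_ ?_ ?_ ?_ ?_ ?_⟩
        · exact (h1.set (by decide)).put
        · simpa using h3
        · simpa using h4
        · intro a ha
          simp only [put_h, eval_var, set_r, reduceCtorEq, if_false, hR'.K, ha.ne]
          exact h5 a ha
        · simp only [put_h, eval_var, set_r, reduceCtorEq, if_false, hR'.K, if_true, hlt', hacc',
            eval_add, eval_one, hR'.na, ne_eq, not_false_eq_true]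
        · intro a ha
          simp only [put_h, eval_var, set_r, reduceCtorEq, if_false, hR'.K, ha.ne']
          exact h6 a ha.le
      · have hacc' : E.inp.getD (P.bA + 2 + σ.h P.K) 0 = 0 := by
          simpa [hR'.bA, hR'.K, hq] using hacc
        refine ⟨by simpa [hR'.K] using hE.heap, hE.inp _, hQ _ ?_ ?_ ?_ ?_ ?_ ?_⟩
        · exact (h1.set (by decide)).put
        · simpa using h3
        · simpa using h4
        · intro a ha
          simp only [put_h, eval_var, set_r, reduceCtorEq, if_false, hR'.K, ha.ne]
          exact h5 a ha
        · simp only [put_h, eval_var, set_r, reduceCtorEq, if_false, hR'.K, if_true, hlt', hacc',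
            eval_add, eval_two, eval_input, eval_mul, eval_heap, hR'.na, hR'.bA, hR'.pA, hq, hv',
            ne_eq, not_true_eq_false]
        · intro a ha
          simp only [put_h, eval_var, set_r, reduceCtorEq, if_false, hR'.K, ha.ne']
          exact h6 a ha.le
    · have hlt' : ¬ σ.h P.K < P.na := by
        simp [hR'.na, hR'.K, hq] at hlt; omega
      refine ⟨by simpa [hR'.K, hq] using hh _ le_rfl, hQ _ ?_ ?_ ?_ ?_ ?_ ?_⟩
      · exact (h1.set (by decide)).set (by decide)
      · simpa using h3
      · simpa using h4
      · exact h5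
      · rw [if_neg hlt']; exact hq
      · exact fun a ha => h6 a ha.le

end HyperAut

namespace HyperAut

/-! ### Common parts of the two programs -/

namespace Code

open Reg HyperAut.Expr HyperAut.Stm

/-- Reading the parameters from the input. -/
def readInput : Stm Reg :=
  s ≔ input 0 ;; ka ≔ input 1 ;; kb ≔ input 2 ;; bA ≔ 3 ;; u ≔ s ;; g ≔ ka ;; power ;;
  bB ≔ 3 + 2 + input 3 + input 3 * var p

/-- Exchange of the two automata. -/
def swap : Stm Reg :=
  t ≔ ka ;; ka ≔ kb ;; kb ≔ t ;; t ≔ bA ;; bA ≔ bB ;; bB ≔ t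

/-- Computation of the remaining parameters. -/
def prepare : Stm Reg :=
  na ≔ input bA ;; nb ≔ input bB ;;
  u ≔ s ;; g ≔ ka ;; power ;; pA ≔ p ;;
  g ≔ kb ;; power ;; pB ≔ p ;;
  u ≔ ka ;; power ;; K ≔ p ;;
  base ≔ na + nb + 2

/-- The initial product state. -/
def start : Stm Reg :=
  f ≔ 0 ;; loop (K - f) (store f (input (bB + 1)) ;; f ≔ f + 1) ;; store K (input (bA + 1))

end Code

open Code

variable {E : Env} {σ : Store Reg}

/-- The registers contain those parameters that `prepare` needs. -/
structure Given (P : Params) (σ : Store Reg) : Prop where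
  s : σ.r .s = P.s
  ka : σ.r .ka = P.ka
  kb : σ.r .kb = P.kb
  bA : σ.r .bA = P.bA
  bB : σ.r .bB = P.bB

theorem pow_le_of_le_pow {b c m Z : ℕ} (h1 : 1 ≤ Z) (h : b ^ c ≤ Z) (hm : m ≤ c) : b ^ m ≤ Z := by
  rcases Nat.eq_zero_or_pos b with rfl | hb
  · rcases Nat.eq_zero_or_pos m with rfl | hm
    · simpa using h1
    · simp [hm.ne']
  · exact (Nat.pow_le_pow_right hb hm).trans h

theorem wp_prepare {P : Params} {Q : Store Reg → Prop} (hG : Given P σ) (hE : Enough E P)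
    (hna : E.inp.getD P.bA 0 = P.na) (hnb : E.inp.getD P.bB 0 = P.nb)
    (hQ : ∀ σ', Agree [.na, .nb, .pA, .pB, .K, .base, .u, .g, .p, .j] σ σ' → σ'.h = σ.h →
      Ready P σ' → Q σ') : wp E prepare σ Q := by
  have hT := hE.rounds
  have hb := hE.base
  unfold Params.base at hb
  refine ⟨hE.inp _, hE.inp _, ?_, ?_, ?_⟩
  · simpa [hG.s] using hE.s
  · simpa [hG.ka] using hE.ka
  refine wp_power ?_ ?_ hE.one ?_ fun σ₁ a1 b1 c1 => ?_
  · simpa [hG.ka] using hE.ka.trans hT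
  · simpa [hG.ka] using hE.ka
  · intro m hm
    simp [hG.ka] at hm
    simpa [hG.s] using pow_le_of_le_pow hE.one hE.pA hm
  have c1' : σ₁.r .p = P.s ^ P.ka := by simpa [hG.s, hG.ka] using c1
  have e1 : Agree [.na, .nb, .u, .g, .p, .j] σ σ₁ :=
    ((((Agree.refl.set (by decide)).set (by decide)).set (by decide)).set (by decide)).trans a1
      (by decide)
  have kb1 : σ₁.r .kb = P.kb := (e1 .kb (by decide)).trans hG.kb
  have u1 : σ₁.r .u = P.s := (a1 .u (by decide)).trans (by simp [hG.s])
  refine ⟨?_, ?_, ?_⟩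
  · simpa [c1'] using hE.pA
  · simpa [kb1] using hE.kb
  refine wp_power ?_ ?_ hE.one ?_ fun σ₂ a2 b2 c2 => ?_
  · simpa [kb1] using hE.kb.trans hT
  · simpa [kb1] using hE.kb
  · intro m hm
    simp [kb1] at hm
    simpa [u1] using pow_le_of_le_pow hE.one hE.pB hm
  have c2' : σ₂.r .p = P.s ^ P.kb := by simpa [u1, kb1] using c2
  have e2 : Agree [.na, .nb, .pA, .u, .g, .p, .j] σ σ₂ :=
    (((e1.mono (by decide)).set (by decide)).set
      (by decide)).trans a2 (by decide)
  have g2 : σ₂.r .g = P.kb := (a2 .g (by decide)).trans (by simp [kb1])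
  have ka2 : σ₂.r .ka = P.ka := (e2 .ka (by decide)).trans hG.ka
  refine ⟨?_, ?_, ?_⟩
  · simpa [c2'] using hE.pB
  · simpa [ka2] using hE.ka
  refine wp_power ?_ ?_ hE.one ?_ fun σ₃ a3 b3 c3 => ?_
  · simpa [g2] using hE.kb.trans hT
  · simpa [g2] using hE.kb
  · intro m hm
    simp [g2] at hm
    simpa [ka2] using pow_le_of_le_pow (c := P.kb) hE.one hE.K hm
  have c3' : σ₃.r .p = P.K := by simpa [g2, ka2, Params.K] using c3
  have e3 : Agree [.na, .nb, .pA, .pB, .u, .g, .p, .j] σ σ₃ :=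
    (((e2.mono (by decide)).set (by decide)).set (by decide)).trans a3 (by decide)
  have pB3 : σ₃.r .pB = P.s ^ P.kb := (a3 .pB (by decide)).trans (by simp [c2'])
  have pA2 : σ₂.r .pA = P.s ^ P.ka := (a2 .pA (by decide)).trans (by simp [c1'])
  have pA3 : σ₃.r .pA = P.s ^ P.ka := (a3 .pA (by decide)).trans (by simp [pA2])
  have na1 : σ₁.r .na = P.na := (a1 .na (by decide)).trans
    (by simp [-List.getD_eq_getElem?_getD, hG.bA, hna])
  have nb1 : σ₁.r .nb = P.nb := (a1 .nb (by decide)).trans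
    (by simp [-List.getD_eq_getElem?_getD, hG.bB, hnb])
  have na2 : σ₂.r .na = P.na := (a2 .na (by decide)).trans (by simp [na1])
  have nb2 : σ₂.r .nb = P.nb := (a2 .nb (by decide)).trans (by simp [nb1])
  have na3 : σ₃.r .na = P.na := (a3 .na (by decide)).trans (by simp [na2])
  have nb3 : σ₃.r .nb = P.nb := (a3 .nb (by decide)).trans (by simp [nb2])
  have s3 : σ₃.r .s = P.s := (e3 .s (by decide)).trans hG.s
  have ka3 : σ₃.r .ka = P.ka := (e3 .ka (by decide)).trans hG.ka
  have kb3 : σ₃.r .kb = P.kb := (e3 .kb (by decide)).trans hG.kb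
  have bA3 : σ₃.r .bA = P.bA := (e3 .bA (by decide)).trans hG.bA
  have bB3 : σ₃.r .bB = P.bB := (e3 .bB (by decide)).trans hG.bB
  refine ⟨?_, ?_, hQ _ ?_ ?_ ?_⟩
  · simpa [c3'] using hE.K
  · simp [na3, nb3]; omega
  · exact ((e3.mono (by decide)).set (by decide)).set (by decide)
  · rw [set_h, set_h, b3, set_h, set_h, b2, set_h, set_h, b1]; rfl
  · constructor <;> simp [s3, ka3, kb3, bA3, bB3, na3, nb3, pA3, pB3, c3', Params.base]

theorem wp_swap {Q : Store Reg → Prop} {P P' : Params} (hG : Given P σ) (hE : Enough E P)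
    (h1 : P'.s = P.s) (h2 : P'.ka = P.kb) (h3 : P'.kb = P.ka) (h4 : P'.bA = P.bB)
    (h5 : P'.bB = P.bA)
    (hQ : ∀ σ', Agree [.t, .ka, .kb, .bA, .bB] σ σ' → σ'.h = σ.h → Given P' σ' → Q σ') :
    wp E swap σ Q := by
  refine ⟨?_, ?_, ?_, ?_, ?_, ?_, hQ _ ?_ rfl ?_⟩
  · simpa [hG.ka] using hE.ka
  · simpa [hG.kb] using hE.kb
  · simpa [hG.ka] using hE.ka
  · simpa [hG.bA] using hE.bA
  · simpa [hG.bB] using hE.bB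
  · simpa [hG.bA] using hE.bA
  · exact (((((Agree.refl.set (by decide)).set (by decide)).set (by decide)).set (by decide)).set
      (by decide)).set (by decide)
  · constructor <;> simp [h1, h2, h3, h4, h5, hG.s, hG.ka, hG.kb, hG.bA, hG.bB]

theorem wp_readInput {Q : Store Reg → Prop} {P : Params} (hE : Enough E P) (h3 : 3 ≤ E.Z)
    (hs : E.inp.getD 0 0 = P.s) (hka : E.inp.getD 1 0 = P.ka) (hkb : E.inp.getD 2 0 = P.kb)
    (hbA : P.bA = 3)
    (hbB : P.bB = 3 + 2 + E.inp.getD 3 0 + E.inp.getD 3 0 * P.s ^ P.ka)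
    (hQ : ∀ σ', Agree [.s, .ka, .kb, .bA, .bB, .u, .g, .p, .j] σ σ' → σ'.h = σ.h →
      Given P σ' → Q σ') : wp E readInput σ Q := by
  refine ⟨hE.inp _, hE.inp _, hE.inp _, h3, ?_, ?_, ?_⟩
  · simpa using hE.inp 0
  · simpa using hE.inp 1
  refine wp_power ?_ ?_ hE.one ?_ fun σ₁ a1 b1 c1 => ?_
  · simpa using (hE.inp 1).trans hE.rounds
  · simpa using hE.inp 1
  · intro m hm
    simp only [set_r, eval_input, eval_var, eval_one, eval_zero, reduceCtorEq, if_false, if_true,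
      hka] at hm
    simp only [set_r, eval_input, eval_var, eval_one, eval_zero, reduceCtorEq, if_false, if_true,
      hs]
    exact pow_le_of_le_pow hE.one hE.pA hm
  have c1' : σ₁.r .p = P.s ^ P.ka := by
    simpa only [set_r, eval_input, eval_var, eval_one, eval_zero, reduceCtorEq, if_false, if_true,
      hs, hka] using c1
  have hB : (3 + 2 + Expr.input 3 + Expr.input 3 * Expr.var Reg.p).eval E.inp σ₁ = P.bB := by
    simp only [eval_add, eval_mul, eval_input, eval_var, eval_three, eval_two, c1', hbB]
  have s1 : σ₁.r .s = P.s := (a1 .s (by decide)).trans (by simpa using hs)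
  have ka1 : σ₁.r .ka = P.ka := (a1 .ka (by decide)).trans (by simpa using hka)
  have kb1 : σ₁.r .kb = P.kb := (a1 .kb (by decide)).trans (by simpa using hkb)
  have bA1 : σ₁.r .bA = P.bA := (a1 .bA (by decide)).trans (by simp [hbA])
  refine ⟨by rw [hB]; exact hE.bB, hQ _ ?_ ?_ ?_⟩
  · exact (((((((Agree.refl.set (by decide)).set (by decide)).set (by decide)).set (by decide)).set
      (by decide)).set (by decide)).trans a1 (by decide)).set (by decide)
  · rw [set_h, b1]; rfl
  · rw [hB]
    constructor <;> simp [s1, ka1, kb1, bA1]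

/-- The parameters of a check of the automata `A`, `B`. -/
def paramsOf (s k k' n n' bA bB : ℕ) : Params := ⟨s, k, k', n, n', bA, bB⟩

variable {s k k' n n' bA bB : ℕ} {B : DetAut (Fin k' → Fin s) n'} {A : DetAut (Fin k → Fin s) n}

/-- The first heap cells contain the product state `x`. -/
def Holds (x : ProdState k k' n n') (σ : Store Reg) : Prop := ∀ i ≤ k ^ k', σ.h i = dig x i

theorem wp_start {Q : Store Reg → Prop} (hR : Ready (paramsOf s k k' n n' bA bB) σ)
    (hE : Enough E (paramsOf s k k' n n' bA bB)) (hA : Encodes E.inp bA A)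
    (hB : Encodes E.inp bB B)
    (hQ : ∀ σ', Agree [.f] σ σ' → Holds (prodStart A B) σ' → (∀ a, k ^ k' < a → σ'.h a = σ.h a) →
      Q σ') : wp E start σ Q := by
  have hH : k ^ k' < E.H := hE.heap
  have hKZ : k ^ k' ≤ E.Z := hE.K
  refine ⟨Nat.zero_le _, ?_⟩
  refine wp_loop_count (k ^ k') (fun m σ' => Agree [.f] σ σ' ∧ σ'.r .f = m ∧
    (∀ a < m, σ'.h a = E.inp.getD (bB + 1) 0) ∧ ∀ a, k ^ k' < a → σ'.h a = σ.h a)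
    (hKZ.trans hE.rounds) ?_ ?_ ?_
  · exact ⟨Agree.refl.set (by decide), by simp, by simp, by simp⟩
  · rintro m σ' hm ⟨h1, h2, h3, h4⟩
    have hR' := hR.agree h1 (by decide)
    have hK : σ'.r .K = k ^ k' := hR'.K
    have hbB : σ'.r .bB = bB := hR'.bB
    refine ⟨by simp [hK, h2]; omega, by simp [h2]; omega, hE.inp _, by simp [h2]; omega, ?_, ?_, ?_,
      ?_⟩
    · exact h1.put.set (by decide)
    · simp [h2]
    · intro a ha
      rcases Nat.lt_succ_iff_lt_or_eq.1 ha with ha | rfl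
      · simpa [h2, ha.ne] using h3 a ha
      · simp [h2, hbB]
    · intro a ha
      simpa [h2, show a ≠ m by omega] using h4 a ha
  · rintro σ' ⟨h1, h2, h3, h4⟩
    have hR' := hR.agree h1 (by decide)
    have hK : σ'.r .K = k ^ k' := hR'.K
    have hbA : σ'.r .bA = bA := hR'.bA
    refine ⟨by simp [hK, h2], by simpa [hK] using hH, hE.inp _, hQ _ h1.put ?_ ?_⟩
    · intro i hi
      rcases hi.lt_or_eq with hi | rfl
      · rw [dig_prodStart_of_lt hB hi]
        simpa [hK, hi.ne] using h3 i hi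
      · rw [dig_prodStart_last hA]
        simp [hK, hbA]
    · intro a ha
      simpa [hK, ha.ne'] using h4 a ha

theorem wp_move_prod {Q : Store Reg → Prop} (hR : Ready (paramsOf s k k' n n' bA bB) σ)
    (hE : Enough E (paramsOf s k k' n n' bA bB)) (hA : Encodes E.inp bA A)
    (hB : Encodes E.inp bB B) (hs : 0 < s) {x : ProdState k k' n n'} {v : Fin k → Fin s}
    (hx : Holds x σ) (hv : σ.r .v = (finFunctionFinEquiv v : Fin (s ^ k))) (herr : σ.r .err ≤ E.Z)
    (hQ : ∀ σ', Agree [.f, .q, .g, .w, .p, .j, .u, .i, .err] σ σ' →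
      (σ'.r .err = 0 ↔ σ.r .err = 0 ∧ ¬ ProdBad B x) → σ'.r .err ≤ E.Z →
      Holds (prodStep A B x v) σ' → (∀ a, k ^ k' < a → σ'.h a = σ.h a) → Q σ') :
    wp E move σ Q := by
  have hpA : s ^ k ≤ E.Z := hE.pA
  have hbase : n + n' + 2 ≤ E.Z := hE.base
  refine wp_move hR hE hs (by rw [hv]; exact (finFunctionFinEquiv v).2.le.trans hpA) herr ?_ ?_
  · intro a ha
    rw [hx a ha]
    exact (dig_lt x a).le.trans hbase
  · intro σ' h1 h2 h3 h4 h5 h6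
    refine hQ σ' h1 (h2.trans (and_congr_right fun _ => ?_)) h3 ?_ h6
    · rw [prodBad_iff hB]
      push Not
      refine forall₂_congr fun a ha => ?_
      rw [hx a (le_of_lt ha)]
      rfl
    · intro i hi
      rcases hi.lt_or_eq with hi | rfl
      · rw [h4 i hi, dig_prodStep_of_lt hB x v hi, hx i hi.le, hv]
        rfl
      · rw [dig_prodStep_last hA x v]
        refine h5.trans ?_
        rw [show (paramsOf s k k' n n' bA bB).K = k ^ k' from rfl, hx _ le_rfl, hv]
        rfl

end HyperAut

namespace HyperAut

/-! ### The nondeterministic search -/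

namespace Code

open Reg HyperAut.Expr HyperAut.Stm

/-- Setting the counter to zero. -/
def clear : Stm Reg :=
  f ≔ 0 ;; loop (K + 2 - var f) (store (K + 1 + var f) 0 ;; f ≔ f + 1)

/-- Incrementing the counter. -/
def increment : Stm Reg :=
  f ≔ K + 1 ;; loop ((heap f + 1) / var base) (store f 0 ;; f ≔ f + 1) ;; store f (heap f + 1)

/-- Guessing a walk, and checking that it ends in a state in which the first automaton has
accepted. -/
def guessWalk : Stm Reg :=
  clear ;;
  loop (1 - heap (var K + 1 + (var K + 1))) (guess v (pA - 1) ;; move ;; increment) ;;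
  ite (heap K - var na) (err ≔ err) (err ≔ 1)

/-- The search for a counterexample. -/
def search : Stm Reg :=
  prepare ;; start ;; err ≔ 0 ;; guessWalk ;; guessWalk ;; ans ≔ err

/-- The search in both directions. -/
def searchBoth : Stm Reg :=
  readInput ;; guess t 1 ;; ite t swap (t ≔ t) ;; ite s search (ans ≔ 1)

end Code

open Code

theorem sum_mul_pow_lt {b : ℕ} {c : ℕ → ℕ} {m : ℕ} (h : ∀ i < m, c i < b) :
    ∑ i ∈ Finset.range m, c i * b ^ i < b ^ m := by
  induction m with
  | zero => simp
  | succ m ih =>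
    rw [Finset.sum_range_succ, pow_succ]
    have h1 := ih fun i hi => h i (by omega)
    have h2 := Nat.mul_le_mul_right (b ^ m) (show c m + 1 ≤ b from h m (by omega))
    rw [add_mul, one_mul] at h2
    rw [mul_comm (b ^ m)]
    omega

/-- The value of the counter on the heap, whose digits to the base `b` follow the cell `K`. -/
def counter (K b : ℕ) (h : ℕ → ℕ) : ℕ := ∑ i ∈ Finset.range (K + 2), h (K + 1 + i) * b ^ i

theorem counter_update {K b j : ℕ} (h : ℕ → ℕ) (v : ℕ) (hj : j < K + 2) :
    counter K b (Function.update h (K + 1 + j) v) + h (K + 1 + j) * b ^ j =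
      counter K b h + v * b ^ j := by
  unfold counter
  rw [← Finset.add_sum_erase _ _ (Finset.mem_range.2 hj),
    ← Finset.add_sum_erase _ (fun i => h (K + 1 + i) * b ^ i) (Finset.mem_range.2 hj)]
  have : ∑ i ∈ (Finset.range (K + 2)).erase j,
      Function.update h (K + 1 + j) v (K + 1 + i) * b ^ i =
      ∑ i ∈ (Finset.range (K + 2)).erase j, h (K + 1 + i) * b ^ i := by
    refine Finset.sum_congr rfl fun i hi => ?_
    rw [Function.update_of_ne]
    have := Finset.ne_of_mem_erase hi
    omega
  rw [this, Function.update_self]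
  ring

theorem le_counter {K b j : ℕ} (h : ℕ → ℕ) (hj : j < K + 2) :
    h (K + 1 + j) * b ^ j ≤ counter K b h :=
  Finset.single_le_sum (f := fun i => h (K + 1 + i) * b ^ i) (fun _ _ => Nat.zero_le _)
    (Finset.mem_range.2 hj)

theorem counter_lt_iff {K b : ℕ} {h : ℕ → ℕ} (hd : ∀ i < K + 2, h (K + 1 + i) < b) :
    counter K b h < b ^ (K + 1) ↔ h (K + 1 + (K + 1)) = 0 := by
  constructor
  · intro hlt
    by_contra h0
    have h1 := le_counter (K := K) (b := b) h (show K + 1 < K + 2 by omega)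
    have h2 := Nat.mul_le_mul_right (b ^ (K + 1)) (Nat.one_le_iff_ne_zero.2 h0)
    omega
  · intro h0
    rw [counter, Finset.sum_range_succ, h0, zero_mul, add_zero]
    exact sum_mul_pow_lt fun i hi => hd i (by omega)

variable {E : Env} {σ : Store Reg}

theorem wp_clear {P : Params} {Q : Store Reg → Prop} (hR : Ready P σ) (hE : Enough E P)
    (hH : 2 * P.K + 2 < E.H)
    (hQ : ∀ σ', Agree [.f] σ σ' → (∀ i < P.K + 2, σ'.h (P.K + 1 + i) = 0) →
      (∀ a ≤ P.K, σ'.h a = σ.h a) → Q σ') : wp E clear σ Q := by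
  have hK := hE.two_K
  refine ⟨Nat.zero_le _, ?_⟩
  refine wp_loop_count (P.K + 2) (fun m σ' => Agree [.f] σ σ' ∧ σ'.r .f = m ∧
    (∀ i < m, σ'.h (P.K + 1 + i) = 0) ∧ ∀ a ≤ P.K, σ'.h a = σ.h a)
    (le_trans (by omega) hE.rounds) ?_ ?_ ?_
  · exact ⟨Agree.refl.set (by decide), by simp, by simp, by simp⟩
  · rintro m σ' hm ⟨h1, h2, h3, h4⟩
    have hR' := hR.agree h1 (by decide)
    refine ⟨by simp [hR'.K, h2]; omega, by simp [hR'.K, h2]; omega, Nat.zero_le _,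
      by simp [h2]; omega, h1.put.set (by decide), by simp [h2], fun i hi => ?_, fun a ha => ?_⟩
    · by_cases him : i = m
      · simp [hR'.K, h2, him]
      · simpa [hR'.K, h2, him] using h3 i (by omega)
    · simpa [hR'.K, h2, show a ≠ P.K + 1 + m by omega] using h4 a ha
  · rintro σ' ⟨h1, h2, h3, h4⟩
    have hR' := hR.agree h1 (by decide)
    exact ⟨by simp [hR'.K, h2], hQ σ' h1 h3 h4⟩

theorem wp_increment {P : Params} {Q : Store Reg → Prop} {t : ℕ} (hR : Ready P σ) (hE : Enough E P)
    (hH : 2 * P.K + 2 < E.H) (hd : ∀ i < P.K + 2, σ.h (P.K + 1 + i) < P.base)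
    (ht : counter P.K P.base σ.h = t) (htV : t < P.base ^ (P.K + 1))
    (hQ : ∀ σ', Agree [.f] σ σ' → (∀ i < P.K + 2, σ'.h (P.K + 1 + i) < P.base) →
      counter P.K P.base σ'.h = t + 1 → (∀ a ≤ P.K, σ'.h a = σ.h a) → Q σ') :
    wp E increment σ Q := by
  have hK := hE.two_K
  have hbase := hE.base
  have hb2 : 2 ≤ P.base := by unfold Params.base; omega
  refine ⟨by simp [hR.K]; omega, ?_⟩
  refine wp_loop_measure (fun σ' => ∃ j ≤ P.K + 1, σ'.r .f = P.K + 1 + j ∧ Agree [.f] σ σ' ∧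
      (∀ i < P.K + 2, σ'.h (P.K + 1 + i) < P.base) ∧
      counter P.K P.base σ'.h + P.base ^ j = t + 1 ∧ ∀ a ≤ P.K, σ'.h a = σ.h a)
    (fun σ' => 2 * P.K + 2 - σ'.r .f) ?_ ?_ ?_ ?_
  · exact le_trans (by omega) hE.rounds
  · exact ⟨0, by omega, by simp [hR.K], Agree.refl.set (by decide), hd, by simp [ht], by simp⟩
  · rintro σ' ⟨j, h1, h2, h3, h4, h5, h6⟩ htest
    have hR' := hR.agree h3 (by decide)
    have h7 := h4 j (by omega)
    have h8 : σ'.h (P.K + 1 + j) + 1 = P.base := by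
      by_contra hne
      refine htest ?_
      simp only [eval_div, eval_add, eval_heap, eval_var, eval_one, h2, hR'.base]
      exact Nat.div_eq_of_lt (by omega)
    have hj : j ≤ P.K := by
      by_contra hj
      obtain rfl : j = P.K + 1 := by omega
      have h9 := le_counter (K := P.K) (b := P.base) σ'.h (show P.K + 1 < P.K + 2 by omega)
      have h10 := Nat.mul_le_mul_right (P.base ^ (P.K + 1))
        (show 1 ≤ σ'.h (P.K + 1 + (P.K + 1)) by omega)
      have : 0 < P.base ^ (P.K + 1) := Nat.pow_pos (by omega)
      omega
    refine ⟨by omega, by simp [h2]; omega, Nat.zero_le _, by simp [h2]; omega, ?_, ?_⟩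
    · refine ⟨j + 1, by omega, by simp [h2]; omega, h3.put.set (by decide), ?_, ?_, ?_⟩
      · intro i hi
        by_cases hij : i = j
        · simp [h2, hij]; omega
        · simpa [h2, hij] using h4 i hi
      · have hu := counter_update (K := P.K) (b := P.base) σ'.h 0 (show j < P.K + 2 by omega)
        have hh : ((σ'.put ((Expr.var Reg.f).eval E.inp σ')
            ((0 : Expr Reg).eval E.inp σ')).set .f ((Expr.var Reg.f + 1).eval E.inp
            (σ'.put ((Expr.var Reg.f).eval E.inp σ') ((0 : Expr Reg).eval E.inp σ')))).h =
            Function.update σ'.h (P.K + 1 + j) 0 := by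
          simp [Store.put, Store.set, h2]
        rw [hh]
        have h11 : P.base ^ (j + 1) = σ'.h (P.K + 1 + j) * P.base ^ j + P.base ^ j := by
          rw [pow_succ, ← add_one_mul, h8, mul_comm]
        omega
      · intro a ha
        simpa [h2, show a ≠ P.K + 1 + j by omega] using h6 a ha
    · simp [h2]; omega
  · rintro σ' ⟨j, h1, h2, h3, h4, h5, h6⟩ htest
    have hR' := hR.agree h3 (by decide)
    have h8 : σ'.h (P.K + 1 + j) + 1 < P.base := by
      simp only [eval_div, eval_add, eval_heap, eval_var, eval_one, h2, hR'.base] at htest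
      rcases Nat.div_eq_zero_iff.1 htest with h | h <;> omega
    refine ⟨by simp [h2]; omega, by simp [h2]; omega, hQ _ h3.put ?_ ?_ ?_⟩
    · intro i hi
      by_cases hij : i = j
      · simpa [h2, hij] using h8
      · simpa [h2, hij] using h4 i hi
    · have hu := counter_update (K := P.K) (b := P.base) σ'.h (σ'.h (P.K + 1 + j) + 1)
        (show j < P.K + 2 by omega)
      have hh : (σ'.put ((Expr.var Reg.f).eval E.inp σ')
          ((Expr.heap (Expr.var Reg.f) + 1).eval E.inp σ')).h =
          Function.update σ'.h (P.K + 1 + j) (σ'.h (P.K + 1 + j) + 1) := by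
        simp [Store.put, h2]
      rw [hh]
      rw [add_one_mul] at hu
      omega
    · intro a ha
      simpa [h2, show a ≠ P.K + 1 + j by omega] using h6 a ha

/-- The statement `p` for all choices or for some choice. -/
def Choice {Λ : Type*} (dem : Bool) (p : Λ → Prop) : Prop := bif dem then ∀ v, p v else ∃ v, p v

theorem wp_guess {z : Reg} {e : Expr Reg} {Λ : Type*} (g : Λ → ℕ) {Q : Store Reg → Prop}
    (he : e.eval E.inp σ ≤ E.Z) (hg : ∀ v, v ≤ e.eval E.inp σ ↔ ∃ w, g w = v)
    (h : Choice E.dem fun w => Q (σ.set z (g w))) : wp E (.guess z e) σ Q := by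
  refine ⟨he, ?_⟩
  unfold Choice at h
  cases hd : E.dem with
  | true =>
    rw [hd] at h
    intro v hv
    obtain ⟨w, rfl⟩ := (hg v).1 hv
    exact h w
  | false =>
    rw [hd] at h
    obtain ⟨w, hw⟩ := h
    exact ⟨g w, (hg _).2 ⟨w, rfl⟩, hw⟩

theorem Choice.mono {Λ : Type*} {dem : Bool} {p q : Λ → Prop} (h : Choice dem p)
    (hpq : ∀ v, p v → q v) : Choice dem q := by
  cases dem with
  | true => exact fun v => hpq v (h v)
  | false =>
    obtain ⟨v, hv⟩ := h
    exact ⟨v, hpq v hv⟩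

variable {s k k' n n' bA bB : ℕ} {B : DetAut (Fin k' → Fin s) n'} {A : DetAut (Fin k → Fin s) n}

/-- Guessing a walk; `J i x e` is the invariant after `i` steps in the state `x` with the error
flag `e`. -/
theorem wp_guessWalk {Q : Store Reg → Prop} (hR : Ready (paramsOf s k k' n n' bA bB) σ)
    (hE : Enough E (paramsOf s k k' n n' bA bB)) (hA : Encodes E.inp bA A)
    (hB : Encodes E.inp bB B) (hs : 0 < s) (hH : 2 * k ^ k' + 2 < E.H)
    (hT : (n + n' + 2) ^ (k ^ k' + 1) ≤ E.T) (J : ℕ → ProdState k k' n n' → ℕ → Prop)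
    {x₀ : ProdState k k' n n'} (hx₀ : Holds x₀ σ) (hJ₀ : J 0 x₀ (σ.r .err))
    (herr : σ.r .err ≤ E.Z)
    (hstep : ∀ i < (n + n' + 2) ^ (k ^ k' + 1), ∀ x e, J i x e →
      Choice E.dem fun v : Fin k → Fin s =>
        ∀ e', (e' = 0 ↔ e = 0 ∧ ¬ ProdBad B x) → J (i + 1) (prodStep A B x v) e')
    (hQ : ∀ σ' x e, Agree [.f, .q, .g, .w, .p, .j, .u, .i, .err, .v] σ σ' → Holds x σ' →
      J ((n + n' + 2) ^ (k ^ k' + 1)) x e → (σ'.r .err = 0 ↔ e = 0 ∧ x.1 = none) →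
      σ'.r .err ≤ E.Z → Q σ') :
    wp E guessWalk σ Q := by
  have hpA : s ^ k ≤ E.Z := hE.pA
  have hpos : 0 < s ^ k := Nat.pow_pos hs
  refine wp_clear hR hE hH fun σ₁ a1 b1 c1 => ?_
  have b1' : ∀ i < k ^ k' + 2, σ₁.h (k ^ k' + 1 + i) = 0 := b1
  have c1' : ∀ a ≤ k ^ k', σ₁.h a = σ.h a := c1
  refine wp_loop_count ((n + n' + 2) ^ (k ^ k' + 1)) (fun m σ' =>
    Agree [.f, .q, .g, .w, .p, .j, .u, .i, .err, .v] σ σ' ∧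
    (∀ i < k ^ k' + 2, σ'.h (k ^ k' + 1 + i) < n + n' + 2) ∧
    counter (k ^ k') (n + n' + 2) σ'.h = m ∧ σ'.r .err ≤ E.Z ∧
    ∃ x, Holds x σ' ∧ J m x (σ'.r .err)) hT ?_ ?_ ?_
  · refine ⟨a1.mono (by decide), fun i hi => by rw [b1' i hi]; omega, ?_, ?_, x₀, ?_, ?_⟩
    · exact Finset.sum_eq_zero fun i hi => by rw [b1' i (Finset.mem_range.1 hi), zero_mul]
    · rwa [a1 .err (by decide)]
    · intro i hi
      rw [c1' i hi]
      exact hx₀ i hi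
    · rwa [a1 .err (by decide)]
  · rintro m σ' hm ⟨h1, h2, h3, h4, x, h5, h6⟩
    have hR' := hR.agree h1 (by decide)
    have hK : σ'.r .K = k ^ k' := hR'.K
    have hpA' : σ'.r .pA = s ^ k := hR'.pA
    have hev : (Expr.var Reg.pA - 1).eval E.inp σ' = s ^ k - 1 := by simp [hpA']
    refine ⟨?_, ?_⟩
    · have := (counter_lt_iff h2).1 (h3 ▸ hm)
      simp [hK, this]
    refine wp_seq (wp_guess (fun v : Fin k → Fin s => (finFunctionFinEquiv v : Fin (s ^ k)))
      ?_ ?_ ?_)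
    · rw [hev]; omega
    · intro v
      rw [hev]
      constructor
      · intro hv
        exact ⟨finFunctionFinEquiv.symm ⟨v, by omega⟩, by rw [Equiv.apply_symm_apply]⟩
      · rintro ⟨w, rfl⟩
        have := (finFunctionFinEquiv w).2
        omega
    refine (hstep m hm x _ h6).mono fun v hv => ?_
    refine wp_move_prod (σ := σ'.set .v _) (x := x) (v := v)
      (hR'.agree (Agree.refl.set (l := [.v]) (by decide)) (by decide)) hE hA hB hs h5 (by simp)
      (by simpa using h4) fun σ₂ a2 b2 c2 d2 e2 => ?_
    have a2' : Agree [.f, .q, .g, .w, .p, .j, .u, .i, .err, .v] σ' σ₂ :=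
      (Agree.refl.set (by decide)).trans a2 (by decide)
    have e2' : ∀ a, k ^ k' < a → σ₂.h a = σ'.h a := e2
    have hcount : counter (k ^ k') (n + n' + 2) σ₂.h = m := by
      rw [← h3]
      exact Finset.sum_congr rfl fun i _ => by rw [e2' _ (by omega)]
    refine wp_increment (hR'.agree a2' (by decide)) hE hH (t := m) ?_ hcount hm
      fun σ₃ a3 b3 c3 d3 => ?_
    · intro i hi
      refine (e2' _ ?_).trans_lt (h2 i hi)
      change k ^ k' < k ^ k' + 1 + i
      omega
    · have herr3 : σ₃.r .err = σ₂.r .err := a3 .err (by decide)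
      refine ⟨h1.trans (a2'.trans a3 (by decide)) (by decide), b3, c3, by rwa [herr3],
        prodStep A B x v, ?_, ?_⟩
      · intro i hi
        exact (d3 i hi).trans (d2 i hi)
      · rw [herr3]
        exact hv _ (by simpa using b2)
  · rintro σ' ⟨h1, h2, h3, h4, x, h5, h6⟩
    have hR' := hR.agree h1 (by decide)
    have hK : σ'.r .K = k ^ k' := hR'.K
    have hna : σ'.r .na = n := hR'.na
    have htop : σ'.h (k ^ k' + 1 + (k ^ k' + 1)) ≠ 0 := fun h0 => by
      have := (counter_lt_iff h2).2 h0
      omega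
    have hacc := fst_eq_none_iff x
    rw [← h5 _ le_rfl] at hacc
    refine ⟨?_, fun ht => ?_, fun ht => ?_⟩
    · simp [hK]; omega
    · refine ⟨h4, hQ _ x _ (h1.set (by decide)) h5 h6 ?_ (by simpa using h4)⟩
      have : x.1 = none := hacc.2 (by simpa [hK, hna] using ht)
      simp [this]
    · refine ⟨hE.one, hQ _ x _ (h1.set (by decide)) h5 h6 ?_ (by simpa using hE.one)⟩
      have : ¬ x.1 = none := fun hx => hacc.1 hx (by simpa [hK, hna] using ht)
      simp [this]

theorem wp_search {Q : Store Reg → Prop} (hG : Given (paramsOf s k k' n n' bA bB) σ)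
    (hE : Enough E (paramsOf s k k' n n' bA bB)) (hA : Encodes E.inp bA A)
    (hB : Encodes E.inp bB B) (hs : 0 < s) (hH : 2 * k ^ k' + 2 < E.H)
    (hT : (n + n' + 2) ^ (k ^ k' + 1) ≤ E.T)
    (hQ : ∀ σ', (bif E.dem then
        σ'.r .ans = 0 → Counterexample A.toNFA.accepts B.toNFA.accepts
        else Counterexample A.toNFA.accepts B.toNFA.accepts → σ'.r .ans = 0) → Q σ') :
    wp E search σ Q := by
  refine wp_prepare hG hE hA.size hB.size fun σ₁ a1 b1 hR1 => ?_
  refine wp_start hR1 hE hA hB fun σ₂ a2 b2 c2 => ?_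
  refine ⟨Nat.zero_le _, ?_⟩
  have hR2 := hR1.agree a2 (by decide)
  have hR2' : Ready (paramsOf s k k' n n' bA bB) (σ₂.set .err 0) :=
    hR2.agree (Agree.refl.set (l := [.err]) (by decide)) (by decide)
  have hCE := counterexample_iff_walk A B (L := (n + n' + 2) ^ (k ^ k' + 1)) le_rfl
  cases hd : E.dem with
  | true =>
    rw [hd] at hQ
    refine wp_guessWalk (A := A) (B := B) hR2' hE hA hB hs hH hT
      (fun i x e => e = 0 → Walk (prodStep A B) (ProdBad B) i (prodStart A B) x) b2
      (fun _ => rfl) (by simp) ?_ ?_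
    · intro i _ x e hJ
      rw [hd]
      intro v e' he' h0
      obtain ⟨h1, h2⟩ := he'.1 h0
      exact (hJ h1).snoc h2 v
    intro σ₃ y e a3 b3 c3 d3 e3
    refine wp_guessWalk (A := A) (B := B) (hR2'.agree a3 (by decide)) hE hA hB hs hH hT
      (fun i x e => e = 0 → Walk (prodStep A B) (ProdBad B) ((n + n' + 2) ^ (k ^ k' + 1))
        (prodStart A B) y ∧ y.1 = none ∧ Walk (prodStep A B) (ProdBad B) i y x) b3 ?_ e3 ?_ ?_
    · intro h0
      obtain ⟨h1, h2⟩ := d3.1 h0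
      exact ⟨c3 h1, h2, rfl⟩
    · intro i _ x e hJ
      rw [hd]
      intro v e' he' h0
      obtain ⟨h1, h2⟩ := he'.1 h0
      obtain ⟨h3, h4, h5⟩ := hJ h1
      exact ⟨h3, h4, h5.snoc h2 v⟩
    intro σ₄ z e' a4 b4 c4 d4 e4
    refine ⟨e4, hQ _ fun h0 => hCE.2 ?_⟩
    obtain ⟨h1, h2⟩ := d4.1 (by simpa using h0)
    obtain ⟨h3, h4, h5⟩ := c4 h1
    exact ⟨y, z, h3, h4, h5, h2⟩
  | false =>
    rw [hd] at hQ
    by_cases hC : Counterexample A.toNFA.accepts B.toNFA.accepts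
    · obtain ⟨y, z, w1, w2, w3, w4⟩ := hCE.1 hC
      have hJ : ∀ y : ProdState k k' n n', ∀ i < (n + n' + 2) ^ (k ^ k' + 1), ∀ x (e : ℕ),
          (e = 0 ∧ Walk (prodStep A B) (ProdBad B) ((n + n' + 2) ^ (k ^ k' + 1) - i) x y) →
          Choice E.dem fun v : Fin k → Fin s =>
            ∀ e' : ℕ, (e' = 0 ↔ e = 0 ∧ ¬ ProdBad B x) → (e' = 0 ∧ Walk (prodStep A B) (ProdBad B)
              ((n + n' + 2) ^ (k ^ k' + 1) - (i + 1)) (prodStep A B x v) y) := by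
        rintro y i hi x e ⟨h1, h2⟩
        rw [hd]
        rw [show (n + n' + 2) ^ (k ^ k' + 1) - i =
          (n + n' + 2) ^ (k ^ k' + 1) - (i + 1) + 1 by omega] at h2
        obtain ⟨h3, v, h4⟩ := h2
        exact ⟨v, fun e' he' => ⟨he'.2 ⟨h1, h3⟩, h4⟩⟩
      refine wp_guessWalk (A := A) (B := B) hR2' hE hA hB hs hH hT _ b2 ⟨by simp, w1⟩ (by simp)
        (hJ y) ?_
      intro σ₃ y' e a3 b3 c3 d3 e3
      obtain ⟨c3, c3'⟩ := c3
      rw [Nat.sub_self] at c3'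
      obtain rfl : y' = y := c3'
      refine wp_guessWalk (A := A) (B := B) (hR2'.agree a3 (by decide)) hE hA hB hs hH hT _ b3
        ⟨d3.2 ⟨c3, w2⟩, w3⟩ e3 (hJ z) ?_
      intro σ₄ z' e' a4 b4 c4 d4 e4
      obtain ⟨c4, c4'⟩ := c4
      rw [Nat.sub_self] at c4'
      obtain rfl : z' = z := c4'
      exact ⟨e4, hQ _ fun _ => by simpa using d4.2 ⟨c4, w4⟩⟩
    · have hJ : ∀ i < (n + n' + 2) ^ (k ^ k' + 1), ∀ (x : ProdState k k' n n') (e : ℕ), True →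
          Choice E.dem fun v : Fin k → Fin s =>
            ∀ e' : ℕ, (e' = 0 ↔ e = 0 ∧ ¬ ProdBad B x) → True := by
        intro i _ x e _
        rw [hd]
        exact ⟨fun _ => ⟨0, hs⟩, fun _ _ => trivial⟩
      refine wp_guessWalk (A := A) (B := B) hR2' hE hA hB hs hH hT (fun _ _ _ => True) b2 trivial
        (by simp) hJ fun σ₃ y e a3 b3 c3 d3 e3 => ?_
      refine wp_guessWalk (A := A) (B := B) (hR2'.agree a3 (by decide)) hE hA hB hs hH hT
        (fun _ _ _ => True) b3 trivial e3 hJ fun σ₄ z e' a4 b4 c4 d4 e4 => ?_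
      exact ⟨e4, hQ _ fun h => absurd h hC⟩

end HyperAut

namespace HyperAut

/-! ### The deterministic exploration -/

namespace Code

open Reg HyperAut.Expr HyperAut.Stm

/-- Writing the product state with the number `x` to the heap. -/
def decode : Stm Reg :=
  u ≔ x ;; f ≔ 0 ;;
  loop (K + 1 - var f) (store f (u % var base) ;; u ≔ u / var base ;; f ≔ f + 1)

/-- Computing the number `y` of the product state on the heap. -/
def encode : Stm Reg :=
  y ≔ 0 ;; p ≔ 1 ;; f ≔ 0 ;;
  loop (K + 1 - var f) (y ≔ var y + var p * heap f ;; p ≔ p * base ;; f ≔ f + 1)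

/-- Marking the successors of the state `x` in the next row of the table. -/
def markSuccessors : Stm Reg :=
  v ≔ 0 ;;
  loop (pA - v) (
    decode ;; err ≔ 0 ;; move ;;
    ite err (err ≔ err) (encode ;; store (row + V + var y) 1) ;;
    v ≔ v + 1)

/-- Computing the next row of the table. -/
def nextRow : Stm Reg :=
  x ≔ 0 ;;
  loop (V - x) (ite (heap (row + x)) markSuccessors (x ≔ x) ;; x ≔ x + 1) ;;
  row ≔ row + V

/-- Computing as many rows of the table as there are states. -/
def allRows : Stm Reg :=
  t ≔ 0 ;; loop (V - t) (nextRow ;; t ≔ t + 1)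

/-- Removing the marks of those states in which the first automaton has not accepted. -/
def filter : Stm Reg :=
  ans ≔ 1 ;; x ≔ 0 ;;
  loop (V - x) (
    ite (heap (row + x)) (ite (x / (V / base) - var na) (ans ≔ 0) (store (row + x) 0)) (x ≔ x) ;;
    x ≔ x + 1)

/-- The exploration of the product. -/
def explore : Stm Reg :=
  prepare ;; start ;; row ≔ row + K + (1 : Expr Reg) ;;
  u ≔ base ;; g ≔ K + 1 ;; power ;; V ≔ p ;;
  encode ;; store (row + y) 1 ;;
  allRows ;; filter ;; allRows ;; filter ;;
  row ≔ row + V ;; tot ≔ tot * ans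

/-- The exploration in both directions. -/
def exploreBoth : Stm Reg :=
  tot ≔ 1 ;; readInput ;; explore ;; swap ;; explore

end Code

open Code

section Numbers

variable {k' n' k n : ℕ}

/-- The number of a product state. -/
def enc (x : ProdState k k' n n') : ℕ :=
  ∑ i ∈ Finset.range (k ^ k' + 1), dig x i * (n + n' + 2) ^ i

/-- A bound for the numbers of the product states. -/
def cap (k k' n n' : ℕ) : ℕ := (n + n' + 2) ^ (k ^ k' + 1)

theorem enc_lt (x : ProdState k k' n n') : enc x < cap k k' n n' :=
  sum_mul_pow_lt fun i _ => dig_lt x i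

theorem enc_div_mod (x : ProdState k k' n n') {i : ℕ} (hi : i ≤ k ^ k') :
    enc x / (n + n' + 2) ^ i % (n + n' + 2) = dig x i := by
  have h : enc x = (finFunctionFinEquiv fun j : Fin (k ^ k' + 1) =>
      (⟨dig x j, dig_lt x j⟩ : Fin (n + n' + 2)) : Fin _) := by
    rw [finFunctionFinEquiv_apply, enc, Finset.sum_range]
  have h2 := congrArg Fin.val (congrFun (Equiv.symm_apply_apply finFunctionFinEquiv
    fun j : Fin (k ^ k' + 1) => (⟨dig x j, dig_lt x j⟩ : Fin (n + n' + 2))) ⟨i, by omega⟩)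
  rw [h]
  exact h2

theorem enc_injective : Function.Injective (enc : ProdState k k' n n' → ℕ) := fun x y h =>
  eq_of_dig_eq fun i hi => by rw [← enc_div_mod x hi, ← enc_div_mod y hi, h]

theorem cap_div : cap k k' n n' / (n + n' + 2) = (n + n' + 2) ^ k ^ k' := by
  rw [cap, pow_succ, Nat.mul_div_cancel _ (by omega)]

theorem enc_div_top (x : ProdState k k' n n') :
    enc x / (cap k k' n n' / (n + n' + 2)) = dig x (k ^ k') := by
  rw [cap_div, ← enc_div_mod x le_rfl, Nat.mod_eq_of_lt]
  refine Nat.div_lt_of_lt_mul ?_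
  rw [← pow_succ]
  exact enc_lt x

end Numbers

variable {E : Env} {σ : Store Reg} {s k k' n n' bA bB : ℕ} {A : DetAut (Fin k → Fin s) n}
  {B : DetAut (Fin k' → Fin s) n'}

theorem wp_decode {Q : Store Reg → Prop} (hR : Ready (paramsOf s k k' n n' bA bB) σ)
    (hE : Enough E (paramsOf s k k' n n' bA bB)) (hZ : cap k k' n n' ≤ E.Z)
    {z : ProdState k k' n n'} (hz : σ.r .x = enc z)
    (hQ : ∀ σ', Agree [.u, .f] σ σ' → Holds z σ' → (∀ a, k ^ k' < a → σ'.h a = σ.h a) → Q σ') :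
    wp E decode σ Q := by
  have hH : k ^ k' < E.H := hE.heap
  have hK : 2 * k ^ k' + 3 ≤ E.Z := hE.two_K
  have hb : n + n' + 2 ≤ E.Z := hE.base
  have hlt := enc_lt z
  refine ⟨by simp [hz]; omega, Nat.zero_le _, ?_⟩
  refine wp_loop_count (k ^ k' + 1) (fun m σ' => Agree [.u, .f] σ σ' ∧ σ'.r .f = m ∧
    σ'.r .u = enc z / (n + n' + 2) ^ m ∧ (∀ i < m, σ'.h i = dig z i) ∧
    ∀ a, k ^ k' < a → σ'.h a = σ.h a) (le_trans (by omega) hE.rounds) ?_ ?_ ?_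
  · exact ⟨(Agree.refl.set (by decide)).set (by decide), by simp, by simp [hz], by simp, by simp⟩
  · rintro m σ' hm ⟨h1, h2, h3, h4, h5⟩
    have hR' := hR.agree h1 (by decide)
    have hKr : σ'.r .K = k ^ k' := hR'.K
    have hbr : σ'.r .base = n + n' + 2 := hR'.base
    have hdig := enc_div_mod z (show m ≤ k ^ k' by omega)
    have hdl := dig_lt z m
    have hle : enc z / (n + n' + 2) ^ m ≤ enc z := Nat.div_le_self _ _
    refine ⟨by simp [hKr, h2]; omega, by simp [h2]; omega, ?_, ?_, ?_, ?_, ?_, ?_, ?_, ?_⟩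
    · simp [h3, hbr, hdig]; omega
    · simpa [h3] using (Nat.div_le_self _ _).trans (by omega)
    · simp [h2]; omega
    · exact (h1.put.set (by decide)).set (by decide)
    · simp [h2]
    · simp [h3, hbr, pow_succ, Nat.div_div_eq_div_mul]
    · intro i hi
      by_cases him : i = m
      · simp [him, h2, h3, hbr, hdig]
      · simpa [him, h2] using h4 i (by omega)
    · intro a ha
      simpa [h2, show a ≠ m by omega] using h5 a ha
  · rintro σ' ⟨h1, h2, h3, h4, h5⟩
    have hR' := hR.agree h1 (by decide)
    have hKr : σ'.r .K = k ^ k' := hR'.K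
    exact ⟨by simp [hKr, h2], hQ σ' h1 (fun i hi => h4 i (by omega)) h5⟩

theorem wp_encode {Q : Store Reg → Prop} (hR : Ready (paramsOf s k k' n n' bA bB) σ)
    (hE : Enough E (paramsOf s k k' n n' bA bB)) (hZ : cap k k' n n' ≤ E.Z)
    {z : ProdState k k' n n'} (hz : Holds z σ)
    (hQ : ∀ σ', Agree [.y, .p, .f] σ σ' → σ'.h = σ.h → σ'.r .y = enc z → Q σ') :
    wp E encode σ Q := by
  have hK : 2 * k ^ k' + 3 ≤ E.Z := hE.two_K
  refine ⟨Nat.zero_le _, hE.one, Nat.zero_le _, ?_⟩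
  refine wp_loop_count (k ^ k' + 1) (fun m σ' => Agree [.y, .p, .f] σ σ' ∧ σ'.r .f = m ∧
    σ'.r .p = (n + n' + 2) ^ m ∧
    σ'.r .y = ∑ i ∈ Finset.range m, dig z i * (n + n' + 2) ^ i ∧ σ'.h = σ.h)
    (le_trans (by omega) hE.rounds) ?_ ?_ ?_
  · exact ⟨((Agree.refl.set (by decide)).set (by decide)).set (by decide), by simp, by simp,
      by simp, by simp⟩
  · rintro m σ' hm ⟨h1, h2, h3, h4, h5⟩
    have hR' := hR.agree h1 (by decide)
    have hKr : σ'.r .K = k ^ k' := hR'.K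
    have hbr : σ'.r .base = n + n' + 2 := hR'.base
    have hpow : (n + n' + 2) ^ (m + 1) ≤ E.Z :=
      (Nat.pow_le_pow_right (by omega) (by omega)).trans hZ
    have hy : (Expr.var Reg.y + Expr.var Reg.p * Expr.heap (Expr.var Reg.f)).eval E.inp σ' =
        ∑ i ∈ Finset.range (m + 1), dig z i * (n + n' + 2) ^ i := by
      rw [Finset.sum_range_succ, ← hz m (by omega)]
      simp only [eval_add, eval_mul, eval_heap, eval_var, h2, h3, h4, h5]
      rw [mul_comm]
    refine ⟨by simp [hKr, h2]; omega, ?_, ?_, ?_, ?_, ?_, ?_, ?_, ?_⟩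
    · rw [hy]
      exact (sum_mul_pow_lt fun i _ => dig_lt z i).le.trans hpow
    · simpa [h3, hbr, ← pow_succ] using hpow
    · simp [h2]; omega
    · exact ((h1.set (by decide)).set (by decide)).set (by decide)
    · simp [h2]
    · simp [h3, hbr, pow_succ]
    · rw [hy]; simp
    · simpa using h5
  · rintro σ' ⟨h1, h2, h3, h4, h5⟩
    have hR' := hR.agree h1 (by decide)
    have hKr : σ'.r .K = k ^ k' := hR'.K
    exact ⟨by simp [hKr, h2], hQ σ' h1 h5 h4⟩

/-- The marks from the heap cell `row` on are those of the states in `R`. -/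
def Marked (R : Set (ProdState k k' n n')) (row : ℕ) (h : ℕ → ℕ) : Prop :=
  ∀ y < cap k k' n n', h (row + y) ≠ 0 ↔ ∃ z ∈ R, enc z = y

theorem Marked.congr {R R' : Set (ProdState k k' n n')} {row : ℕ} {h h' : ℕ → ℕ}
    (hm : Marked R row h) (hR : R = R') (hh : ∀ y < cap k k' n n', h' (row + y) = h (row + y)) :
    Marked R' row h' := by
  subst hR
  intro y hy
  rw [hh y hy]
  exact hm y hy

theorem Marked.insert {R : Set (ProdState k k' n n')} {row : ℕ} {h : ℕ → ℕ}
    (hm : Marked R row h) (w : ProdState k k' n n') :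
    Marked (insert w R) row (Function.update h (row + enc w) 1) := by
  intro y hy
  by_cases hyw : y = enc w
  · subst hyw
    simp
  · rw [Function.update_of_ne (by omega), hm y hy]
    simp [show enc w ≠ y from fun h => hyw h.symm]

/-- The successors of the states in `R` that are not bad. -/
def successors (A : DetAut (Fin k → Fin s) n) (B : DetAut (Fin k' → Fin s) n')
    (R : Set (ProdState k k' n n')) : Set (ProdState k k' n n') :=
  {w | ∃ z ∈ R, ¬ ProdBad B z ∧ ∃ v, prodStep A B z v = w}

theorem wp_markSuccessors {Q : Store Reg → Prop} (hR : Ready (paramsOf s k k' n n' bA bB) σ)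
    (hE : Enough E (paramsOf s k k' n n' bA bB)) (hA : Encodes E.inp bA A)
    (hB : Encodes E.inp bB B) (hk : 1 ≤ k) (hZ : cap k k' n n' ≤ E.Z)
    (hV : σ.r .V = cap k k' n n') (hrow : k ^ k' < σ.r .row)
    (hH : σ.r .row + 2 * cap k k' n n' ≤ E.H)
    {z : ProdState k k' n n'} (hz : σ.r .x = enc z) {S : Set (ProdState k k' n n')}
    (hS : Marked S (σ.r .row + cap k k' n n') σ.h)
    (hQ : ∀ σ', Agree [.f, .q, .g, .w, .p, .j, .u, .i, .err, .v, .y] σ σ' →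
      Marked (S ∪ successors A B {z}) (σ.r .row + cap k k' n n') σ'.h →
      (∀ a, k ^ k' < a → a < σ.r .row + cap k k' n n' ∨ σ.r .row + 2 * cap k k' n n' ≤ a →
        σ'.h a = σ.h a) → Q σ') :
    wp E markSuccessors σ Q := by
  have hpA : s ^ k ≤ E.Z := hE.pA
  refine ⟨Nat.zero_le _, ?_⟩
  refine wp_loop_count (s ^ k) (fun m σ' =>
    Agree [.f, .q, .g, .w, .p, .j, .u, .i, .err, .v, .y] σ σ' ∧ σ'.r .v = m ∧
    Marked (S ∪ {w | ¬ ProdBad B z ∧ ∃ v : Fin k → Fin s,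
      (finFunctionFinEquiv v : Fin (s ^ k)) < m ∧ prodStep A B z v = w})
      (σ.r .row + cap k k' n n') σ'.h ∧
    (∀ a, k ^ k' < a → a < σ.r .row + cap k k' n n' ∨ σ.r .row + 2 * cap k k' n n' ≤ a →
        σ'.h a = σ.h a)) (hpA.trans hE.rounds) ?_ ?_ ?_
  · exact ⟨Agree.refl.set (by decide), by simp, hS.congr (by simp) (by simp), by simp⟩
  · rintro m σ' hm ⟨h1, h2, h3, h4⟩
    have hs : 0 < s := by
      rcases Nat.eq_zero_or_pos s with rfl | h
      · rw [zero_pow (by omega)] at hm; omega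
      · exact h
    obtain ⟨v, hv⟩ : ∃ v : Fin k → Fin s, (finFunctionFinEquiv v : ℕ) = m :=
      ⟨finFunctionFinEquiv.symm ⟨m, hm⟩, by rw [Equiv.apply_symm_apply]⟩
    have hR' := hR.agree h1 (by decide)
    have hpA' : σ'.r .pA = s ^ k := hR'.pA
    refine ⟨by simp [hpA', h2]; omega, ?_⟩
    refine wp_decode hR' hE hZ ((h1 .x (by decide)).trans hz) fun σ₁ a1 b1 c1 => ?_
    refine ⟨Nat.zero_le _, ?_⟩
    have v1 : σ₁.r .v = m := (a1 .v (by decide)).trans h2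
    have R1 : Ready (paramsOf s k k' n n' bA bB) (σ₁.set .err 0) :=
      (hR'.agree a1 (by decide)).agree (Agree.refl.set (l := [.err]) (by decide)) (by decide)
    refine wp_move_prod (x := z) (v := v) (σ := σ₁.set .err 0) R1 hE hA hB hs b1
      (by simp [v1]; exact hv.symm) (by simp) fun σ₂ a2 b2 c2 d2 e2 => ?_
    have R2 := R1.agree a2 (by decide)
    have v2 : σ₂.r .v = m := (a2 .v (by decide)).trans (by simp [v1])
    have a2' : Agree [.f, .q, .g, .w, .p, .j, .u, .i, .err, .v, .y] σ σ₂ :=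
      ((h1.trans a1 (by decide)).set (by decide)).trans a2 (by decide)
    have hh2 : ∀ a, k ^ k' < a → σ₂.h a = σ'.h a := fun a ha => (e2 a ha).trans (c1 a ha)
    have hset : ∀ w : ProdState k k' n n', (¬ ProdBad B z ∧ ∃ v : Fin k → Fin s,
        (finFunctionFinEquiv v : Fin (s ^ k)) < m + 1 ∧ prodStep A B z v = w) ↔
        (¬ ProdBad B z ∧ w = prodStep A B z v) ∨ (¬ ProdBad B z ∧ ∃ v : Fin k → Fin s,
        (finFunctionFinEquiv v : Fin (s ^ k)) < m ∧ prodStep A B z v = w) := by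
      intro w
      rw [← and_or_left]
      refine and_congr_right fun _ => ⟨?_, ?_⟩
      · rintro ⟨v', h, rfl⟩
        rcases Nat.lt_succ_iff_lt_or_eq.1 h with h | h
        · exact Or.inr ⟨v', h, rfl⟩
        · refine Or.inl ?_
          rw [finFunctionFinEquiv.injective (Fin.ext (h.trans hv.symm))]
      · rintro (rfl | ⟨v', h, rfl⟩)
        · exact ⟨v, by rw [hv]; omega, rfl⟩
        · exact ⟨v', by omega, rfl⟩
    refine ⟨fun he => ⟨c2, ?_⟩, fun he => ?_⟩
    · have hbad : ProdBad B z := by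
        by_contra hb
        exact he (b2.2 ⟨by simp, hb⟩)
      refine ⟨by simp [v2]; omega, (a2'.set (by decide)).set (by decide), by simp [v2], ?_, ?_⟩
      · refine h3.congr ?_ fun y hy => hh2 _ (by omega)
        ext w
        simp [hbad]
      · exact fun a ha ha' => (hh2 a ha).trans (h4 a ha ha')
    · have hbad : ¬ ProdBad B z := (b2.1 he).2
      refine wp_encode R2 hE hZ d2 fun σ₃ a3 b3 c3 => ?_
      have v3 : σ₃.r .v = m := (a3 .v (by decide)).trans v2
      have a3' := a2'.trans a3 (by decide)
      have row3 : σ₃.r .row = σ.r .row := a3' .row (by decide)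
      have V3 : σ₃.r .V = cap k k' n n' := (a3' .V (by decide)).trans hV
      have hl := enc_lt (prodStep A B z v)
      have haddr : (Expr.var Reg.row + .var .V + .var .y).eval E.inp σ₃ =
          σ.r .row + cap k k' n n' + enc (prodStep A B z v) := by
        simp [row3, V3, c3]
      refine ⟨by rw [haddr]; omega, hE.one, by simp [v3]; omega, a3'.put.set (by decide),
        by simp [v3], ?_, ?_⟩
      · rw [haddr]
        refine (h3.insert (prodStep A B z v)).congr ?_ fun y hy => ?_
        · ext w
          simp only [Set.mem_insert_iff, Set.mem_union, Set.mem_ofPred_eq, hset w]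
          simp only [hbad, not_false_eq_true, true_and]
          tauto
        · rw [set_h, put_h, Function.update_apply, b3, hh2 _ (by omega)]
          rfl
      · intro a ha ha'
        rw [haddr, set_h, put_h, if_neg (by omega), b3, hh2 a ha, h4 a ha ha']
  · rintro σ' ⟨h1, h2, h3, h4⟩
    have hR' := hR.agree h1 (by decide)
    have hpA' : σ'.r .pA = s ^ k := hR'.pA
    refine ⟨by simp [hpA', h2], hQ σ' h1 (h3.congr ?_ fun _ _ => rfl) h4⟩
    congr 1
    ext w
    simp only [successors, Set.mem_ofPred_eq, Set.mem_singleton_iff, exists_eq_left, Fin.is_lt,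
      true_and]

theorem wp_nextRow {Q : Store Reg → Prop} (hR : Ready (paramsOf s k k' n n' bA bB) σ)
    (hE : Enough E (paramsOf s k k' n n' bA bB)) (hA : Encodes E.inp bA A)
    (hB : Encodes E.inp bB B) (hk : 1 ≤ k) (hZ : cap k k' n n' ≤ E.Z)
    (hV : σ.r .V = cap k k' n n') (hrow : k ^ k' < σ.r .row)
    (hH : σ.r .row + 2 * cap k k' n n' ≤ E.H) (hrZ : σ.r .row + cap k k' n n' ≤ E.Z)
    {R : Set (ProdState k k' n n')} (hM : Marked R (σ.r .row) σ.h)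
    (hF : ∀ a, σ.r .row + cap k k' n n' ≤ a → σ.h a = 0)
    (hQ : ∀ σ', Agree [.f, .q, .g, .w, .p, .j, .u, .i, .err, .v, .y, .x, .row] σ σ' →
      σ'.r .row = σ.r .row + cap k k' n n' →
      Marked (successors A B R) (σ.r .row + cap k k' n n') σ'.h →
      (∀ a, σ.r .row + 2 * cap k k' n n' ≤ a → σ'.h a = 0) → Q σ') :
    wp E nextRow σ Q := by
  refine ⟨Nat.zero_le _, ?_⟩
  refine wp_loop_count (cap k k' n n') (fun m σ' =>
    Agree [.f, .q, .g, .w, .p, .j, .u, .i, .err, .v, .y, .x] σ σ' ∧ σ'.r .x = m ∧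
    Marked (successors A B {z ∈ R | enc z < m}) (σ.r .row + cap k k' n n') σ'.h ∧
    (∀ a, k ^ k' < a → a < σ.r .row + cap k k' n n' ∨ σ.r .row + 2 * cap k k' n n' ≤ a →
        σ'.h a = σ.h a)) (hZ.trans hE.rounds) ?_ ?_ ?_
  · refine ⟨Agree.refl.set (by decide), by simp, fun y hy => ?_, by simp⟩
    have := hF (σ.r .row + cap k k' n n' + y) (by omega)
    simp [this, successors]
  · rintro m σ' hm ⟨h1, h2, h3, h4⟩
    have hR' := hR.agree h1 (by decide)
    have hV' : σ'.r .V = cap k k' n n' := (h1 .V (by decide)).trans hV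
    have hrow' : σ'.r .row = σ.r .row := h1 .row (by decide)
    have hmark : σ'.h (σ.r .row + m) ≠ 0 ↔ ∃ z ∈ R, enc z = m := by
      rw [h4 _ (by omega) (Or.inl (by omega))]
      exact hM m hm
    refine ⟨by simp [hV', h2]; omega, fun ht => ?_, fun ht => ?_⟩
    · obtain ⟨z, hz, hzm⟩ := hmark.1 (by simpa [hrow', h2] using ht)
      refine wp_markSuccessors (A := A) (B := B) (z := z) hR' hE hA hB hk hZ hV' (by omega)
        (by omega) (by omega) (by rw [hrow']; exact h3) fun σ₁ a1 b1 c1 => ?_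
      have x1 : σ₁.r .x = m := (a1 .x (by decide)).trans h2
      rw [hrow'] at b1 c1
      refine ⟨by simp [x1]; omega, (h1.trans a1 (by decide)).set (by decide), by simp [x1],
        b1.congr ?_ fun _ _ => rfl, fun a ha ha' => (c1 a ha ha').trans (h4 a ha ha')⟩
      ext w
      simp only [successors, Set.mem_union, Set.mem_ofPred_eq, Set.mem_singleton_iff]
      constructor
      · rintro (⟨z', ⟨g1, g2⟩, g3⟩ | ⟨_, rfl, g3⟩)
        · exact ⟨z', ⟨g1, by omega⟩, g3⟩
        · exact ⟨_, ⟨hz, by omega⟩, g3⟩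
      · rintro ⟨z', ⟨g1, g2⟩, g3⟩
        rcases Nat.lt_succ_iff_lt_or_eq.1 g2 with g2 | g2
        · exact Or.inl ⟨z', ⟨g1, g2⟩, g3⟩
        · exact Or.inr ⟨z', enc_injective (g2.trans hzm.symm), g3⟩
    · have hnm : ¬ ∃ z ∈ R, enc z = m := fun h => hmark.2 h (by simpa [hrow', h2] using ht)
      refine ⟨by simp [h2]; omega, by simp [h2]; omega, (h1.set (by decide)).set (by decide),
        by simp [h2], h3.congr ?_ fun _ _ => rfl, h4⟩
      congr 1
      ext w
      simp only [Set.mem_ofPred_eq]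
      refine and_congr_right fun hw => ?_
      have : enc w ≠ m := fun h => hnm ⟨w, hw, h⟩
      omega
  · rintro σ' ⟨h1, h2, h3, h4⟩
    have hV' : σ'.r .V = cap k k' n n' := (h1 .V (by decide)).trans hV
    have hrow' : σ'.r .row = σ.r .row := h1 .row (by decide)
    refine ⟨by simp [hV', h2], by simpa [hrow', hV'] using hrZ, hQ _ ?_ ?_ ?_ ?_⟩
    · exact (h1.mono (by decide)).set (by decide)
    · simp [hrow', hV']
    · refine h3.congr ?_ fun _ _ => rfl
      congr 1
      ext w
      simp [enc_lt w]
    · intro a ha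
      exact (h4 a (by omega) (Or.inr ha)).trans (hF a (by omega))

theorem wp_allRows {Q : Store Reg → Prop} (hR : Ready (paramsOf s k k' n n' bA bB) σ)
    (hE : Enough E (paramsOf s k k' n n' bA bB)) (hA : Encodes E.inp bA A)
    (hB : Encodes E.inp bB B) (hk : 1 ≤ k)
    (hV : σ.r .V = cap k k' n n') (hrow : k ^ k' < σ.r .row)
    (hH : σ.r .row + cap k k' n n' * cap k k' n n' + cap k k' n n' ≤ E.H)
    (hrZ : σ.r .row + cap k k' n n' * cap k k' n n' ≤ E.Z)
    {R : Set (ProdState k k' n n')} (hM : Marked R (σ.r .row) σ.h)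
    (hF : ∀ a, σ.r .row + cap k k' n n' ≤ a → σ.h a = 0)
    (hQ : ∀ σ', Agree [.f, .q, .g, .w, .p, .j, .u, .i, .err, .v, .y, .x, .row, .t] σ σ' →
      σ'.r .row = σ.r .row + cap k k' n n' * cap k k' n n' →
      Marked {w | ∃ z ∈ R, Walk (prodStep A B) (ProdBad B) (cap k k' n n') z w} (σ'.r .row) σ'.h →
      (∀ a, σ'.r .row + cap k k' n n' ≤ a → σ'.h a = 0) → Q σ') :
    wp E allRows σ Q := by
  have hpos : 0 < cap k k' n n' := Nat.pow_pos (by omega)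
  have hsq : cap k k' n n' ≤ cap k k' n n' * cap k k' n n' := Nat.le_mul_of_pos_left _ hpos
  refine ⟨Nat.zero_le _, ?_⟩
  refine wp_loop_count (cap k k' n n') (fun m σ' =>
    Agree [.f, .q, .g, .w, .p, .j, .u, .i, .err, .v, .y, .x, .row, .t] σ σ' ∧ σ'.r .t = m ∧
    σ'.r .row = σ.r .row + m * cap k k' n n' ∧
    Marked {w | ∃ z ∈ R, Walk (prodStep A B) (ProdBad B) m z w} (σ'.r .row) σ'.h ∧
    ∀ a, σ'.r .row + cap k k' n n' ≤ a → σ'.h a = 0)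
    (le_trans (by omega) hE.rounds) ?_ ?_ ?_
  · refine ⟨Agree.refl.set (by decide), by simp, by simp, ?_, by simpa using hF⟩
    refine Marked.congr (R := R) (by simpa using hM) ?_ fun _ _ => rfl
    ext w
    simp [Walk]
  · rintro m σ' hm ⟨h1, h2, h3, h4, h5⟩
    have hR' := hR.agree h1 (by decide)
    have hV' : σ'.r .V = cap k k' n n' := (h1 .V (by decide)).trans hV
    have hmul : (m + 1) * cap k k' n n' ≤ cap k k' n n' * cap k k' n n' :=
      Nat.mul_le_mul_right _ hm
    rw [add_one_mul] at hmul
    refine ⟨by simp [hV', h2]; omega, ?_⟩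
    refine wp_nextRow hR' hE hA hB hk (by omega) hV' (by omega) (by omega) (by omega) h4 h5
      fun σ₁ a1 b1 c1 d1 => ?_
    have t1 : σ₁.r .t = m := (a1 .t (by decide)).trans h2
    refine ⟨by simp [t1]; omega, (h1.trans a1 (by decide)).set (by decide), by simp [t1], ?_, ?_,
      ?_⟩
    · simp [b1, h3, add_one_mul]; omega
    · refine Marked.congr (R := successors A B {w | ∃ z ∈ R,
        Walk (prodStep A B) (ProdBad B) m z w}) (by simpa [b1] using c1) ?_ fun _ _ => rfl
      ext w
      simp only [successors, Set.mem_ofPred_eq, walk_succ_iff]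
      constructor
      · rintro ⟨y, ⟨z, g1, g2⟩, g3, v, g4⟩
        exact ⟨z, g1, y, v, g2, g3, g4⟩
      · rintro ⟨z, g1, y, v, g2, g3, g4⟩
        exact ⟨y, ⟨z, g1, g2⟩, g3, v, g4⟩
    · intro a ha
      simp [b1] at ha
      exact d1 a (by omega)
  · rintro σ' ⟨h1, h2, h3, h4, h5⟩
    have hV' : σ'.r .V = cap k k' n n' := (h1 .V (by decide)).trans hV
    exact ⟨by simp [hV', h2], hQ σ' h1 h3 h4 h5⟩

theorem wp_filter {Q : Store Reg → Prop} (hR : Ready (paramsOf s k k' n n' bA bB) σ)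
    (hE : Enough E (paramsOf s k k' n n' bA bB)) (hZ : cap k k' n n' ≤ E.Z)
    (hV : σ.r .V = cap k k' n n') (hH : σ.r .row + cap k k' n n' ≤ E.H)
    {R : Set (ProdState k k' n n')} (hM : Marked R (σ.r .row) σ.h)
    (hF : ∀ a, σ.r .row + cap k k' n n' ≤ a → σ.h a = 0)
    (hQ : ∀ σ', Agree [.x, .ans] σ σ' → σ'.r .ans ≤ 1 →
      (σ'.r .ans = 0 ↔ ∃ z ∈ R, z.1 = none) →
      Marked {z ∈ R | z.1 = none} (σ.r .row) σ'.h →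
      (∀ a, σ.r .row + cap k k' n n' ≤ a → σ'.h a = 0) → Q σ') :
    wp E filter σ Q := by
  refine ⟨hE.one, Nat.zero_le _, ?_⟩
  refine wp_loop_count (cap k k' n n') (fun m σ' => Agree [.x, .ans] σ σ' ∧ σ'.r .x = m ∧
    σ'.r .ans ≤ 1 ∧ (σ'.r .ans = 0 ↔ ∃ z ∈ R, z.1 = none ∧ enc z < m) ∧
    Marked {z ∈ R | enc z < m → z.1 = none} (σ.r .row) σ'.h ∧
    ∀ a, σ.r .row + cap k k' n n' ≤ a → σ'.h a = 0) (hZ.trans hE.rounds) ?_ ?_ ?_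
  · exact ⟨(Agree.refl.set (by decide)).set (by decide), by simp, by simp, by simp,
      hM.congr (by simp) fun _ _ => rfl, hF⟩
  · rintro m σ' hm ⟨h1, h2, h3, h4, h5, h6⟩
    have hR' := hR.agree h1 (by decide)
    have hV' : σ'.r .V = cap k k' n n' := (h1 .V (by decide)).trans hV
    have hrow' : σ'.r .row = σ.r .row := h1 .row (by decide)
    have hna : σ'.r .na = n := hR'.na
    have hbr : σ'.r .base = n + n' + 2 := hR'.base
    have hmark := h5 m hm
    have hmZ : m + 1 ≤ E.Z := by omega
    refine ⟨by simp [hV', h2]; omega, fun ht => ?_, fun ht => ?_⟩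
    · obtain ⟨z, ⟨hz, -⟩, hzm⟩ := hmark.1 (by simpa [hrow', h2] using ht)
      have huniq : ∀ w : ProdState k k' n n', enc w = m → w = z := fun w hw =>
        enc_injective (hw.trans hzm.symm)
      have hacc := fst_eq_none_iff z
      rw [← enc_div_top, hzm] at hacc
      refine ⟨fun ha => ?_, fun ha => ?_⟩
      · have hz0 : z.1 = none := hacc.2 (by simpa [h2, hV', hna, hbr] using ha)
        refine ⟨Nat.zero_le _, by simpa [h2] using hmZ, (h1.set (by decide)).set (by decide),
          by simp [h2], by simp, ?_, h5.congr ?_ fun _ _ => rfl, h6⟩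
        · simp only [set_r, reduceCtorEq, if_false, if_true, eval_zero, true_iff]
          exact ⟨z, hz, hz0, by omega⟩
        · ext w
          simp only [Set.mem_ofPred_eq]
          refine and_congr_right fun _ => ⟨fun h hw => ?_, fun h hw => h (by omega)⟩
          rcases Nat.lt_succ_iff_lt_or_eq.1 hw with hw | hw
          · exact h hw
          · rw [huniq w hw, hz0]
      · have hz0 : ¬ z.1 = none := fun h => hacc.1 h (by simpa [h2, hV', hna, hbr] using ha)
        refine ⟨by simp [hrow', h2]; omega, Nat.zero_le _, by simpa [h2] using hmZ,
          h1.put.set (by decide), by simp [h2], by simpa using h3, ?_, ?_, ?_⟩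
        · simp only [set_r, reduceCtorEq, if_false, put_r, h4]
          refine exists_congr fun w => and_congr_right fun _ => and_congr_right fun hw => ?_
          have : enc w ≠ m := fun h => hz0 (huniq w h ▸ hw)
          omega
        · intro y hy
          have hy' := h5 y hy
          by_cases hym : y = m
          · subst hym
            simp only [set_h, put_h, eval_add, eval_var, hrow', h2, if_true, eval_zero, ne_eq,
              not_true_eq_false, false_iff, Set.mem_ofPred_eq, not_exists, not_and]
            intro w hw hwy
            exact hz0 (huniq w hwy ▸ hw.2 (by omega))
          · simp only [set_h, put_h, eval_add, eval_var, hrow', h2]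
            rw [if_neg (by omega), hy']
            refine exists_congr fun w => ?_
            simp only [Set.mem_ofPred_eq]
            constructor
            · rintro ⟨⟨g1, g2⟩, rfl⟩
              exact ⟨⟨g1, fun h => g2 (by omega)⟩, rfl⟩
            · rintro ⟨⟨g1, g2⟩, rfl⟩
              exact ⟨⟨g1, fun h => g2 (by omega)⟩, rfl⟩
        · intro a ha
          simp only [set_h, put_h, eval_add, eval_var, hrow', h2]
          rw [if_neg (by omega)]
          exact h6 a ha
    · have hnm : ¬ ∃ z ∈ {z ∈ R | enc z < m → z.1 = none}, enc z = m :=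
        fun h => hmark.2 h (by simpa [hrow', h2] using ht)
      have hnm' : ∀ w ∈ R, enc w ≠ m := fun w hw h => hnm ⟨w, ⟨hw, fun h' => by omega⟩, h⟩
      refine ⟨by simp [h2]; omega, by simpa [h2] using hmZ, (h1.set (by decide)).set (by decide),
        by simp [h2], by simpa using h3, ?_, h5.congr ?_ fun _ _ => rfl, h6⟩
      · simp only [set_r, reduceCtorEq, if_false, h4]
        refine exists_congr fun w => and_congr_right fun hw => and_congr_right fun _ => ?_
        have := hnm' w hw
        omega
      · ext w
        simp only [Set.mem_ofPred_eq]
        refine and_congr_right fun hw => ?_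
        have h7 : enc w < m ↔ enc w < m + 1 := by
          have := hnm' w hw
          omega
        rw [h7]
  · rintro σ' ⟨h1, h2, h3, h4, h5, h6⟩
    have hV' : σ'.r .V = cap k k' n n' := (h1 .V (by decide)).trans hV
    refine ⟨by simp [hV', h2], hQ σ' h1 h3 (by simpa [enc_lt] using h4) (h5.congr ?_ fun _ _ => rfl)
      h6⟩
    ext w
    simp [enc_lt]

end HyperAut

namespace HyperAut

open Code

section Exploration

variable {E : Env} {σ : Store Reg} {s k k' n n' bA bB : ℕ} {A : DetAut (Fin k → Fin s) n}
  {B : DetAut (Fin k' → Fin s) n'}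

theorem Ready.given {P : Params} (h : Ready P σ) : Given P σ := ⟨h.s, h.ka, h.kb, h.bA, h.bB⟩

/-- The number of heap cells used by an exploration. -/
def tableSize (k k' n n' : ℕ) : ℕ :=
  k ^ k' + 1 + 2 * (cap k k' n n' * cap k k' n n') + cap k k' n n'

theorem wp_explore {Q : Store Reg → Prop} (hG : Given (paramsOf s k k' n n' bA bB) σ)
    (hE : Enough E (paramsOf s k k' n n' bA bB)) (hA : Encodes E.inp bA A)
    (hB : Encodes E.inp bB B) (hk : 1 ≤ k)
    (hZ : σ.r .row + tableSize k k' n n' ≤ E.Z) (hH : σ.r .row + tableSize k k' n n' ≤ E.H)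
    (hF : ∀ a, σ.r .row ≤ a → σ.h a = 0) (htot : σ.r .tot ≤ 1)
    (hQ : ∀ σ', Given (paramsOf s k k' n n' bA bB) σ' →
      σ'.r .row = σ.r .row + tableSize k k' n n' →
      (∀ a, σ'.r .row ≤ a → σ'.h a = 0) → σ'.r .tot ≤ 1 →
      (σ'.r .tot ≠ 0 ↔ σ.r .tot ≠ 0 ∧ ¬ Counterexample A.toNFA.accepts B.toNFA.accepts) →
      Q σ') :
    wp E explore σ Q := by
  unfold tableSize at hZ hH hQ
  have hpos : 0 < cap k k' n n' := Nat.pow_pos (by omega)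
  have hsq : cap k k' n n' ≤ cap k k' n n' * cap k k' n n' := Nat.le_mul_of_pos_left _ hpos
  have hb : n + n' + 2 ≤ E.Z := hE.base
  have hK : 2 * k ^ k' + 3 ≤ E.Z := hE.two_K
  have hrounds := hE.rounds
  have hCE := counterexample_iff_walk A B (L := cap k k' n n') le_rfl
  generalize hS : cap k k' n n' * cap k k' n n' = S at *
  refine wp_prepare hG hE hA.size hB.size fun σ₁ a1 b1 hR1 => ?_
  refine wp_start hR1 hE hA hB fun σ₂ a2 b2 c2 => ?_
  have hR2 := hR1.agree a2 (by decide)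
  have K2 : σ₂.r .K = k ^ k' := hR2.K
  have base2 : σ₂.r .base = n + n' + 2 := hR2.base
  have e2 := (a1.mono (l' := [.na, .nb, .pA, .pB, .K, .base, .u, .g, .p, .j, .f])
    (by decide)).trans a2 (by decide)
  have row2 : σ₂.r .row = σ.r .row := e2 .row (by decide)
  have hF2 : ∀ a, k ^ k' < a → σ.r .row ≤ a → σ₂.h a = 0 := fun a h1 h2 => by
    rw [c2 a h1, b1, hF a h2]
  refine ⟨by simp [row2, K2]; omega, by simp [base2]; omega, by simp [K2]; omega, ?_⟩
  refine wp_power ?_ ?_ hE.one ?_ fun σ₃ a3 b3 c3 => ?_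
  · simp [K2]; omega
  · simp [K2]; omega
  · intro m hm
    simp [K2] at hm
    simp only [set_r, reduceCtorEq, if_false, if_true, eval_var, base2]
    refine pow_le_of_le_pow (c := k ^ k' + 1) hE.one ?_ hm
    change cap k k' n n' ≤ E.Z
    omega
  have p3 : σ₃.r .p = cap k k' n n' := by simpa [K2, base2, cap] using c3
  have row3 : σ₃.r .row = σ.r .row + k ^ k' + 1 :=
    (a3 .row (by decide)).trans (by simp [row2, K2])
  have R3 : Ready (paramsOf s k k' n n' bA bB) (σ₃.set .V (cap k k' n n')) :=
    hR2.agree (((((Agree.refl (l := [.row, .u, .g, .p, .j, .V]).set (by decide)).set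
      (by decide)).set (by decide)).trans a3 (by decide)).set (by decide)) (by decide)
  have tot3 : σ₃.r .tot = σ.r .tot := (a3 .tot (by decide)).trans (by simp [e2 .tot (by decide)])
  refine ⟨by simp [p3]; omega, ?_⟩
  rw [eval_var, p3]
  refine wp_encode (z := prodStart A B) R3 hE (by omega) ?_ fun σ₄ a4 b4 c4 => ?_
  · intro i hi
    rw [set_h, b3]
    exact b2 i hi
  have R4 := R3.agree a4 (by decide)
  have row4 : σ₄.r .row = σ.r .row + k ^ k' + 1 := (a4 .row (by decide)).trans (by simp [row3])
  have V4 : σ₄.r .V = cap k k' n n' := (a4 .V (by decide)).trans (by simp)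
  have tot4 : σ₄.r .tot = σ.r .tot := (a4 .tot (by decide)).trans (by simp [tot3])
  have hl := enc_lt (prodStart A B)
  have haddr : (Expr.var Reg.row + .var .y).eval E.inp σ₄ =
      σ₄.r .row + enc (prodStart A B) := by simp [c4]
  have hh4 : ∀ a, σ₄.r .row ≤ a → σ₄.h a = 0 := fun a ha => by
    rw [b4, set_h, b3]
    exact hF2 a (by omega) (by omega)
  refine ⟨by rw [haddr]; omega, hE.one, ?_⟩
  rw [haddr]
  refine wp_allRows (σ := σ₄.put _ _) (R := {prodStart A B})
    (R4.agree (Agree.refl (l := [])) (by decide)) hE hA hB hk V4 ?_ ?_ ?_ ?_ ?_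
    fun σ₅ a5 b5 c5 d5 => ?_
  · rw [put_r]; omega
  · rw [put_r]; omega
  · rw [put_r]; omega
  · have h0 : Marked (∅ : Set (ProdState k k' n n')) (σ₄.r .row) σ₄.h := fun y _ => by
      simp [hh4 (σ₄.r .row + y) (by omega)]
    exact (h0.insert (prodStart A B)).congr (by simp) fun _ _ => rfl
  · intro a ha
    rw [put_r] at ha
    rw [put_h, if_neg (by omega)]
    exact hh4 a (by omega)
  rw [put_r, hS] at b5
  have R5 := R4.agree (σ' := σ₅) (Agree.trans (Agree.put Agree.refl) a5 (List.Subset.refl _))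
    (by decide)
  have V5 : σ₅.r .V = cap k k' n n' := (a5 .V (by decide)).trans V4
  have tot5 : σ₅.r .tot = σ.r .tot := (a5 .tot (by decide)).trans tot4
  refine wp_filter R5 hE (by omega) V5 (by omega) c5 d5 fun σ₆ a6 b6 c6 d6 e6 => ?_
  have R6 := R5.agree a6 (by decide)
  have V6 : σ₆.r .V = cap k k' n n' := (a6 .V (by decide)).trans V5
  have row6 : σ₆.r .row = σ₅.r .row := a6 .row (by decide)
  have tot6 : σ₆.r .tot = σ.r .tot := (a6 .tot (by decide)).trans tot5
  rw [← row6] at d6 e6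
  refine wp_allRows R6 hE hA hB hk V6 (by omega) (by omega) (by omega) d6 e6
    fun σ₇ a7 b7 c7 d7 => ?_
  rw [hS] at b7
  have R7 := R6.agree a7 (by decide)
  have V7 : σ₇.r .V = cap k k' n n' := (a7 .V (by decide)).trans V6
  have tot7 : σ₇.r .tot = σ.r .tot := (a7 .tot (by decide)).trans tot6
  refine wp_filter R7 hE (by omega) V7 (by omega) c7 d7 fun σ₈ a8 b8 c8 d8 e8 => ?_
  have R8 := R7.agree a8 (by decide)
  have V8 : σ₈.r .V = cap k k' n n' := (a8 .V (by decide)).trans V7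
  have row8 : σ₈.r .row = σ₇.r .row := a8 .row (by decide)
  have tot8 : σ₈.r .tot = σ.r .tot := (a8 .tot (by decide)).trans tot7
  have hans : σ₈.r .ans = 0 ↔ Counterexample A.toNFA.accepts B.toNFA.accepts := by
    rw [c8, hCE]
    constructor
    · rintro ⟨z, ⟨y, ⟨⟨x, rfl, h1⟩, h2⟩, h3⟩, h4⟩
      exact ⟨y, z, h1, h2, h3, h4⟩
    · rintro ⟨y, z, h1, h2, h3, h4⟩
      exact ⟨z, ⟨y, ⟨⟨_, rfl, h1⟩, h2⟩, h3⟩, h4⟩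
  have hmul : σ.r .tot * σ₈.r .ans ≤ 1 := by
    calc σ.r .tot * σ₈.r .ans ≤ 1 * 1 := Nat.mul_le_mul htot b8
      _ = 1 := rfl
  refine ⟨by simp [row8, V8]; omega, by simpa [tot8] using hmul.trans hE.one, hQ _ ?_ ?_ ?_ ?_ ?_⟩
  · exact (R8.agree ((Agree.refl.set (l := [.row, .tot]) (by decide)).set (by decide))
      (by decide)).given
  · simp [row8, V8]; omega
  · intro a ha
    simp [row8, V8] at ha
    exact e8 a (by omega)
  · simpa [tot8] using hmul
  · simp only [set_r, reduceCtorEq, if_false, if_true, eval_mul, eval_var, tot8, ne_eq,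
      mul_eq_zero, not_or, hans]

end Exploration

end HyperAut

namespace HyperAut

open Code

section Programs

variable {k' n' s k n : ℕ}

theorem mem_encodeAut_le {A : DetAut (Fin k → Fin s) n} {a : ℕ} (h : a ∈ encodeAut A) : a ≤ n := by
  have hn := A.start.2
  simp only [encodeAut, List.mem_cons, List.mem_append, List.mem_ofFn] at h
  rcases h with rfl | rfl | ⟨q, rfl⟩ | ⟨i, rfl⟩
  · exact le_rfl
  · exact hn.le
  · split <;> omega
  · exact getD_map_val_le _

/-- A bound for the values of the parameters. -/
def need (s k k' n n' : ℕ) : ℕ :=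
  s + k + k' + n + n' + n * s ^ k + n' * s ^ k' + s ^ k + s ^ k' + 2 * (k ^ k' + k' ^ k) + 8

variable (A : DetAut (Fin k → Fin s) n) (A' : DetAut (Fin k' → Fin s) n')

theorem getD_encodeInput_le (a : ℕ) : (encodeInput A A').getD a 0 ≤ need s k k' n n' := by
  unfold need
  rw [List.getD_eq_getElem?_getD]
  cases h : (encodeInput A A')[a]? with
  | none => simp
  | some c =>
    have := List.mem_of_getElem? h
    simp only [encodeInput, List.mem_cons, List.mem_append] at this
    simp only [Option.getD_some]
    rcases this with rfl | rfl | rfl | h | h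
    · omega
    · omega
    · omega
    · have := mem_encodeAut_le h; omega
    · have := mem_encodeAut_le h; omega

/-- The position of the second automaton in the input. -/
def position (s k n : ℕ) : ℕ := 3 + 2 + n + n * s ^ k

theorem encodes_fst : Encodes (encodeInput A A') 3 A :=
  encodes_append A [s, k, k'] (encodeAut A')

theorem encodes_snd : Encodes (encodeInput A A') (position s k n) A' := by
  have := encodes_append A' ([s, k, k'] ++ encodeAut A) []
  rw [List.append_nil, List.append_assoc] at this
  have hl : ([s, k, k'] ++ encodeAut A).length = position s k n := by
    simp [position]; omega
  rwa [hl] at this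

theorem enough_fst {E : Env} (hinp : E.inp = encodeInput A A') (hZ : need s k k' n n' ≤ E.Z)
    (hT : E.Z ≤ E.T) (hH : k ^ k' < E.H) :
    Enough E (paramsOf s k k' n n' 3 (position s k n)) := by
  have hi := fun a => (getD_encodeInput_le A A' a).trans hZ
  unfold need at hZ
  constructor
  all_goals try simp only [paramsOf, Params.K, Params.base, position, hinp]
  all_goals first | exact hi | exact hH | omega

theorem enough_snd {E : Env} (hinp : E.inp = encodeInput A A') (hZ : need s k k' n n' ≤ E.Z)
    (hT : E.Z ≤ E.T) (hH : k' ^ k < E.H) :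
    Enough E (paramsOf s k' k n' n (position s k n) 3) := by
  have hi := fun a => (getD_encodeInput_le A A' a).trans hZ
  unfold need at hZ
  constructor
  all_goals try simp only [paramsOf, Params.K, Params.base, position, hinp]
  all_goals first | exact hi | exact hH | omega

theorem wp_readInput_encodeInput {E : Env} {σ : Store Reg} {Q : Store Reg → Prop}
    (hinp : E.inp = encodeInput A A')
    (hE : Enough E (paramsOf s k k' n n' 3 (position s k n)))
    (hQ : ∀ σ', Agree [.s, .ka, .kb, .bA, .bB, .u, .g, .p, .j] σ σ' → σ'.h = σ.h →
      Given (paramsOf s k k' n n' 3 (position s k n)) σ' → Q σ') : wp E readInput σ Q := by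
  have h3 : E.inp.getD 3 0 = n := by rw [hinp]; exact (encodes_fst A A').size
  refine wp_readInput hE hE.bA ?_ ?_ ?_ rfl ?_ hQ
  · rw [hinp]; rfl
  · rw [hinp]; rfl
  · rw [hinp]; rfl
  · rw [h3]; rfl

theorem wp_exploreBoth {E : Env} (hk : 1 ≤ k) (hk' : 1 ≤ k') (hinp : E.inp = encodeInput A A')
    (hZ : need s k k' n n' ≤ E.Z) (hT : E.Z ≤ E.T)
    (hZ' : tableSize k k' n n' + tableSize k' k n' n ≤ E.Z) (hH : E.H = E.Z) :
    wp E exploreBoth ⟨fun _ => 0, fun _ => 0⟩ fun σ => σ.r .tot ≠ 0 ↔ RepEquiv A A' := by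
  have hE1 := enough_fst A A' hinp hZ hT (by unfold need at hZ; omega)
  have hE2 := enough_snd A A' hinp hZ hT (by unfold need at hZ; omega)
  have e1 := encodes_fst A A'
  have e2 := encodes_snd A A'
  rw [← hinp] at e1 e2
  refine ⟨hE1.one, ?_⟩
  refine wp_readInput_encodeInput A A' hinp hE1 fun σ₁ a1 b1 g1 => ?_
  have row1 : σ₁.r .row = 0 := (a1 .row (by decide)).trans (by simp)
  have tot1 : σ₁.r .tot = 1 := (a1 .tot (by decide)).trans (by simp)
  refine wp_explore g1 hE1 e1 e2 hk (by omega) (by omega) (fun a _ => by rw [b1]; rfl) (by omega)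
    fun σ₂ g2 row2 f2 tot2 t2 => ?_
  refine wp_swap (P' := paramsOf s k' k n' n (position s k n) 3) g2 hE1 rfl rfl rfl rfl rfl
    fun σ₃ a3 b3 g3 => ?_
  have row3 : σ₃.r .row = σ₂.r .row := a3 .row (by decide)
  have tot3 : σ₃.r .tot = σ₂.r .tot := a3 .tot (by decide)
  refine wp_explore g3 hE2 e2 e1 hk' (by omega) (by omega)
    (fun a ha => by rw [b3]; exact f2 a (by omega)) (by omega) fun σ₄ g4 row4 f4 tot4 t4 => ?_
  rw [t4, tot3, t2, tot1, repEquiv_iff]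
  simp

theorem not_counterexample_of_eq_zero (hs : s = 0) (hk : 1 ≤ k)
    (L : Language (Fin k → Fin s)) (L' : Language (Fin k' → Fin s)) : ¬ Counterexample L L' := by
  rintro ⟨τ, -⟩
  subst hs
  exact (τ 0 ⟨0, hk⟩).elim0

theorem wp_searchBoth {E : Env} (hk : 1 ≤ k) (hk' : 1 ≤ k') (hinp : E.inp = encodeInput A A')
    (hZ : need s k k' n n' ≤ E.Z) (hT : E.Z ≤ E.T) (hT1 : cap k k' n n' ≤ E.T)
    (hT2 : cap k' k n' n ≤ E.T) (hH : 2 * (k ^ k' + k' ^ k) + 2 < E.H) :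
    wp E searchBoth ⟨fun _ => 0, fun _ => 0⟩ fun σ =>
      bif E.dem then σ.r .ans = 0 → ¬ RepEquiv A A' else ¬ RepEquiv A A' → σ.r .ans = 0 := by
  have hE1 := enough_fst A A' hinp hZ hT (by omega)
  have hE2 := enough_snd A A' hinp hZ hT (by omega)
  have e1 := encodes_fst A A'
  have e2 := encodes_snd A A'
  rw [← hinp] at e1 e2
  refine wp_readInput_encodeInput A A' hinp hE1 fun σ₁ a1 b1 g1 => ?_
  have hG : ∀ b : Bool, Given (paramsOf s k k' n n' 3 (position s k n)) (σ₁.set .t b.toNat) :=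
    fun b => ⟨g1.s, g1.ka, g1.kb, g1.bA, g1.bB⟩
  refine wp_seq (wp_guess Bool.toNat hE1.one ?_ ?_)
  · intro v
    constructor
    · intro hv
      have hv' : v ≤ 1 := hv
      interval_cases v
      · exact ⟨false, rfl⟩
      · exact ⟨true, rfl⟩
    · rintro ⟨b, rfl⟩
      exact Bool.toNat_le b
  have key : ∀ b : Bool, wp E (.ite (.var .t) swap (.assign .t (.var .t))) (σ₁.set .t b.toNat)
      fun σ => wp E (.ite (.var .s) search (.assign .ans 1)) σ fun σ =>
        bif E.dem then σ.r .ans = 0 → (bif b then Counterexample A'.toNFA.accepts A.toNFA.accepts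
            else Counterexample A.toNFA.accepts A'.toNFA.accepts)
        else (bif b then Counterexample A'.toNFA.accepts A.toNFA.accepts
            else Counterexample A.toNFA.accepts A'.toNFA.accepts) → σ.r .ans = 0 := by
    intro b
    have hzero : ∀ σ : Store Reg, (Expr.var Reg.s).eval E.inp σ = 0 → σ.r .s = s →
        wp E (.assign Reg.ans 1) σ fun σ =>
          bif E.dem then σ.r .ans = 0 → (bif b then Counterexample A'.toNFA.accepts A.toNFA.accepts
            else Counterexample A.toNFA.accepts A'.toNFA.accepts)
          else (bif b then Counterexample A'.toNFA.accepts A.toNFA.accepts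
            else Counterexample A.toNFA.accepts A'.toNFA.accepts) → σ.r .ans = 0 := by
      intro σ h0 hs
      have hs0 : s = 0 := hs.symm.trans h0
      refine ⟨hE1.one, ?_⟩
      cases E.dem with
      | true => exact fun h => absurd h (by simp)
      | false =>
        intro hc
        cases b with
        | true => exact absurd hc (not_counterexample_of_eq_zero hs0 hk' _ _)
        | false => exact absurd hc (not_counterexample_of_eq_zero hs0 hk _ _)
    refine ⟨fun hb => ?_, fun hb => ?_⟩
    · obtain rfl : b = true := by
        cases b with
        | true => rfl
        | false => simp at hb
      refine wp_swap (P' := paramsOf s k' k n' n (position s k n) 3) (hG true) hE1 rfl rfl rfl rfl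
        rfl fun σ₂ a2 b2 g2 => ⟨fun hs => ?_, fun hs => hzero σ₂ hs g2.s⟩
      have hs' : 0 < s := Nat.pos_of_ne_zero fun h => hs (g2.s.trans h)
      exact wp_search g2 hE2 e2 e1 hs' (by omega) hT2 fun σ₃ h => h
    · obtain rfl : b = false := by
        cases b with
        | false => rfl
        | true => simp at hb
      refine ⟨by simp, fun hs => ?_, fun hs => hzero _ hs (by simpa [paramsOf] using g1.s)⟩
      have g2 : Given (paramsOf s k k' n n' 3 (position s k n)) ((σ₁.set .t false.toNat).set .t
          ((Expr.var Reg.t).eval E.inp (σ₁.set .t false.toNat))) :=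
        ⟨g1.s, g1.ka, g1.kb, g1.bA, g1.bB⟩
      have hs' : 0 < s := Nat.pos_of_ne_zero fun h => hs (g2.s.trans h)
      exact wp_search g2 hE1 e1 e2 hs' (by omega) hT1 fun σ₃ h => h
  rw [repEquiv_iff]
  cases hd : E.dem with
  | true =>
    simp only [hd, cond_true] at key
    intro b
    refine wp_mono (key b) fun σ₂ h h0 hr => ?_
    cases b with
    | true => exact hr.2 (h h0)
    | false => exact hr.1 (h h0)
  | false =>
    simp only [hd, cond_false] at key
    by_cases hC : Counterexample A.toNFA.accepts A'.toNFA.accepts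
    · exact ⟨false, wp_mono (key false) fun σ₂ h _ => h hC⟩
    · refine ⟨true, wp_mono (key true) fun σ₂ h hr => h ?_⟩
      by_contra hC'
      exact hr ⟨hC, hC'⟩

end Programs

/-! ### Polynomial bounds -/

section Bounds

theorem exists_polynomial_bound (s k k' : ℕ) : ∃ p : Polynomial ℕ, ∀ n n' : ℕ,
    need s k k' n n' + cap k k' n n' + cap k' k n' n + tableSize k k' n n' +
      tableSize k' k n' n ≤ p.eval (n + n') := by
  open Polynomial in
  let c : ℕ → ℕ[X] := fun e => (X + 2) ^ (e + 1)
  let d : ℕ → ℕ[X] := fun e => C (e + 1) + 2 * (c e * c e) + c e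
  refine ⟨Polynomial.C (s + k + k' + s ^ k + s ^ k' + 2 * (k ^ k' + k' ^ k) + 8) +
    Polynomial.C (s ^ k + s ^ k' + 1) * Polynomial.X + c (k ^ k') + c (k' ^ k) + d (k ^ k') +
    d (k' ^ k), fun n n' => ?_⟩
  have h1 : cap k k' n n' = (c (k ^ k')).eval (n + n') := by simp [c, cap]
  have h2 : cap k' k n' n = (c (k' ^ k)).eval (n + n') := by simp [c, cap, add_comm n' n]
  have h3 : tableSize k k' n n' = (d (k ^ k')).eval (n + n') := by
    simp only [d, tableSize, h1, Polynomial.eval_add, Polynomial.eval_mul, Polynomial.eval_C,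
      Polynomial.eval_ofNat]
  have h4 : tableSize k' k n' n = (d (k' ^ k)).eval (n + n') := by
    simp only [d, tableSize, h2, Polynomial.eval_add, Polynomial.eval_mul, Polynomial.eval_C,
      Polynomial.eval_ofNat]
  rw [Polynomial.eval_add, Polynomial.eval_add, Polynomial.eval_add, Polynomial.eval_add,
    Polynomial.eval_add, ← h1, ← h2, ← h3, ← h4]
  have h5 : need s k k' n n' ≤ (Polynomial.C (s + k + k' + s ^ k + s ^ k' +
      2 * (k ^ k' + k' ^ k) + 8)).eval (n + n') +
      (Polynomial.C (s ^ k + s ^ k' + 1) * Polynomial.X).eval (n + n') := by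
    simp only [need, Polynomial.eval_C, Polynomial.eval_mul, Polynomial.eval_X]
    nlinarith [Nat.zero_le (n * s ^ k'), Nat.zero_le (n' * s ^ k)]
  omega

theorem HaltsWithin.mono {P : Prog} {inp : List ℕ} {T T' : ℕ} (h : HaltsWithin P inp T)
    (hT : T ≤ T') : HaltsWithin P inp T' := fun t c hr => (h t c hr).trans hT

theorem WordsAtMost.mono {P : Prog} {inp : List ℕ} {W W' : ℕ} (h : WordsAtMost P inp W)
    (hW : W ≤ W') : WordsAtMost P inp W' := fun t c hr a => (h t c hr a).trans hW

theorem pow_le_max_pow_max {k k' : ℕ} (hk : 1 ≤ k) : k ^ k' ≤ max k k' ^ max k k' :=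
  (Nat.pow_le_pow_left (le_max_left k k') k').trans
    (Nat.pow_le_pow_right (by omega) (le_max_right k k'))

theorem need_le {s k k' n n' : ℕ} (hk : 1 ≤ k) (hk' : 1 ≤ k') (A : DetAut (Fin k → Fin s) n)
    (A' : DetAut (Fin k' → Fin s) n') :
    need s k k' n n' + 2 ≤ ((encodeInput A A').length + max k k' ^ max k k') ^ 2 := by
  have hN : (encodeInput A A').length = n + n * s ^ k + 2 + (n' + n' * s ^ k' + 2) + 3 := by
    simp [encodeInput]
  have hn : 1 ≤ n := by have := A.start.2; omega
  have hn' : 1 ≤ n' := by have := A'.start.2; omega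
  have h1 := pow_le_max_pow_max (k' := k') hk
  have h2 := pow_le_max_pow_max (k' := k) hk'
  rw [max_comm k' k] at h2
  have h3 : max k k' ≤ max k k' ^ max k k' := Nat.le_self_pow (by omega) _
  have h4 : s ^ k ≤ n * s ^ k := Nat.le_mul_of_pos_left _ hn
  have h5 : s ^ k' ≤ n' * s ^ k' := Nat.le_mul_of_pos_left _ hn'
  have h6 : s ≤ s ^ k := Nat.le_self_pow (by omega) _
  have h7 : k ≤ max k k' := le_max_left _ _
  have h8 : k' ≤ max k k' := le_max_right _ _
  generalize hM : max k k' ^ max k k' = M at *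
  generalize hL : (encodeInput A A').length = N at *
  have h9 : need s k k' n n' + 2 ≤ 9 * (N + M) := by unfold need; omega
  have h10 : 9 * (N + M) ≤ (N + M) ^ 2 := by
    rw [sq]
    exact Nat.mul_le_mul_right _ (by omega)
  exact h9.trans h10

theorem two_rpow_mul_logb {k k' : ℕ} (hk : 1 ≤ k) (hk' : 1 ≤ k') (C : ℕ) :
    (2 : ℝ) ^ ((C : ℝ) * (max (Real.logb 2 k) (Real.logb 2 k') * max (k : ℝ) k')) =
      (((max k k' ^ max k k') ^ C : ℕ) : ℝ) := by
  have hlog : max (Real.logb 2 k) (Real.logb 2 k') = Real.logb 2 (max k k' : ℕ) := by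
    have hk0 : (0 : ℝ) < k := by exact_mod_cast hk
    have hk0' : (0 : ℝ) < k' := by exact_mod_cast hk'
    rcases le_total k k' with h | h
    · rw [max_eq_right h, max_eq_right]
      exact Real.logb_le_logb_of_le (by norm_num) hk0 (by exact_mod_cast h)
    · rw [max_eq_left h, max_eq_left]
      exact Real.logb_le_logb_of_le (by norm_num) hk0' (by exact_mod_cast h)
  have hpos : (0 : ℝ) < (max k k' : ℕ) := by exact_mod_cast lt_of_lt_of_le hk (le_max_left k k')
  rw [hlog, show max (k : ℝ) k' = (max k k' : ℕ) by push_cast; rfl,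
    show (C : ℝ) * (Real.logb 2 (max k k' : ℕ) * (max k k' : ℕ)) =
      Real.logb 2 (max k k' : ℕ) * ((max k k' * C : ℕ) : ℝ) by push_cast; ring,
    Real.rpow_mul (by norm_num), Real.rpow_logb (by norm_num) (by norm_num) hpos,
    Real.rpow_natCast, pow_mul]
  push_cast
  rfl

end Bounds

end HyperAut

open HyperAut in
/-- Representation-equivalence of deterministic finite automata of arities `k`, `k'` is decided
by a deterministic program in polynomial time (in the total number of states), and by an
on-the-fly search, a program with nondeterministic choices, that runs in polynomial time and
in space `2 ^ O(max (log k) (log k') * max k k')` at the same time. -/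
theorem mainTheorem4 :
    (∃ P : Prog, P.Deterministic ∧
      ∀ s k k' : ℕ, 1 ≤ k → 1 ≤ k' → ∃ p : Polynomial ℕ,
        ∀ (n n' : ℕ) (A : DetAut (Fin k → Fin s) n) (A' : DetAut (Fin k' → Fin s) n'),
          HaltsWithin P (encodeInput A A') (p.eval (n + n')) ∧
          WordsAtMost P (encodeInput A A') (p.eval (n + n')) ∧
          (AnswersYes P (encodeInput A A') ↔ RepEquiv A A')) ∧
    (∃ (P : Prog) (C : ℕ),
      ∀ s k k' : ℕ, 1 ≤ k → 1 ≤ k' → ∃ p : Polynomial ℕ,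
        ∀ (n n' : ℕ) (A : DetAut (Fin k → Fin s) n) (A' : DetAut (Fin k' → Fin s) n'),
          HaltsWithin P (encodeInput A A') (p.eval (n + n')) ∧
          SpaceAtMost P (encodeInput A A')
            (C * 2 ^ ((C : ℝ) * (max (Real.logb 2 k) (Real.logb 2 k') * max (k : ℝ) k'))) ∧
          WordsAtMost P (encodeInput A A')
            (((encodeInput A A').length + max k k' ^ max k k') ^ C) ∧
          (AnswersYes P (encodeInput A A') ↔ RepEquiv A A')) := by
  constructor
  · obtain ⟨P, C, q, hdet, h⟩ := Code.exploreBoth.exists_prog Reg.tot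
    refine ⟨P, hdet ?_, fun s k k' hk hk' => ?_⟩
    · simp [Code.exploreBoth, Code.readInput, Code.explore, Code.swap, Code.prepare, Code.start,
        Code.power, Code.encode, Code.allRows, Code.filter, Code.nextRow, Code.markSuccessors,
        Code.decode, Code.move, Code.getLetter, Stm.NoGuess]
    obtain ⟨p, hp⟩ := exists_polynomial_bound s k k'
    refine ⟨q.comp p + (p + 2) ^ C, fun n n' A A' => ?_⟩
    have hZ := hp n n'
    have hn : need s k k' n n' ≤ p.eval (n + n') := by omega
    have hwp : ∀ dem, wp ⟨encodeInput A A', p.eval (n + n'), p.eval (n + n'), p.eval (n + n'), dem⟩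
        Code.exploreBoth ⟨fun _ => 0, fun _ => 0⟩ fun σ => σ.r .tot ≠ 0 ↔ RepEquiv A A' :=
      fun dem => wp_exploreBoth A A' hk hk' rfl hn le_rfl
        (show _ ≤ p.eval (n + n') by omega) rfl
    obtain ⟨h1, h2⟩ := h (encodeInput A A') (p.eval (n + n')) (p.eval (n + n')) (p.eval (n + n'))
      fun a => (getD_encodeInput_le A A' a).trans hn
    obtain ⟨ht, hw, -, hyes⟩ := h1 _ (hwp true)
    obtain ⟨t, M, hr, σ, hM, hσ⟩ := h2 _ (hwp false)
    refine ⟨ht.mono ?_, hw.mono ?_, fun hans => ?_, fun hrep t M hr => ?_⟩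
    · rw [Polynomial.eval_add, Polynomial.eval_comp]
      exact Nat.le_add_right _ _
    · rw [Polynomial.eval_add, Polynomial.eval_pow, Polynomial.eval_add, Polynomial.eval_ofNat]
      exact Nat.le_add_left _ _
    · exact hσ.1 (hM ▸ hans t M hr)
    · obtain ⟨σ, hM, hσ⟩ := hyes t M hr
      rw [hM]
      exact hσ.2 hrep
  · obtain ⟨P, C, q, -, h⟩ := Code.searchBoth.exists_prog Reg.ans
    refine ⟨P, 2 * C + 7, fun s k k' hk hk' => ?_⟩
    obtain ⟨p, hp⟩ := exists_polynomial_bound s k k'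
    refine ⟨q.comp p, fun n n' A A' => ?_⟩
    have hZ := hp n n'
    have hwp : ∀ dem, wp ⟨encodeInput A A', need s k k' n n', 2 * (k ^ k' + k' ^ k) + 3,
        p.eval (n + n'), dem⟩ Code.searchBoth ⟨fun _ => 0, fun _ => 0⟩ fun σ =>
          bif dem then σ.r .ans = 0 → ¬ RepEquiv A A' else ¬ RepEquiv A A' → σ.r .ans = 0 :=
      fun dem => wp_searchBoth A A' hk hk' rfl le_rfl
        (show need s k k' n n' ≤ p.eval (n + n') by omega)
        (show _ ≤ p.eval (n + n') by omega) (show _ ≤ p.eval (n + n') by omega)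
        (show _ < 2 * (k ^ k' + k' ^ k) + 3 by omega)
    obtain ⟨h1, h2⟩ := h (encodeInput A A') (need s k k' n n') (2 * (k ^ k' + k' ^ k) + 3)
      (p.eval (n + n')) (getD_encodeInput_le A A')
    obtain ⟨ht, hw, hs, hyes⟩ := h1 _ (hwp true)
    obtain ⟨t, M, hr, σ, hM, hσ⟩ := h2 _ (hwp false)
    have hM1 : 1 ≤ max k k' ^ max k k' := Nat.one_le_pow _ _ (by omega)
    refine ⟨ht.mono ?_, fun t c hr a ha => hs t c hr a ?_, hw.mono ?_, fun hans => ?_,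
      fun hrep t M hr h0 => ?_⟩
    · rw [Polynomial.eval_comp]
    · rw [two_rpow_mul_logb hk hk'] at ha
      have ha' : (2 * C + 7) * (max k k' ^ max k k') ^ (2 * C + 7) ≤ a := by exact_mod_cast ha
      have h3 := pow_le_max_pow_max (k' := k') hk
      have h4 := pow_le_max_pow_max (k' := k) hk'
      rw [max_comm k' k] at h4
      have h5 : max k k' ^ max k k' ≤ (max k k' ^ max k k') ^ (2 * C + 7) :=
        Nat.le_self_pow (by omega) _
      generalize max k k' ^ max k k' = m at *
      have h6 : (2 * C + 7) * m ≤ a := (Nat.mul_le_mul_left _ h5).trans ha'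
      have h7 : C ≤ C * m := Nat.le_mul_of_pos_right _ hM1
      nlinarith
    · refine (Nat.pow_le_pow_left (need_le hk hk' A A') C).trans ?_
      rw [← pow_mul]
      exact Nat.pow_le_pow_right (by omega) (by omega)
    · by_contra hrep
      exact hans t M hr (hM.trans (hσ hrep))
    · obtain ⟨σ, hM, hσ⟩ := hyes t M hr
      exact hσ (hM.symm.trans h0) hrep
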